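/- Throughout, the model is the randomized word RAM: a fixed program (not depending on the input) works on words of $\Theta(\log n+\log|\Sigma|)$ bits, elementary word operations (addition, truncated subtraction, multiplication, division with remainder, comparison, indirect memory access, reading one character of an input string at a computed position, drawing a uniformly random word) take unit time, and the input strings are given by random access without any preprocessing. $\mathrm{ED}(A,B)$ denotes the edit distance, i.e. the least number of single-character insertions, deletions and substitutions that turn $A$ into $B$. **Theorem.** There are a program $P$ of the randomized word RAM and constants $c\in\mathbb N$, $C>0$ such that the following holds for all integers $n,k,\ell$ with $1\le k\le n$ and $\sqrt k\le \ell\le n$, every finite alphabet $\Sigma=\{0,\dots,|\Sigma|-1\}$ and all strings $A,B\in\Sigma^n$. Given $n,|\Sigma|,k,\ell$ and random access to $A$ and $B$: 1. $P$ always halts after at most $C\log^c(n+2)\cdot\dfrac{(n+k^2)\sqrt k}{\ell}$ steps, whatever the random words are; 2. if $\mathrm{ED}(A,B)\le \dfrac{k}{C\log^c(n+2)}$, then $P$ outputs SMALL with probability at least $1-\frac1n$; 3. if $\mathrm{ED}(A,B)\ge C\,k\ell$, then $P$ outputs LARGE with probability at least $1-\frac1n$. That is, one can distinguish $\mathrm{ED}(A,B)\le\tilde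 O(k)$ from $\mathrm{ED}(A,B)\ge\tilde\Omega(k\ell)$ in $\tilde O\big((n+k^2)\sqrt k/\ell\big)$ time with probability at least $1-\frac1n$. -/

import Mathlib

open MeasureTheory

/-! ## Edit distance -/

/-- One edit operation on a string: insert, delete or substitute a single character. -/
inductive EditStep {α : Type*} : List α → List α → Prop
  | insert (u v : List α) (a : α) : EditStep (u ++ v) (u ++ a :: v)
  | delete (u v : List α) (a : α) : EditStep (u ++ a :: v) (u ++ v)
  | subst (u v : List α) (a b : α) : EditStep (u ++ a :: v) (u ++ b :: v)

/-- `EditsIn d x y`: the string `x` can be turned into `y` by exactly `d` edit operations. -/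
inductive EditsIn {α : Type*} : ℕ → List α → List α → Prop
  | refl (x : List α) : EditsIn 0 x x
  | tail {d : ℕ} {x y z : List α} : EditsIn d x y → EditStep y z → EditsIn (d + 1) x z

/-- The edit distance: the least number of insertions, deletions and substitutions
that turn `x` into `y`. -/
noncomputable def editDist {α : Type*} (x y : List α) : ℕ :=
  sInf {d | EditsIn d x y}

theorem EditsIn.trans {α : Type*} {d e : ℕ} {x y z : List α}
    (h : EditsIn d x y) (h' : EditsIn e y z) : EditsIn (d + e) x z := by
  induction h' with
  | refl => exact h
  | tail _ st ih => exact EditsIn.tail (ih h) st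

/-- Any string can be turned into any other one, so the infimum in `editDist` is attained. -/
theorem exists_editsIn {α : Type*} (x y : List α) : ∃ d, EditsIn d x y := by
  have del : ∀ x : List α, ∃ d, EditsIn d x [] := by
    intro x
    induction x with
    | nil => exact ⟨0, .refl _⟩
    | cons a x ih =>
      obtain ⟨d, hd⟩ := ih
      exact ⟨_, EditsIn.trans (.tail (.refl _) (EditStep.delete [] x a)) hd⟩
  have ins : ∀ y : List α, ∃ d, EditsIn d [] y := by
    intro y
    induction y with
    | nil => exact ⟨0, .refl _⟩
    | cons a y ih =>
      obtain ⟨d, hd⟩ := ih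
      exact ⟨_, EditsIn.tail hd (EditStep.insert [] y a)⟩
  obtain ⟨d, hd⟩ := del x
  obtain ⟨e, he⟩ := ins y
  exact ⟨_, hd.trans he⟩

theorem editsIn_editDist {α : Type*} (x y : List α) : EditsIn (editDist x y) x y :=
  Nat.sInf_mem (s := {d | EditsIn d x y}) (exists_editsIn x y)

/-! ## A randomized word RAM with random access to two read-only input strings -/

namespace WordRAM

/-- The arithmetic and comparison operations on words. -/
inductive Op
  | add | sub | mul | div | mod | lt | eq

/-- Expressions: constants, registers, operations, memory cells (indirect addressing) and
characters of the two input strings, at a computed position. -/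
inductive Expr
  | const (v : ℕ)
  | reg (x : ℕ)
  | op (o : Op) (a b : Expr)
  | load (a : Expr)
  | charA (a : Expr)
  | charB (a : Expr)

/-- Programs. A program is a finite object and uses finitely many registers. -/
inductive Cmd
  /-- `x := a` -/
  | assign (x : ℕ) (a : Expr)
  /-- `mem[a] := b` -/
  | store (a b : Expr)
  /-- `x :=` a fresh uniformly random word -/
  | rand (x : ℕ)
  | seq (p q : Cmd)
  /-- `if a ≠ 0 then p else q` -/
  | ite (a : Expr) (p q : Cmd)
  /-- `while a ≠ 0 do p` -/
  | while (a : Expr) (p : Cmd)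

/-- What a run of a program depends on, apart from the initial registers: the word size in bits,
the two input strings (as functions of the position), and the sequence of random words. -/
structure Env where
  wordSize : ℕ
  charA : ℕ → ℕ
  charB : ℕ → ℕ
  coin : ℕ → Fin (2 ^ wordSize)

/-- Registers, memory, and the number of random words drawn so far. -/
structure State where
  reg : ℕ → ℕ
  mem : ℕ → ℕ
  drawn : ℕ

/-- Value of an operation before reduction modulo the word length; subtraction is truncated at
`0`, division by `0` gives `0`, and comparisons give `1` (true) or `0` (false). -/
def Op.eval : Op → ℕ → ℕ → ℕ
  | .add, a, b => a + b
  | .sub, a, b => a - b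
  | .mul, a, b => a * b
  | .div, a, b => a / b
  | .mod, a, b => a % b
  | .lt, a, b => if a < b then 1 else 0
  | .eq, a, b => if a = b then 1 else 0

/-- Value of an expression; every computed value is reduced modulo `2 ^ wordSize`. -/
def Expr.eval (E : Env) (s : State) : Expr → ℕ
  | .const v => v % 2 ^ E.wordSize
  | .reg x => s.reg x
  | .op o a b => o.eval (a.eval E s) (b.eval E s) % 2 ^ E.wordSize
  | .load a => s.mem (a.eval E s)
  | .charA a => E.charA (a.eval E s)
  | .charB a => E.charB (a.eval E s)

/-- Time to evaluate an expression: one step for every node. -/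
def Expr.cost : Expr → ℕ
  | .const _ => 1
  | .reg _ => 1
  | .op _ a b => a.cost + b.cost + 1
  | .load a => a.cost + 1
  | .charA a => a.cost + 1
  | .charB a => a.cost + 1

/-- `Exec E p s s' t`: started in the state `s`, the program `p` halts in the state `s'`
after `t` steps. -/
inductive Exec (E : Env) : Cmd → State → State → ℕ → Prop
  | assign (x : ℕ) (a : Expr) (s : State) :
      Exec E (.assign x a) s { s with reg := Function.update s.reg x (a.eval E s) } (a.cost + 1)
  | store (a b : Expr) (s : State) :
      Exec E (.store a b) s
        { s with mem := Function.update s.mem (a.eval E s) (b.eval E s) } (a.cost + b.cost + 1)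
  | rand (x : ℕ) (s : State) :
      Exec E (.rand x) s
        { s with reg := Function.update s.reg x (E.coin s.drawn), drawn := s.drawn + 1 } 1
  | seq {p q : Cmd} {s s' s'' : State} {t t' : ℕ} :
      Exec E p s s' t → Exec E q s' s'' t' → Exec E (.seq p q) s s'' (t + t')
  | ite_true {a : Expr} {p q : Cmd} {s s' : State} {t : ℕ} :
      a.eval E s ≠ 0 → Exec E p s s' t → Exec E (.ite a p q) s s' (a.cost + 1 + t)
  | ite_false {a : Expr} {p q : Cmd} {s s' : State} {t : ℕ} :
      a.eval E s = 0 → Exec E q s s' t → Exec E (.ite a p q) s s' (a.cost + 1 + t)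
  | while_true {a : Expr} {p : Cmd} {s s' s'' : State} {t t' : ℕ} :
      a.eval E s ≠ 0 → Exec E p s s' t → Exec E (.while a p) s' s'' t' →
      Exec E (.while a p) s s'' (a.cost + 1 + t + t')
  | while_false {a : Expr} {p : Cmd} {s : State} :
      a.eval E s = 0 → Exec E (.while a p) s s (a.cost + 1)

/-- For given random words a run has at most one outcome. -/
theorem Exec.unique {E : Env} {p : Cmd} {s s₁ : State} {t₁ : ℕ} (h₁ : Exec E p s s₁ t₁) :
    ∀ {s₂ : State} {t₂ : ℕ}, Exec E p s s₂ t₂ → s₁ = s₂ ∧ t₁ = t₂ := by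
  induction h₁ with
  | assign => intro _ _ h; cases h; exact ⟨rfl, rfl⟩
  | store => intro _ _ h; cases h; exact ⟨rfl, rfl⟩
  | rand => intro _ _ h; cases h; exact ⟨rfl, rfl⟩
  | seq _ _ ih ih' =>
    intro _ _ h
    cases h with
    | seq g g' =>
      obtain ⟨rfl, rfl⟩ := ih g
      obtain ⟨rfl, rfl⟩ := ih' g'
      exact ⟨rfl, rfl⟩
  | ite_true ha _ ih =>
    intro _ _ h
    cases h with
    | ite_true _ g => obtain ⟨rfl, rfl⟩ := ih g; exact ⟨rfl, rfl⟩
    | ite_false hb _ => exact absurd hb ha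
  | ite_false ha _ ih =>
    intro _ _ h
    cases h with
    | ite_true hb _ => exact absurd ha hb
    | ite_false _ g => obtain ⟨rfl, rfl⟩ := ih g; exact ⟨rfl, rfl⟩
  | while_true ha _ _ ih ih' =>
    intro _ _ h
    cases h with
    | while_true _ g g' =>
      obtain ⟨rfl, rfl⟩ := ih g
      obtain ⟨rfl, rfl⟩ := ih' g'
      exact ⟨rfl, rfl⟩
    | while_false hb => exact absurd hb ha
  | while_false ha =>
    intro _ _ h
    cases h with
    | while_true hb _ _ => exact absurd ha hb
    | while_false _ => exact ⟨rfl, rfl⟩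

/-- The law of the random words: independent, uniform on all words of `w` bits. -/
noncomputable def coinLaw (w : ℕ) : Measure (ℕ → Fin (2 ^ w)) :=
  Measure.infinitePi fun _ => (PMF.uniformOfFintype (Fin (2 ^ w))).toMeasure

end WordRAM

/-! ## Algorithms for gap edit distance -/

/-- The character at position `i` (counted from `0`) of a string of length `n` over the alphabet
`{0, …, σ - 1}`; positions out of range hold the extra symbol `σ`. -/
def charAt {n σ : ℕ} (A : Fin n → Fin σ) (i : ℕ) : ℕ :=
  if h : i < n then A ⟨i, h⟩ else σ

/-- Words of `κ` times the bit length of `n + σ`, that is, of `Θ(log n + log σ)` bits. -/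
def wordBits (κ n σ : ℕ) : ℕ := κ * Nat.size (n + σ)

/-- The environment of a run on the input strings `A`, `B`, with random words `ω`. -/
def gapEnv (κ : ℕ) {n σ : ℕ} (A B : Fin n → Fin σ)
    (ω : ℕ → Fin (2 ^ wordBits κ n σ)) : WordRAM.Env where
  wordSize := wordBits κ n σ
  charA := charAt A
  charB := charAt B
  coin := ω

/-- At the start the registers `0, 1, 2, 3` hold `n, σ, k, ℓ`; all other registers and the whole
memory are `0`. In particular nothing about `A` and `B` has been preprocessed. -/
def gapInit (n σ k ℓ : ℕ) : WordRAM.State where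
  reg := fun x => if x = 0 then n else if x = 1 then σ else if x = 2 then k
    else if x = 3 then ℓ else 0
  mem := fun _ => 0
  drawn := 0

/-- With the random words `ω`, the program halts after at most `T` steps. -/
def HaltsWithin (P : WordRAM.Cmd) (κ k ℓ : ℕ) {n σ : ℕ} (A B : Fin n → Fin σ)
    (ω : ℕ → Fin (2 ^ wordBits κ n σ)) (T : ℝ) : Prop :=
  ∃ (s : WordRAM.State) (t : ℕ),
    WordRAM.Exec (gapEnv κ A B ω) P (gapInit n σ k ℓ) s t ∧ (t : ℝ) ≤ T

/-- The two possible answers: small or large edit distance. -/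
inductive Answer
  | small | large

/-- The encoding of the answers in register `0`. -/
def Answer.code : Answer → ℕ
  | .small => 1
  | .large => 0

/-- With the random words `ω`, the program halts with the answer `b` in register `0`. -/
def Outputs (P : WordRAM.Cmd) (κ k ℓ : ℕ) {n σ : ℕ} (A B : Fin n → Fin σ)
    (ω : ℕ → Fin (2 ^ wordBits κ n σ)) (b : Answer) : Prop :=
  ∃ (s : WordRAM.State) (t : ℕ),
    WordRAM.Exec (gapEnv κ A B ω) P (gapInit n σ k ℓ) s t ∧ s.reg 0 = b.code

/-- The probability, over the random words, that the program answers `b`. -/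
noncomputable def probOutputs (P : WordRAM.Cmd) (κ k ℓ : ℕ) {n σ : ℕ} (A B : Fin n → Fin σ)
    (b : Answer) : ENNReal :=
  WordRAM.coinLaw (wordBits κ n σ) {ω | Outputs P κ k ℓ A B ω b}

/-- Edit distance of two strings of length `n`. -/
noncomputable def stringED {n σ : ℕ} (A B : Fin n → Fin σ) : ℕ :=
  editDist (List.ofFn A) (List.ofFn B)

/-! ## Costs of shift paths -/

/-! Edit distance is replaced by a cost of paths. A path gives every position `i` of `A` a shift `p
i` in `[0, 2K]`, stored with offset `K`, and pays 1 whenever `A[i]` and `B[i + p i - K]` differ,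
plus the total variation of `p`. If `2 ED ≤ K`, the least cost is at most `2 ED`
(`cheap_of_stringED`); conversely `ED` is at most the least cost plus `4K` (`stringED_le_minCost`).
Put `r = ⌊√k⌋` and `K = r²`. If `n ≤ 2Kℓ`, no input has distance `17kℓ`, and SMALL is a safe answer.

Otherwise the positions are cut into a dyadic hierarchy of blocks, of lengths from about `K` up to
about `n/ℓ`. Glueing two blocks costs at most one jump `2K`, so the total cost is `O(K)` times the
number `J = O(ℓ)` of top blocks plus the number of heavy blocks (cost at least `2K`) on the levels
above the lowest. A cost above `12Kℓ` therefore forces some level to have at least `ℓ/U` heavy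
blocks, where `U` is the top level (`exists_level_heavyBlocks`). Level `u` has `J·2^(U-u)` blocks,
and `L·2^(U-u)` random samples with `L` about `log² n` hit a heavy one with high probability.

A sampled block is tested on one random position from every group of `g ≈ r / log n` positions; a
dynamic program finds the least cost counting only mismatches at these positions, and the block is
flagged if this is at least `r`. Unless the sample misses a stretch with `r` mismatches on one
diagonal, the true cost of a path is at most `(r+1)` times its sampled cost plus `r`
(`pathCost_le_sampled`), so an unflagged block costs less than `2r² = 2K`: heavy blocks get flagged.
In the other direction sampling only lowers costs, so flagged blocks cost at least `r`. If `ED = d`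
is small, at most `2d/r` blocks of a level are that expensive, and since `J > ℓ/2 ≥ r/2` (this is
where `√k ≤ ℓ` enters) one run flags something with probability at most 1/2. The search is repeated
about `log n` times, and the answer is SMALL if some run flags nothing.

On every level the sampled blocks contain `L·2^U·G` groups in total, where `G` is the number of
groups in a lowest block, and each group costs `O(K)` for one sweep over all shifts. As `2^U·G·g =
O(n/ℓ)` and `K/g` is about `√k log n`, the time is `n√k/ℓ` up to logarithms. -/

/-- The cost of the path of shifts `p` on the positions `x ≤ i < y`: the local costs `c i (p i)`
plus the total variation. -/
def pathCost (c : ℕ → ℕ → ℕ) (p : ℕ → ℕ) (x y : ℕ) : ℕ :=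
  ∑ i ∈ Finset.Ico x y, (c i (p i) + Nat.dist (p i) (p (i + 1)))

/-- There is a path with shifts at most `k` that costs at most `D` on `x ≤ i < y`. -/
def Cheap (c : ℕ → ℕ → ℕ) (k x y D : ℕ) : Prop :=
  ∃ p : ℕ → ℕ, (∀ i, p i ≤ k) ∧ pathCost c p x y ≤ D

/-- The least cost of a path with shifts at most `k` on `x ≤ i < y`. -/
noncomputable def minCost (c : ℕ → ℕ → ℕ) (k x y : ℕ) : ℕ := sInf {D | Cheap c k x y D}

theorem Nat.dist_le_of_le {a b k : ℕ} (ha : a ≤ k) (hb : b ≤ k) : Nat.dist a b ≤ k := by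
  unfold Nat.dist; omega

theorem pathCost_self (c : ℕ → ℕ → ℕ) (p : ℕ → ℕ) (x : ℕ) : pathCost c p x x = 0 := by
  simp [pathCost]

theorem pathCost_add (c : ℕ → ℕ → ℕ) (p : ℕ → ℕ) {x y z : ℕ} (h : x ≤ y) (h' : y ≤ z) :
    pathCost c p x y + pathCost c p y z = pathCost c p x z :=
  Finset.sum_Ico_consecutive _ h h'

theorem pathCost_succ (c : ℕ → ℕ → ℕ) (p : ℕ → ℕ) {x y : ℕ} (h : x ≤ y) :
    pathCost c p x (y + 1) = pathCost c p x y + (c y (p y) + Nat.dist (p y) (p (y + 1))) :=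
  Finset.sum_Ico_succ_top h _

theorem pathCost_congr {c c' : ℕ → ℕ → ℕ} {p p' : ℕ → ℕ} {x y : ℕ}
    (hc : ∀ i, x ≤ i → i < y → c i = c' i) (hp : ∀ i, x ≤ i → i ≤ y → p i = p' i) :
    pathCost c p x y = pathCost c' p' x y := by
  refine Finset.sum_congr rfl fun i hi => ?_
  rw [Finset.mem_Ico] at hi
  rw [hc i hi.1 hi.2, hp i hi.1 hi.2.le, hp (i + 1) (by omega) (by omega)]

theorem pathCost_mono {c c' : ℕ → ℕ → ℕ} (p : ℕ → ℕ) (x y : ℕ) (h : ∀ i s, c i s ≤ c' i s) :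
    pathCost c p x y ≤ pathCost c' p x y :=
  Finset.sum_le_sum fun _ _ => Nat.add_le_add_right (h _ _) _

theorem dist_le_pathCost (c : ℕ → ℕ → ℕ) (p : ℕ → ℕ) {x y : ℕ} (h : x ≤ y) :
    Nat.dist (p x) (p y) ≤ pathCost c p x y := by
  induction y, h using Nat.le_induction with
  | base => simp [Nat.dist_self]
  | succ y h ih =>
    rw [pathCost_succ c p h]
    have := Nat.dist.triangle_inequality (p x) (p y) (p (y + 1))
    omega

theorem cheap_length {c : ℕ → ℕ → ℕ} (hc : ∀ i s, c i s ≤ 1) (k x y : ℕ) :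
    Cheap c k x y (y - x) := by
  refine ⟨fun _ => 0, fun _ => Nat.zero_le _, ?_⟩
  have : ∀ i ∈ Finset.Ico x y, c i 0 + Nat.dist 0 0 ≤ 1 := by
    simpa [Nat.dist_self] using fun i _ _ => hc i 0
  simpa [pathCost] using Finset.sum_le_card_nsmul _ _ _ this

theorem cheap_minCost {c : ℕ → ℕ → ℕ} (k x y : ℕ) : Cheap c k x y (minCost c k x y) :=
  Nat.sInf_mem (s := {D | Cheap c k x y D})
    ⟨pathCost c (fun _ => 0) x y, fun _ => 0, fun _ => Nat.zero_le _, le_rfl⟩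

theorem minCost_le {c : ℕ → ℕ → ℕ} {k x y D : ℕ} (h : Cheap c k x y D) :
    minCost c k x y ≤ D := Nat.sInf_le h

theorem minCost_le_length {c : ℕ → ℕ → ℕ} (hc : ∀ i s, c i s ≤ 1) (k x y : ℕ) :
    minCost c k x y ≤ y - x := minCost_le (cheap_length hc k x y)

/-- Follow an optimal path on the left up to position `y - 1` and an optimal one on the right from
`y` on. The only new expense is one jump between shifts at most `k`. This additive loss sets the
scale on which blocks count as heavy. -/
theorem minCost_glue (c : ℕ → ℕ → ℕ) (k : ℕ) {x y z : ℕ} (h : x ≤ y) (h' : y ≤ z) :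
    minCost c k x z ≤ minCost c k x y + minCost c k y z + k := by
  obtain ⟨p, hp, hpc⟩ := cheap_minCost (c := c) k x y
  obtain ⟨q, hq, hqc⟩ := cheap_minCost (c := c) k y z
  refine minCost_le ⟨fun i => if i < y then p i else q i, fun i => ?_, ?_⟩
  · dsimp only; split_ifs
    exacts [hp i, hq i]
  rw [← pathCost_add c _ h h']
  have h1 : pathCost c (fun i => if i < y then p i else q i) y z = pathCost c q y z :=
    pathCost_congr (fun _ _ _ => rfl) fun i hi _ => by simp [not_lt.2 hi]
  have h2 : pathCost c (fun i => if i < y then p i else q i) x y ≤ pathCost c p x y + k := by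
    rcases h.eq_or_lt with rfl | hlt
    · simp [pathCost_self]
    · obtain ⟨y, rfl⟩ : ∃ y', y = y' + 1 := ⟨y - 1, by omega⟩
      rw [pathCost_succ _ _ (by omega), pathCost_succ _ _ (by omega)]
      have : pathCost c (fun i => if i < y + 1 then p i else q i) x y = pathCost c p x y :=
        pathCost_congr (fun _ _ _ => rfl) fun i hi hi' => by simp [Nat.lt_succ_of_le hi']
      rw [this]
      have := Nat.dist_le_of_le (hp y) (hq (y + 1))
      simp only [lt_add_iff_pos_right, Nat.lt_one_iff, pos_of_gt, if_true, lt_irrefl, if_false]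
      omega
  omega

theorem minCost_mono_right (c : ℕ → ℕ → ℕ) (k : ℕ) {x y z : ℕ} (h : x ≤ y) (h' : y ≤ z) :
    minCost c k x y ≤ minCost c k x z := by
  obtain ⟨p, hp, hpc⟩ := cheap_minCost (c := c) k x z
  refine minCost_le ⟨p, hp, le_trans ?_ hpc⟩
  rw [← pathCost_add c p h h']
  exact Nat.le_add_right _ _

theorem minCost_blocks (c : ℕ → ℕ → ℕ) (k b J : ℕ) :
    minCost c k 0 (J * b) ≤ ∑ j ∈ Finset.range J, minCost c k (j * b) ((j + 1) * b) + J * k := by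
  induction J with
  | zero =>
    have := minCost_le (c := c) (k := k) (x := 0) (y := 0) (D := 0)
      ⟨fun _ => 0, fun _ => Nat.zero_le _, by simp [pathCost_self]⟩
    simpa using this
  | succ J ih =>
    rw [Finset.sum_range_succ]
    have := minCost_glue c k (Nat.zero_le (J * b)) (Nat.mul_le_mul_right b (Nat.le_succ J))
    rw [Nat.succ_eq_add_one] at this
    rw [Nat.add_mul J 1 k]
    omega

theorem sum_pathCost_blocks (c : ℕ → ℕ → ℕ) (p : ℕ → ℕ) (b J : ℕ) :
    ∑ j ∈ Finset.range J, pathCost c p (j * b) ((j + 1) * b) = pathCost c p 0 (J * b) := by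
  induction J with
  | zero => simp [pathCost_self]
  | succ J ih =>
    rw [Finset.sum_range_succ, ih, pathCost_add c p (Nat.zero_le _)
      (Nat.mul_le_mul_right b (Nat.le_succ J))]

/-- Markov's inequality for the costs of blocks. -/
theorem card_expensive_blocks (c : ℕ → ℕ → ℕ) (k b J r D : ℕ) (h : Cheap c k 0 (J * b) D) :
    ((Finset.range J).filter fun j => r ≤ minCost c k (j * b) ((j + 1) * b)).card * r ≤ D := by
  obtain ⟨p, hp, hD⟩ := h
  refine le_trans ?_ hD
  rw [← sum_pathCost_blocks, ← smul_eq_mul]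
  refine le_trans (Finset.card_nsmul_le_sum _ _ r fun j hj => ?_)
    (Finset.sum_le_sum_of_subset (Finset.filter_subset
      (fun j => r ≤ minCost c k (j * b) ((j + 1) * b)) _))
  exact le_trans (Finset.mem_filter.1 hj).2 (minCost_le ⟨p, hp, le_rfl⟩)

/-- If the sampled positions hit every stretch with `q` mismatches on one diagonal, then the cost of
a path exceeds its sampled cost by a factor of at most about `q`. -/
theorem pathCost_le_sampled {c : ℕ → ℕ → ℕ} (hc : ∀ i s, c i s ≤ 1) (S : Set ℕ)
    [DecidablePred (· ∈ S)] {k q x y : ℕ} (hxy : x ≤ y)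
    (hit : ∀ u v s, x ≤ u → v ≤ y → s ≤ k → q ≤ ∑ i ∈ Finset.Ico u v, c i s →
      ∃ i ∈ S, u ≤ i ∧ i < v ∧ c i s ≠ 0)
    (p : ℕ → ℕ) (hp : ∀ i, p i ≤ k) :
    pathCost c p x y ≤ (q + 1) * pathCost (fun i s => if i ∈ S then c i s else 0) p x y + q := by
  set c' : ℕ → ℕ → ℕ := fun i s => if i ∈ S then c i s else 0 with hc'
  -- While `p` is constant and nothing is paid in the sample, `hit` in contrapositive form leaves at
  -- most `q - 1` true mismatches.
  have seg : ∀ u v, x ≤ u → v ≤ y → u ≤ v → (∀ i, u ≤ i → i ≤ v → p i = p v) →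
      pathCost c' p u v = 0 → pathCost c p u v + 1 ≤ q := by
    intro u v hu hv huv hconst h0
    have e1 : pathCost c p u v = ∑ i ∈ Finset.Ico u v, c i (p v) := by
      refine Finset.sum_congr rfl fun i hi => ?_
      rw [Finset.mem_Ico] at hi
      rw [hconst i hi.1 hi.2.le, hconst (i + 1) (by omega) (by omega), Nat.dist_self, add_zero]
    by_contra hlt
    obtain ⟨i, hiS, hui, hiv, hi⟩ := hit u v (p v) hu hv (hp v) (by omega)
    have := (Finset.sum_eq_zero_iff.1 h0) i (Finset.mem_Ico.2 ⟨hui, hiv⟩)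
    simp only [hc', hiS, if_true, Nat.add_eq_zero_iff, hconst i hui hiv.le] at this
    exact hi this.1
  -- Amortization: `u` starts the current constant stretch that is unpaid in the sample; everything
  -- before `u` already satisfies the bound with factor `q + 1`.
  have key : ∀ z, x ≤ z → z ≤ y → ∃ u, x ≤ u ∧ u ≤ z ∧ (∀ i, u ≤ i → i ≤ z → p i = p z) ∧
      pathCost c' p u z = 0 ∧ pathCost c p x u ≤ (q + 1) * pathCost c' p x u := by
    intro z hz
    induction z, hz using Nat.le_induction with
    | base =>
      intro _
      exact ⟨x, le_rfl, le_rfl, fun i h1 h2 => by rw [le_antisymm h2 h1], by simp [pathCost_self],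
        by simp [pathCost_self]⟩
    | succ z hz ih =>
      intro hzy
      obtain ⟨u, hxu, huz, hconst, h0, hle⟩ := ih (by omega)
      by_cases h1 : c' z (p z) + Nat.dist (p z) (p (z + 1)) = 0
      · have hz1 : p z = p (z + 1) := Nat.eq_of_dist_eq_zero (by omega)
        refine ⟨u, hxu, by omega, fun i hi hi' => ?_, ?_, hle⟩
        · rcases Nat.lt_or_ge z i with h | h
          · rw [le_antisymm hi' h]
          · rw [hconst i hi h, hz1]
        · rw [pathCost_succ _ _ huz, h0, h1]
      · refine ⟨z + 1, by omega, le_rfl, fun i h1 h2 => by rw [le_antisymm h2 h1],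
          pathCost_self _ _ _, ?_⟩
        -- The step at `z` has sampled cost `w ≥ 1`. The unpaid `q - 1` mismatches, a possibly
        -- unsampled mismatch at `z` and the jump sum to at most `q + w ≤ (q + 1) * w`.
        have hs := seg u z hxu (by omega) huz hconst h0
        have a1 := pathCost_add c p hxu huz
        have a2 := pathCost_add c' p hxu huz
        rw [pathCost_succ c p hz, pathCost_succ c' p hz, ← a1, ← a2, h0]
        have := hc z (p z)
        have h2 : 1 ≤ c' z (p z) + Nat.dist (p z) (p (z + 1)) := by omega
        have h3 : q ≤ q * (c' z (p z) + Nat.dist (p z) (p (z + 1))) := Nat.le_mul_of_pos_right _ h2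
        nlinarith
  obtain ⟨u, hxu, huy, hconst, h0, hle⟩ := key y hxy le_rfl
  have hs := seg u y hxu le_rfl huy hconst h0
  rw [← pathCost_add c p hxu huy, ← pathCost_add c' p hxu huy, h0, add_zero]
  omega

/-! ### Heavy blocks in the dyadic hierarchy of blocks -/

theorem sum_range_two_mul {f : ℕ → ℕ} (N : ℕ) :
    ∑ j ∈ Finset.range (2 * N), f j = ∑ j ∈ Finset.range N, (f (2 * j) + f (2 * j + 1)) := by
  induction N with
  | zero => rfl
  | succ N ih => rw [Nat.mul_succ, Finset.sum_range_succ, Finset.sum_range_succ,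
      Finset.sum_range_succ, ih, add_assoc]

/-- The blocks of length `b` among the first `N` whose cost is at least `H`. -/
noncomputable def heavyBlocks (c : ℕ → ℕ → ℕ) (k H b N : ℕ) : Finset ℕ :=
  (Finset.range N).filter fun j => H ≤ minCost c k (j * b) ((j + 1) * b)

/-- Induction over levels on the excess of block costs over `k`, truncated at 0. Two children cost
at most `k` plus their excess each, and glueing adds `k`; so the parent's excess is at most that of
its children plus `2 * k`, and the extra term is needed only for a heavy parent, since a light one
has excess 0. At the bottom `b ≤ k` leaves no excess. -/
theorem sum_excess_le {c : ℕ → ℕ → ℕ} (hc : ∀ i s, c i s ≤ 1) {k b : ℕ} (hb : b ≤ k)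
    (U : ℕ) : ∀ J, ∑ j ∈ Finset.range J, (minCost c k (j * (b * 2 ^ U)) ((j + 1) * (b * 2 ^ U)) - k)
      ≤ 2 * k * ∑ u ∈ Finset.Ico 1 (U + 1),
        (heavyBlocks c k k (b * 2 ^ u) (J * 2 ^ (U - u))).card := by
  induction U with
  | zero =>
    intro J
    refine le_of_eq_of_le (Finset.sum_eq_zero fun j _ => ?_) (Nat.zero_le _)
    have := minCost_le_length hc k (j * (b * 2 ^ 0)) ((j + 1) * (b * 2 ^ 0))
    rw [Nat.add_mul, Nat.add_sub_cancel_left] at this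
    simp only [pow_zero, mul_one, one_mul] at this ⊢
    rw [Nat.add_mul, one_mul]
    omega
  | succ U ih =>
    intro J
    rw [Finset.sum_Ico_succ_top (by omega), Nat.sub_self, pow_zero, mul_one, mul_add]
    have h1 : ∀ j, minCost c k (j * (b * 2 ^ (U + 1))) ((j + 1) * (b * 2 ^ (U + 1))) - k ≤
        ((minCost c k (2 * j * (b * 2 ^ U)) ((2 * j + 1) * (b * 2 ^ U)) - k) +
        (minCost c k ((2 * j + 1) * (b * 2 ^ U)) ((2 * j + 1 + 1) * (b * 2 ^ U)) - k)) +
        2 * k * (if k ≤ minCost c k (j * (b * 2 ^ (U + 1))) ((j + 1) * (b * 2 ^ (U + 1)))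
          then 1 else 0) := by
      intro j
      have e1 : j * (b * 2 ^ (U + 1)) = 2 * j * (b * 2 ^ U) := by ring
      have e2 : (j + 1) * (b * 2 ^ (U + 1)) = (2 * j + 1 + 1) * (b * 2 ^ U) := by ring
      have := minCost_glue c k (x := 2 * j * (b * 2 ^ U)) (y := (2 * j + 1) * (b * 2 ^ U))
        (z := (2 * j + 1 + 1) * (b * 2 ^ U)) (Nat.mul_le_mul_right _ (by omega))
        (Nat.mul_le_mul_right _ (by omega))
      rw [e1, e2]
      split_ifs <;> omega
    refine le_trans (Finset.sum_le_sum fun j _ => h1 j) ?_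
    rw [Finset.sum_add_distrib, ← sum_range_two_mul (f := fun j =>
      minCost c k (j * (b * 2 ^ U)) ((j + 1) * (b * 2 ^ U)) - k), ← Finset.mul_sum]
    refine Nat.add_le_add ((ih (2 * J)).trans ?_) ?_
    · refine Nat.mul_le_mul_left _ (Finset.sum_le_sum fun u hu => ?_)
      rw [Finset.mem_Ico] at hu
      rw [show 2 * J * 2 ^ (U - u) = J * 2 ^ (U + 1 - u) by
        rw [show U + 1 - u = U - u + 1 by omega, pow_succ]; ring]
    · rw [heavyBlocks, Finset.card_filter]

/-- Each of the `J` top blocks loses `k` to truncating its cost and `k` to glueing, which gives `2 *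
k * J`; the excess is counted by heavy blocks. -/
theorem minCost_le_heavyBlocks {c : ℕ → ℕ → ℕ} (hc : ∀ i s, c i s ≤ 1) {k b n : ℕ} (hb : b ≤ k)
    (U J : ℕ) (hn : n ≤ J * (b * 2 ^ U)) : minCost c k 0 n ≤ 2 * k * (J +
      ∑ u ∈ Finset.Ico 1 (U + 1), (heavyBlocks c k k (b * 2 ^ u) (J * 2 ^ (U - u))).card) := by
  refine (minCost_mono_right c k (Nat.zero_le _) hn).trans ((minCost_blocks c k _ J).trans ?_)
  have h1 : ∑ j ∈ Finset.range J, minCost c k (j * (b * 2 ^ U)) ((j + 1) * (b * 2 ^ U)) ≤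
      ∑ j ∈ Finset.range J, ((minCost c k (j * (b * 2 ^ U)) ((j + 1) * (b * 2 ^ U)) - k) + k) :=
    Finset.sum_le_sum fun j _ => by omega
  have h2 := sum_excess_le hc hb U J
  rw [Finset.sum_add_distrib, Finset.sum_const, Finset.card_range, smul_eq_mul] at h1
  rw [mul_add]
  have : 2 * k * J = J * k + J * k := by ring
  omega

/-- An expensive string has many heavy blocks on some level of the hierarchy. -/
theorem exists_level_heavyBlocks {c : ℕ → ℕ → ℕ} (hc : ∀ i s, c i s ≤ 1) {k b n : ℕ}
    (hb : b ≤ k) {U J l : ℕ} (hn : n ≤ J * (b * 2 ^ U))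
    (hD : 2 * k * (J + l) < minCost c k 0 n) :
    ∃ u ≤ U, l ≤ U * (heavyBlocks c k k (b * 2 ^ u) (J * 2 ^ (U - u))).card := by
  by_contra! hcon
  have h1 := minCost_le_heavyBlocks hc hb U J hn
  have h2 : ∑ u ∈ Finset.Ico 1 (U + 1), (heavyBlocks c k k (b * 2 ^ u) (J * 2 ^ (U - u))).card
      ≤ l := by
    rcases Nat.eq_zero_or_pos U with rfl | hU
    · simp
    · refine le_of_mul_le_mul_left ?_ hU
      rw [Finset.mul_sum]
      refine (Finset.sum_le_card_nsmul _ _ l fun u hu => (hcon u ?_).le).trans ?_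
      · rw [Finset.mem_Ico] at hu; omega
      · simp
  have h3 : 2 * k * (J + ∑ u ∈ Finset.Ico 1 (U + 1),
      (heavyBlocks c k k (b * 2 ^ u) (J * 2 ^ (U - u))).card) ≤ 2 * k * (J + l) :=
    Nat.mul_le_mul_left _ (by omega)
  omega

/-! ## Edit distance and shift paths -/

/-- Alignments of two strings with `d` edits. -/
inductive EditAlignment {α : Type*} : ℕ → List α → List α → Prop
  | nil : EditAlignment 0 [] []
  | keep (a : α) {d : ℕ} {x y : List α} : EditAlignment d x y → EditAlignment d (a :: x) (a :: y)
  | subst (a b : α) {d : ℕ} {x y : List α} :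
      EditAlignment d x y → EditAlignment (d + 1) (a :: x) (b :: y)
  | delete (a : α) {d : ℕ} {x y : List α} : EditAlignment d x y → EditAlignment (d + 1) (a :: x) y
  | insert (b : α) {d : ℕ} {x y : List α} : EditAlignment d x y → EditAlignment (d + 1) x (b :: y)

/-- A single edit, located by recursion on the string. -/
inductive HeadEdit {α : Type*} : List α → List α → Prop
  | insert (a : α) (y : List α) : HeadEdit y (a :: y)
  | delete (a : α) (y : List α) : HeadEdit (a :: y) y
  | subst (a b : α) (y : List α) : HeadEdit (a :: y) (b :: y)
  | cons (a : α) {y z : List α} : HeadEdit y z → HeadEdit (a :: y) (a :: z)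

theorem EditStep.headEdit {α : Type*} {y z : List α} (h : EditStep y z) : HeadEdit y z := by
  have app : ∀ (u : List α) {y z : List α}, HeadEdit y z → HeadEdit (u ++ y) (u ++ z) := by
    intro u y z h
    induction u with
    | nil => exact h
    | cons a u ih => exact .cons a ih
  cases h with
  | insert u v a => exact app u (.insert a v)
  | delete u v a => exact app u (.delete a v)
  | subst u v a b => exact app u (.subst a b v)

theorem EditAlignment.refl {α : Type*} (x : List α) : EditAlignment 0 x x := by
  induction x with
  | nil => exact .nil
  | cons a x ih => exact .keep a ih

/-- The alignment is followed down to the edited character of the middle string. There the new edit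
adds one operation or modifies one already paid for; deleting an inserted character even saves one.
-/
theorem EditAlignment.headEdit {α : Type*} {d : ℕ} {x y z : List α} (h : EditAlignment d x y)
    (e : HeadEdit y z) : ∃ d' ≤ d + 1, EditAlignment d' x z := by
  induction h generalizing z with
  | nil => cases e with
    | insert a _ => exact ⟨1, le_rfl, .insert a .nil⟩
  | keep a h ih => cases e with
    | insert b _ => exact ⟨_, le_rfl, .insert b (.keep a h)⟩
    | delete _ _ => exact ⟨_, le_rfl, .delete a h⟩
    | subst _ b _ => exact ⟨_, le_rfl, .subst a b h⟩
    | cons _ e => obtain ⟨d', hd, h'⟩ := ih e; exact ⟨d', hd, .keep a h'⟩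
  | subst a b h ih => cases e with
    | insert b' _ => exact ⟨_, le_rfl, .insert b' (.subst a b h)⟩
    | delete _ _ => exact ⟨_, Nat.le_succ _, .delete a h⟩
    | subst _ b' _ => exact ⟨_, Nat.le_succ _, .subst a b' h⟩
    | cons _ e =>
      obtain ⟨d', hd, h'⟩ := ih e; exact ⟨d' + 1, Nat.succ_le_succ hd, .subst a b h'⟩
  | delete a h ih =>
    obtain ⟨d', hd, h'⟩ := ih e; exact ⟨d' + 1, Nat.succ_le_succ hd, .delete a h'⟩
  | insert b h ih => cases e with
    | insert b' _ => exact ⟨_, le_rfl, .insert b' (.insert b h)⟩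
    | delete _ _ => exact ⟨_, by omega, h⟩
    | subst _ b' _ => exact ⟨_, Nat.le_succ _, .insert b' h⟩
    | cons _ e => obtain ⟨d', hd, h'⟩ := ih e; exact ⟨d' + 1, Nat.succ_le_succ hd, .insert b h'⟩

theorem EditsIn.alignment {α : Type*} {d : ℕ} {x y : List α} (h : EditsIn d x y) :
    ∃ d' ≤ d, EditAlignment d' x y := by
  induction h with
  | refl x => exact ⟨0, le_rfl, .refl x⟩
  | tail _ st ih =>
    obtain ⟨d', hd, h'⟩ := ih
    obtain ⟨d'', hd', h''⟩ := h'.headEdit st.headEdit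
    exact ⟨d'', by omega, h''⟩

/-! ### Alignments as sequences of integer shifts -/

open Classical in
/-- Whether position `i` of `x` disagrees with position `i + t` of `y`. -/
noncomputable def shiftMismatch {α : Type*} (x y : List α) (i : ℕ) (t : ℤ) : ℤ :=
  if i < x.length → ∃ j : ℕ, (j : ℤ) = i + t ∧ x[i]? = y[j]? then 0 else 1

theorem shiftMismatch_le_one {α : Type*} (x y : List α) (i : ℕ) (t : ℤ) :
    shiftMismatch x y i t ≤ 1 := by
  unfold shiftMismatch; split_ifs <;> norm_num

theorem shiftMismatch_nonneg {α : Type*} (x y : List α) (i : ℕ) (t : ℤ) :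
    0 ≤ shiftMismatch x y i t := by
  unfold shiftMismatch; split_ifs <;> norm_num

theorem shiftMismatch_eq_zero_imp {α : Type*} {x y x' y' : List α} {i i' : ℕ} {t t' : ℤ}
    (h : (i < x.length → ∃ j : ℕ, (j : ℤ) = i + t ∧ x[i]? = y[j]?) →
      (i' < x'.length → ∃ j : ℕ, (j : ℤ) = i' + t' ∧ x'[i']? = y'[j]?)) :
    shiftMismatch x' y' i' t' ≤ shiftMismatch x y i t := by
  by_cases h2 : i < x.length → ∃ j : ℕ, (j : ℤ) = i + t ∧ x[i]? = y[j]?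
  · rw [shiftMismatch, shiftMismatch, if_pos h2, if_pos (h h2)]
  · rw [shiftMismatch, shiftMismatch, if_neg h2]
    split_ifs <;> norm_num

/-- The sequence `t` with `0` put in front. -/
def zeroCons (t : ℕ → ℤ) : ℕ → ℤ
  | 0 => 0
  | i + 1 => t i

/-- `t i` is the displacement of the partner of position `i`. A deletion pays twice, as a mismatch
at the deleted position and as a change of shift, hence the factor 2. The term `|t 0|` is an initial
jump from shift 0: putting a position with shift 0 in front turns it into ordinary variation, which
makes the induction close. -/
theorem EditAlignment.exists_shift {α : Type*} {d : ℕ} {x y : List α} (h : EditAlignment d x y) :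
    ∃ t : ℕ → ℤ, (∀ i, x.length ≤ i → t i = y.length - x.length) ∧
      ∀ N, |t 0| + ∑ i ∈ Finset.range N, (shiftMismatch x y i (t i) + |t (i + 1) - t i|) ≤
        2 * d := by
  induction h with
  | nil =>
    refine ⟨fun _ => 0, by simp, fun N => ?_⟩
    simp [shiftMismatch]
  | @keep a d x y h ih =>
    obtain ⟨t, ht, hs⟩ := ih
    refine ⟨zeroCons t, fun i hi => ?_, fun N => ?_⟩
    · cases i with
      | zero => simp at hi
      | succ i => simpa [zeroCons] using ht i (by simpa using hi)
    · cases N with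
      | zero => simp [zeroCons]
      | succ N =>
        rw [Finset.sum_range_succ']
        have h0 : shiftMismatch (a :: x) (a :: y) 0 0 = 0 := by
          unfold shiftMismatch; rw [if_pos]; intro _; exact ⟨0, by simp, by simp⟩
        have h1 : ∀ i, shiftMismatch (a :: x) (a :: y) (i + 1) (t i) ≤
            shiftMismatch x y i (t i) := fun i => shiftMismatch_eq_zero_imp fun hi hi' => by
          obtain ⟨j, hj, e⟩ := hi (by simpa using hi')
          exact ⟨j + 1, by push_cast; omega, by simpa using e⟩
        have := hs N
        have h2 := Finset.sum_le_sum fun i (_ : i ∈ Finset.range N) =>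
          add_le_add_left (h1 i) |t (i + 1) - t i|
        simp only [zeroCons, h0, abs_zero, sub_zero, zero_add]
        linarith
  | @subst a b d x y h ih =>
    obtain ⟨t, ht, hs⟩ := ih
    refine ⟨zeroCons t, fun i hi => ?_, fun N => ?_⟩
    · cases i with
      | zero => simp at hi
      | succ i => simpa [zeroCons] using ht i (by simpa using hi)
    · cases N with
      | zero => simp [zeroCons]; positivity
      | succ N =>
        rw [Finset.sum_range_succ']
        have h0 := shiftMismatch_le_one (a :: x) (b :: y) 0 0
        have h1 : ∀ i, shiftMismatch (a :: x) (b :: y) (i + 1) (t i) ≤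
            shiftMismatch x y i (t i) := fun i => shiftMismatch_eq_zero_imp fun hi hi' => by
          obtain ⟨j, hj, e⟩ := hi (by simpa using hi')
          exact ⟨j + 1, by push_cast; omega, by simpa using e⟩
        have := hs N
        have h2 := Finset.sum_le_sum fun i (_ : i ∈ Finset.range N) =>
          add_le_add_left (h1 i) |t (i + 1) - t i|
        simp only [zeroCons, abs_zero, sub_zero, zero_add]
        push_cast
        linarith
  | @delete a d x y h ih =>
    obtain ⟨t, ht, hs⟩ := ih
    refine ⟨zeroCons fun i => t i - 1, fun i hi => ?_, fun N => ?_⟩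
    · cases i with
      | zero => simp at hi
      | succ i =>
        have := ht i (by simpa using hi)
        simp only [List.length_cons, zeroCons]; push_cast; omega
    · cases N with
      | zero => simp [zeroCons]; positivity
      | succ N =>
        rw [Finset.sum_range_succ']
        have h0 := shiftMismatch_le_one (a :: x) y 0 0
        have h1 : ∀ i, shiftMismatch (a :: x) y (i + 1) (t i - 1) ≤
            shiftMismatch x y i (t i) := fun i => shiftMismatch_eq_zero_imp fun hi hi' => by
          obtain ⟨j, hj, e⟩ := hi (by simpa using hi')
          exact ⟨j, by push_cast; omega, by simpa using e⟩
        have := hs N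
        have h2 := Finset.sum_le_sum fun i (_ : i ∈ Finset.range N) =>
          add_le_add_left (h1 i) |t (i + 1) - t i|
        have h3 := abs_sub (t 0) 1
        simp only [zeroCons, abs_zero, sub_zero, zero_add, sub_sub_sub_cancel_right, abs_one] at h3 ⊢
        push_cast
        linarith
  | @insert b d x y h ih =>
    obtain ⟨t, ht, hs⟩ := ih
    -- An insertion moves all later partners by one and is charged to `|t 0|` alone.
    refine ⟨fun i => t i + 1, fun i hi => ?_, fun N => ?_⟩
    · have := ht i hi
      simp only [List.length_cons]; push_cast; omega
    · have h1 : ∀ i, shiftMismatch x (b :: y) i (t i + 1) ≤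
            shiftMismatch x y i (t i) := fun i => shiftMismatch_eq_zero_imp fun hi hi' => by
          obtain ⟨j, hj, e⟩ := hi hi'
          exact ⟨j + 1, by push_cast; omega, by simpa using e⟩
      have := hs N
      have h2 := Finset.sum_le_sum fun i (_ : i ∈ Finset.range N) =>
        add_le_add_left (h1 i) |t (i + 1) - t i|
      have h3 := abs_add_le (t 0) 1
      simp only [add_sub_add_right_eq_sub, abs_one] at h3 ⊢
      push_cast
      linarith

/-- Mismatch of `f i` and `g (i + s - k)`. -/
def mismatch (f g : ℕ → ℕ) (k i s : ℕ) : ℕ := if f i = g (i + s - k) then 0 else 1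

theorem mismatch_le_one (f g : ℕ → ℕ) (k i s : ℕ) : mismatch f g k i s ≤ 1 := by
  unfold mismatch; split_ifs <;> norm_num

theorem charAt_eq_getElem? {n σ : ℕ} (A : Fin n → Fin σ) (i : ℕ) :
    charAt A i = ((List.ofFn A)[i]?).elim σ (fun a => (a : ℕ)) := by
  unfold charAt
  split_ifs with h <;> simp [h]

/-- The initial jump together with the variation bounds every `|t i|` by `2 * d ≤ k`, so the
recentred shifts `k + t i` stay in `[0, 2 * k]`. The bound holds for every `N`, because the blocks
of the search may reach beyond the strings. -/
theorem cheap_of_stringED {n σ : ℕ} (A B : Fin n → Fin σ) {k : ℕ} (h : 2 * stringED A B ≤ k)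
    (N : ℕ) : Cheap (mismatch (charAt A) (charAt B) k) (2 * k) 0 N (2 * stringED A B) := by
  obtain ⟨d, hd, hal⟩ := (editsIn_editDist (List.ofFn A) (List.ofFn B)).alignment
  change d ≤ stringED A B at hd
  obtain ⟨t, ht, hs⟩ := hal.exists_shift
  have hb : ∀ i, |t i| ≤ 2 * d := by
    intro i
    refine le_trans ?_ (hs i)
    clear hs
    induction i with
    | zero => simp
    | succ i ih =>
      rw [Finset.sum_range_succ]
      have := shiftMismatch_nonneg (List.ofFn A) (List.ofFn B) i (t i)
      have h3 := abs_add_le (t i) (t (i + 1) - t i)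
      rw [add_sub_cancel] at h3
      linarith
  have hb' : ∀ i, ((k + t i).toNat : ℤ) = k + t i := fun i => by
    have := abs_le.1 (hb i)
    exact Int.toNat_of_nonneg (by omega)
  refine ⟨fun i => (k + t i).toNat, fun i => ?_, ?_⟩
  · have := abs_le.1 (hb i)
    change (k + t i).toNat ≤ 2 * k
    omega
  · have key : ∀ i, (mismatch (charAt A) (charAt B) k i (k + t i).toNat : ℤ) ≤
        shiftMismatch (List.ofFn A) (List.ofFn B) i (t i) := by
      intro i
      unfold shiftMismatch
      split_ifs with hi
      · rw [mismatch, if_pos]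
        · rfl
        · rcases Nat.lt_or_ge i n with hin | hin
          · obtain ⟨j, hj, e⟩ := hi (by simpa using hin)
            have : i + (k + t i).toNat - k = j := by have := hb' i; omega
            rw [this, charAt_eq_getElem?, charAt_eq_getElem?, e]
          -- Equal lengths make the final shift 0, and past the end both strings show the same
          -- padding symbol.
          · have h0 := ht i (by simpa using hin)
            simp only [List.length_ofFn, sub_self] at h0
            rw [h0, show i + ((k : ℤ) + 0).toNat - k = i by omega, charAt, charAt,
              dif_neg (by omega), dif_neg (by omega)]
      · exact_mod_cast mismatch_le_one _ _ _ _ _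
    have h1 := hs N
    have h2 : (pathCost (mismatch (charAt A) (charAt B) k) (fun i => (k + t i).toNat) 0 N : ℤ) ≤
        ∑ i ∈ Finset.range N, (shiftMismatch (List.ofFn A) (List.ofFn B) i (t i) +
          |t (i + 1) - t i|) := by
      rw [pathCost, ← Finset.range_eq_Ico]
      push_cast
      refine Finset.sum_le_sum fun i _ => add_le_add (key i) ?_
      have a1 := hb' i
      have a2 := hb' (i + 1)
      unfold Nat.dist
      rcases abs_cases (t (i + 1) - t i) with h | h <;> omega
    have := abs_nonneg (t 0)
    omega

/-! ### From shift paths back to edit distance -/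

theorem editDist_le {α : Type*} {d : ℕ} {x y : List α} (h : EditsIn d x y) : editDist x y ≤ d :=
  Nat.sInf_le h

theorem editDist_triangle {α : Type*} (x y z : List α) :
    editDist x z ≤ editDist x y + editDist y z :=
  editDist_le ((editsIn_editDist x y).trans (editsIn_editDist y z))

theorem editDist_self {α : Type*} (x : List α) : editDist x x = 0 :=
  Nat.le_zero.1 (editDist_le (.refl x))

theorem editDist_le_one {α : Type*} {x y : List α} (h : EditStep x y) : editDist x y ≤ 1 :=
  editDist_le (.tail (.refl x) h)

theorem editDist_append {α : Type*} (x y : List α) (a : α) :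
    editDist (x ++ [a]) (y ++ [a]) ≤ editDist x y := by
  refine editDist_le ?_
  generalize editDist x y = d, editsIn_editDist x y = h
  induction h with
  | refl => exact .refl _
  | tail _ st ih =>
    refine .tail ih ?_
    cases st with
    | insert u v b => simpa using EditStep.insert u (v ++ [a]) b
    | delete u v b => simpa using EditStep.delete u (v ++ [a]) b
    | subst u v b b' => simpa using EditStep.subst u (v ++ [a]) b b'

theorem editDist_take_succ {α : Type*} (y : List α) (j : ℕ) :
    editDist (y.take j) (y.take (j + 1)) ≤ 1 ∧ editDist (y.take (j + 1)) (y.take j) ≤ 1 := by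
  rcases Nat.lt_or_ge j y.length with h | h
  · rw [List.take_add_one, List.getElem?_eq_getElem h]
    constructor
    · have := editDist_le_one (EditStep.insert (y.take j) [] y[j])
      rwa [List.append_nil] at this
    · have := editDist_le_one (EditStep.delete (y.take j) [] y[j])
      rwa [List.append_nil] at this
  · rw [List.take_of_length_le h, List.take_of_length_le (by omega), editDist_self]
    simp

theorem editDist_take_take {α : Type*} (y : List α) (i j : ℕ) :
    editDist (y.take i) (y.take j) ≤ Nat.dist i j := by
  have up : ∀ i e, editDist (y.take i) (y.take (i + e)) ≤ e ∧
      editDist (y.take (i + e)) (y.take i) ≤ e := by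
    intro i e
    induction e with
    | zero => simp [editDist_self]
    | succ e ih =>
      have h := editDist_take_succ y (i + e)
      have h1 := editDist_triangle (y.take i) (y.take (i + e)) (y.take (i + e + 1))
      have h2 := editDist_triangle (y.take (i + e + 1)) (y.take (i + e)) (y.take i)
      rw [← add_assoc]
      omega
  rcases Nat.le_total i j with h | h
  · obtain ⟨e, rfl⟩ := Nat.exists_eq_add_of_le h
    have := (up i e).1
    unfold Nat.dist; omega
  · obtain ⟨e, rfl⟩ := Nat.exists_eq_add_of_le h
    have := (up j e).2
    unfold Nat.dist; omega

/-- The path is read as a transformation of prefixes of `A` into prefixes of `B`. The loss `4 * k`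
consists of `k` for the initial shift, `k` for the final one, and `2 * k` reserved for the first `k`
positions, where truncated subtraction in `mismatch` can report a false match with character 0. -/
theorem stringED_le_pathCost {n σ : ℕ} (A B : Fin n → Fin σ) (k : ℕ) (p : ℕ → ℕ)
    (hp : ∀ i, p i ≤ 2 * k) :
    stringED A B ≤ pathCost (mismatch (charAt A) (charAt B) k) p 0 n + 4 * k := by
  set x := List.ofFn A with hx
  set y := List.ofFn B with hy
  have key : ∀ m, m ≤ n → editDist (x.take m) (y.take (m + p m - k)) ≤
      pathCost (mismatch (charAt A) (charAt B) k) p 0 m + k + 2 * min m k := by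
    intro m
    induction m with
    | zero =>
      intro _
      have h1 := editDist_take_take y 0 (0 + p 0 - k)
      have := hp 0
      simp only [List.take_zero] at h1 ⊢
      unfold Nat.dist at h1
      omega
    | succ m ih =>
      intro hm
      have ih := ih (by omega)
      rw [pathCost_succ _ _ (Nat.zero_le _)]
      have hd := editDist_take_take y (m + 1 + p m - k) (m + 1 + p (m + 1) - k)
      have hd' : Nat.dist (m + 1 + p m - k) (m + 1 + p (m + 1) - k) ≤
          Nat.dist (p m) (p (m + 1)) := by unfold Nat.dist; omega
      have ht := editDist_triangle (x.take (m + 1)) (y.take (m + 1 + p m - k))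
        (y.take (m + 1 + p (m + 1) - k))
      have hx1 := (editDist_take_succ x m).2
      have hxt := editDist_triangle (x.take (m + 1)) (x.take m) (y.take (m + p m - k))
      have h3 : editDist (x.take (m + 1)) (y.take (m + 1 + p m - k)) ≤
          editDist (x.take m) (y.take (m + p m - k)) +
          mismatch (charAt A) (charAt B) k m (p m) + 2 * (min (m + 1) k - min m k) := by
        have hy2 := editDist_triangle (x.take (m + 1)) (y.take (m + p m - k))
          (y.take (m + 1 + p m - k))
        -- If the partner lies before the start of `B`, then `m < k`, and the growth of `2 * min m
        -- k` pays for removing the character, whatever `mismatch` reports.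
        rcases Nat.lt_or_ge (m + p m) k with hlt | hge
        · have hy1 := editDist_take_take y (m + p m - k) (m + 1 + p m - k)
          unfold Nat.dist at hy1
          omega
        · rw [show m + 1 + p m - k = m + p m - k + 1 by omega] at hy2 ⊢
          set j := m + p m - k with hj
          have hmx : m < x.length := by simpa [hx] using hm
          rcases Nat.lt_or_ge j n with hjn | hjn
          · have hjy : j < y.length := by simpa [hy] using hjn
            by_cases heq : charAt A m = charAt B j
            · have : x[m] = y[j] := by
                simp only [charAt, hjn, show m < n by omega, dif_pos] at heq
                simp only [hx, hy, List.getElem_ofFn]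
                exact Fin.ext heq
              have h4 := editDist_append (x.take m) (y.take j) x[m]
              rw [List.take_add_one, List.take_add_one (l := y), List.getElem?_eq_getElem hmx,
                List.getElem?_eq_getElem hjy, ← this]
              simp only [Option.toList_some]
              omega
            · have h4 : editDist (x.take m ++ [x[m]]) (y.take j ++ [y[j]]) ≤
                  editDist (x.take m) (y.take j) + 1 := by
                have e1 := editDist_append (x.take m) (y.take j) x[m]
                have e2 := editDist_le_one (EditStep.subst (y.take j) [] x[m] y[j])
                have e3 := editDist_triangle (x.take m ++ [x[m]]) (y.take j ++ [x[m]])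
                  (y.take j ++ [y[j]])
                omega
              rw [mismatch, if_neg (by rw [← hj]; exact heq), List.take_add_one,
                List.take_add_one (l := y), List.getElem?_eq_getElem hmx,
                List.getElem?_eq_getElem hjy]
              simp only [Option.toList_some]
              omega
          -- Past the end of `B` stands the symbol `σ`, which no character of `A` equals, so the
          -- mismatch pays for a deletion.
          · have hjy : y.length ≤ j := by simpa [hy] using hjn
            rw [mismatch, if_neg]
            · rw [List.take_of_length_le hjy] at hxt ⊢
              rw [List.take_of_length_le (l := y) (i := j + 1) (by omega)]
              omega
            · rw [← hj, charAt, charAt, dif_pos (by omega), dif_neg (by omega)]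
              exact (Fin.isLt _).ne
      omega
  have h1 := key n le_rfl
  have h2 := editDist_take_take y (n + p n - k) n
  have h3 := editDist_triangle (x.take n) (y.take (n + p n - k)) (y.take n)
  have hpn := hp n
  rw [List.take_of_length_le (l := x) (by simp [hx]),
    List.take_of_length_le (l := y) (i := n) (by simp [hy])] at h3
  rw [List.take_of_length_le (l := x) (by simp [hx])] at h1
  rw [List.take_of_length_le (l := y) (i := n) (by simp [hy])] at h2
  have h4 : Nat.dist (n + p n - k) n ≤ k := by unfold Nat.dist; omega
  change editDist x y ≤ _
  omega

theorem stringED_le_minCost {n σ : ℕ} (A B : Fin n → Fin σ) (k : ℕ) :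
    stringED A B ≤ minCost (mismatch (charAt A) (charAt B) k) (2 * k) 0 n + 4 * k := by
  obtain ⟨p, hp, hc⟩ := cheap_minCost (c := mismatch (charAt A) (charAt B) k) (2 * k) 0 n
  exact (stringED_le_pathCost A B k p hp).trans (Nat.add_le_add_right hc _)

/-! ## Independent random words -/

/-- A random word reduced modulo `N` is only nearly uniform: a residue `b` has at least the
preimages `b + N * q` with `q < W / N`, and at most one more. For `N ≤ W` this is within a factor 2
of uniform, the source of the factors 2 in the probability bounds. -/
theorem card_mod_mem_ge {N : ℕ} (W : ℕ) (bad : Finset ℕ) (hb : ∀ b ∈ bad, b < N) :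
    bad.card * (W / N) ≤ (Finset.univ.filter fun v : Fin W => (v : ℕ) % N ∈ bad).card := by
  rw [← Finset.card_range (W / N), ← Finset.card_product]
  refine Finset.card_le_card_of_surjOn (fun v : Fin W => ((v : ℕ) % N, (v : ℕ) / N)) ?_
  rintro ⟨b, q⟩ hx
  rw [Finset.mem_coe, Finset.mem_product, Finset.mem_range] at hx
  have h1 := hb _ hx.1
  have h2 := Nat.mul_le_mul_left N (Nat.succ_le_of_lt hx.2)
  have h3 := Nat.mul_div_le W N
  rw [Nat.succ_eq_add_one, mul_add] at h2
  dsimp only at *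
  refine ⟨⟨b + N * q, by omega⟩, ?_, ?_⟩
  · simpa [Nat.mod_eq_of_lt h1] using hx.1
  · simp [Nat.mod_eq_of_lt h1, Nat.add_mul_div_left _ _ (Nat.zero_lt_of_lt h1),
      Nat.div_eq_of_lt h1]

theorem card_mod_mem_le (N W : ℕ) (bad : Finset ℕ) :
    (Finset.univ.filter fun v : Fin W => (v : ℕ) % N ∈ bad).card ≤ bad.card * (W / N + 1) := by
  rw [← Finset.card_range (W / N + 1), ← Finset.card_product]
  refine Finset.card_le_card_of_injOn (fun v => ((v : ℕ) % N, (v : ℕ) / N)) ?_ ?_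
  · intro v hv
    rw [Finset.mem_coe, Finset.mem_filter] at hv
    simp only [Finset.coe_product, Set.mem_prod, Finset.mem_coe, Finset.mem_range]
    exact ⟨hv.2, Nat.lt_succ_of_le (Nat.div_le_div_right v.2.le)⟩
  · intro v _ v' _ h
    simp only [Prod.mk.injEq] at h
    refine Fin.ext ?_
    rw [← Nat.mod_add_div (v : ℕ) N, h.1, h.2, Nat.mod_add_div]

namespace WordRAM

instance (w : ℕ) : IsProbabilityMeasure (coinLaw w) := by
  unfold coinLaw; infer_instance

theorem coinLaw_forall (w : ℕ) (s : Finset ℕ) (T : ℕ → Set (Fin (2 ^ w))) :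
    coinLaw w {ω | ∀ i ∈ s, ω i ∈ T i} =
      ∏ i ∈ s, (PMF.uniformOfFintype (Fin (2 ^ w))).toMeasure (T i) := by
  rw [coinLaw, ← Measure.infinitePi_pi _ fun i _ => MeasurableSet.of_discrete]
  rfl

theorem uniform_real (w : ℕ) (p : Fin (2 ^ w) → Prop) [DecidablePred p] :
    (PMF.uniformOfFintype (Fin (2 ^ w))).toMeasure {v | p v} =
      ENNReal.ofReal ((Finset.univ.filter p).card / 2 ^ w) := by
  rw [PMF.toMeasure_uniformOfFintype_apply _ MeasurableSet.of_discrete]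
  have : Fintype.card {v | p v} = (Finset.univ.filter p).card := by
    rw [← Set.toFinset_card]; congr 1; ext; simp
  rw [this, Fintype.card_fin, ENNReal.ofReal_div_of_pos (by positivity)]
  norm_cast

theorem uniform_mod_mem_le {w N : ℕ} (hN : 0 < N) (hW : N ≤ 2 ^ w) (bad : Finset ℕ) :
    (PMF.uniformOfFintype (Fin (2 ^ w))).toMeasure {v | (v : ℕ) % N ∈ bad} ≤
      ENNReal.ofReal (2 * bad.card / N) := by
  rw [uniform_real]
  refine ENNReal.ofReal_le_ofReal ?_
  have h1 : ((Finset.univ.filter fun v : Fin (2 ^ w) => (v : ℕ) % N ∈ bad).card : ℝ) ≤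
      bad.card * ((2 ^ w / N : ℕ) + 1 : ℕ) := by exact_mod_cast card_mod_mem_le N (2 ^ w) bad
  have h2 : ((2 ^ w / N : ℕ) : ℝ) * N ≤ 2 ^ w := by exact_mod_cast Nat.div_mul_le_self (2 ^ w) N
  have h3 : (N : ℝ) ≤ 2 ^ w := by exact_mod_cast hW
  have hN' : (0 : ℝ) < N := by exact_mod_cast hN
  rw [div_le_div_iff₀ (by positivity) hN']
  push_cast at h1
  calc _ ≤ (bad.card : ℝ) * ((2 ^ w / N : ℕ) + 1) * N := by gcongr
    _ = bad.card * ((2 ^ w / N : ℕ) * N + N) := by ring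
    _ ≤ bad.card * (2 ^ w + 2 ^ w) := by gcongr
    _ = _ := by ring

theorem uniform_mod_notMem_le {w N : ℕ} (hN : 0 < N) (hW : N ≤ 2 ^ w) (bad : Finset ℕ)
    (hb : ∀ b ∈ bad, b < N) :
    (PMF.uniformOfFintype (Fin (2 ^ w))).toMeasure {v | (v : ℕ) % N ∉ bad} ≤
      ENNReal.ofReal (Real.exp (-(bad.card / (2 * N)))) := by
  rw [uniform_real]
  refine ENNReal.ofReal_le_ofReal ?_
  refine le_trans ?_ (Real.one_sub_le_exp_neg _)
  have h0 := Finset.card_filter_add_card_filter_not (s := Finset.univ)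
    (fun v : Fin (2 ^ w) => (v : ℕ) % N ∈ bad)
  have h1 := card_mod_mem_ge (2 ^ w) bad hb
  have h2 : 2 ^ w ≤ 2 * N * (2 ^ w / N) := by
    have e := Nat.div_add_mod (2 ^ w) N
    have l := Nat.mod_lt (2 ^ w) hN
    have p : 1 ≤ 2 ^ w / N := (Nat.one_le_div_iff hN).2 hW
    nlinarith
  rw [Finset.card_univ, Fintype.card_fin] at h0
  rw [div_le_iff₀ (by positivity)]
  have hN' : (0 : ℝ) < N := by exact_mod_cast hN
  have h3 : (bad.card : ℝ) / (2 * N) * 2 ^ w ≤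
      ((Finset.univ.filter fun v : Fin (2 ^ w) => (v : ℕ) % N ∈ bad).card : ℝ) := by
    refine le_trans ?_ (Nat.cast_le.2 h1)
    rw [div_mul_eq_mul_div, div_le_iff₀ (by positivity)]
    have : (2 ^ w : ℝ) ≤ 2 * N * (2 ^ w / N : ℕ) := by exact_mod_cast h2
    calc (bad.card : ℝ) * 2 ^ w ≤ bad.card * (2 * N * (2 ^ w / N : ℕ)) := by gcongr
      _ = _ := by push_cast; ring
  have h4 : ((Finset.univ.filter fun v : Fin (2 ^ w) => (v : ℕ) % N ∈ bad).card : ℝ) +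
      (Finset.univ.filter fun v : Fin (2 ^ w) => (v : ℕ) % N ∉ bad).card = 2 ^ w := by
    exact_mod_cast h0
  linarith

/-- Distinct random words are unlikely to avoid large sets of residues. -/
theorem coinLaw_avoid_le {w N : ℕ} (hN : 0 < N) (hW : N ≤ 2 ^ w) (R : ℕ) (idx : ℕ → ℕ)
    (hidx : Function.Injective idx) (bad : ℕ → Finset ℕ) (hb : ∀ i, ∀ b ∈ bad i, b < N) :
    coinLaw w {ω | ∀ i < R, (ω (idx i) : ℕ) % N ∉ bad i} ≤
      ENNReal.ofReal (Real.exp (-((∑ i ∈ Finset.range R, (bad i).card : ℕ) / (2 * N)))) := by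
  have e : {ω : ℕ → Fin (2 ^ w) | ∀ i < R, (ω (idx i) : ℕ) % N ∉ bad i} =
      {ω | ∀ j ∈ (Finset.range R).image idx,
        ω j ∈ {v : Fin (2 ^ w) | (v : ℕ) % N ∉ bad (Function.invFun idx j)}} := by
    ext ω
    simp [Function.leftInverse_invFun hidx _]
  rw [e, coinLaw_forall, Finset.prod_image fun _ _ _ _ h => hidx h]
  simp only [Function.leftInverse_invFun hidx _]
  refine (Finset.prod_le_prod' fun i _ => uniform_mod_notMem_le hN hW (bad i) (hb i)).trans ?_
  rw [← ENNReal.ofReal_prod_of_nonneg fun i _ => (Real.exp_pos _).le, ← Real.exp_sum]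
  rw [Finset.sum_neg_distrib, ← Finset.sum_div]
  push_cast
  rfl

/-- Independent repetitions of a union of unlikely events. -/
theorem coinLaw_repeat_le {w : ℕ} {ι : Type*} (I : Finset ι) (N : ι → ℕ)
    (hN : ∀ a ∈ I, 0 < N a ∧ N a ≤ 2 ^ w) (bad : ι → Finset ℕ) (R : ℕ) (idx : Fin R → ι → ℕ)
    (hidx : ∀ r r', ∀ a ∈ I, ∀ a' ∈ I, idx r a = idx r' a' → r = r') :
    coinLaw w {ω | ∀ r, ∃ a ∈ I, (ω (idx r a) : ℕ) % N a ∈ bad a} ≤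
      ENNReal.ofReal ((∑ a ∈ I, 2 * ((bad a).card : ℝ) / N a) ^ R) := by
  classical
  -- Choose the culprit `f r` of every repetition. For fixed `f` the indices `idx r (f r)` are
  -- distinct, so probabilities multiply, and summing the products over all `f` expands the `R`-th
  -- power. Indices need not be distinct within one repetition.
  have hsub : {ω : ℕ → Fin (2 ^ w) | ∀ r, ∃ a ∈ I, (ω (idx r a) : ℕ) % N a ∈ bad a} ⊆
      ⋃ f ∈ Fintype.piFinset fun _ : Fin R => I,
        {ω | ∀ r, (ω (idx r (f r)) : ℕ) % N (f r) ∈ bad (f r)} := by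
    intro ω hω
    choose f hf hf' using hω
    simp only [Set.mem_iUnion]
    exact ⟨f, Fintype.mem_piFinset.2 hf, hf'⟩
  refine (measure_mono hsub).trans ((measure_biUnion_finset_le _ _).trans ?_)
  have h1 : ∀ f ∈ Fintype.piFinset fun _ : Fin R => I,
      coinLaw w {ω | ∀ r, (ω (idx r (f r)) : ℕ) % N (f r) ∈ bad (f r)} ≤
        ∏ r, ENNReal.ofReal (2 * (bad (f r)).card / N (f r)) := by
    intro f hf
    rw [Fintype.mem_piFinset] at hf
    rcases Nat.eq_zero_or_pos R with rfl | hR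
    · simp
    have : Nonempty (Fin R) := ⟨⟨0, hR⟩⟩
    have hinj : Function.Injective fun r => idx r (f r) :=
      fun r r' h => hidx r r' _ (hf r) _ (hf r') h
    have e : {ω : ℕ → Fin (2 ^ w) | ∀ r, (ω (idx r (f r)) : ℕ) % N (f r) ∈ bad (f r)} =
        {ω | ∀ j ∈ Finset.univ.image fun r => idx r (f r), ω j ∈ {v : Fin (2 ^ w) |
          (v : ℕ) % N (f (Function.invFun (fun r => idx r (f r)) j)) ∈
            bad (f (Function.invFun (fun r => idx r (f r)) j))}} := by
      ext ω
      have := Function.leftInverse_invFun hinj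
      simp only [Function.LeftInverse] at this
      simp [this]
    have hl := Function.leftInverse_invFun hinj
    simp only [Function.LeftInverse] at hl
    rw [e, coinLaw_forall, Finset.prod_image fun _ _ _ _ h => hinj h]
    simp only [hl]
    exact Finset.prod_le_prod' fun r _ => uniform_mod_mem_le (hN _ (hf r)).1 (hN _ (hf r)).2 _
  refine (Finset.sum_le_sum h1).trans ?_
  rw [← Finset.prod_univ_sum (fun _ : Fin R => I)
    (fun _ a => ENNReal.ofReal (2 * ((bad a).card : ℝ) / N a)), Finset.prod_const,
    Finset.card_univ, Fintype.card_fin, ENNReal.ofReal_pow (by positivity),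
    ENNReal.ofReal_sum_of_nonneg fun a _ => by positivity]

end WordRAM

/-! ## Reasoning about programs -/

namespace WordRAM

instance : Add Expr := ⟨.op .add⟩
instance : Sub Expr := ⟨.op .sub⟩
instance : Mul Expr := ⟨.op .mul⟩
instance : Div Expr := ⟨.op .div⟩
instance : Mod Expr := ⟨.op .mod⟩
instance (v : ℕ) : OfNat Expr v := ⟨.const v⟩

/-- Comparison of two expressions. -/
def Expr.lt (a b : Expr) : Expr := .op .lt a b

/-- Equality test of two expressions. -/
def Expr.beq (a b : Expr) : Expr := .op .eq a b

/-- The minimum of two expressions. -/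
def Expr.min (a b : Expr) : Expr := a - (a - b)

section eval

variable {E : Env} {s : State} {a b : Expr} {x y : ℕ}

theorem eval_zero : Expr.eval E s 0 = 0 := Nat.zero_mod _

theorem eval_one (h : 1 < 2 ^ E.wordSize) : Expr.eval E s 1 = 1 := Nat.mod_eq_of_lt h

theorem eval_two (h : 2 < 2 ^ E.wordSize) : Expr.eval E s 2 = 2 := Nat.mod_eq_of_lt h

theorem eval_add (ha : a.eval E s = x) (hb : b.eval E s = y) (h : x + y < 2 ^ E.wordSize) :
    (a + b).eval E s = x + y := by
  subst ha hb; exact Nat.mod_eq_of_lt h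

theorem eval_mul (ha : a.eval E s = x) (hb : b.eval E s = y) (h : x * y < 2 ^ E.wordSize) :
    (a * b).eval E s = x * y := by
  subst ha hb; exact Nat.mod_eq_of_lt h

theorem eval_sub (ha : a.eval E s = x) (hb : b.eval E s = y) (h : x < 2 ^ E.wordSize) :
    (a - b).eval E s = x - y := by
  subst ha hb; exact Nat.mod_eq_of_lt ((Nat.sub_le _ _).trans_lt h)

theorem eval_div (ha : a.eval E s = x) (hb : b.eval E s = y) (h : x < 2 ^ E.wordSize) :
    (a / b).eval E s = x / y := by
  subst ha hb; exact Nat.mod_eq_of_lt ((Nat.div_le_self _ _).trans_lt h)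

theorem eval_mod (ha : a.eval E s = x) (hb : b.eval E s = y) (h : x < 2 ^ E.wordSize) :
    (a % b).eval E s = x % y := by
  subst ha hb; exact Nat.mod_eq_of_lt ((Nat.mod_le _ _).trans_lt h)

theorem eval_lt (ha : a.eval E s = x) (hb : b.eval E s = y) (h : 1 < 2 ^ E.wordSize) :
    (a.lt b).eval E s = if x < y then 1 else 0 := by
  subst ha hb; exact Nat.mod_eq_of_lt (by simp only [Op.eval]; split_ifs <;> omega)

theorem eval_beq (ha : a.eval E s = x) (hb : b.eval E s = y) (h : 1 < 2 ^ E.wordSize) :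
    (a.beq b).eval E s = if x = y then 1 else 0 := by
  subst ha hb; exact Nat.mod_eq_of_lt (by simp only [Op.eval]; split_ifs <;> omega)

theorem eval_min (ha : a.eval E s = x) (hb : b.eval E s = y) (h : x < 2 ^ E.wordSize) :
    (a.min b).eval E s = min x y := by
  have := eval_sub ha (eval_sub ha hb h) h
  rw [Expr.min, this]; omega

theorem eval_load (ha : a.eval E s = x) : (Expr.load a).eval E s = s.mem x := by
  subst ha; rfl

theorem eval_charA (ha : a.eval E s = x) : (Expr.charA a).eval E s = E.charA x := by
  subst ha; rfl

theorem eval_charB (ha : a.eval E s = x) : (Expr.charB a).eval E s = E.charB x := by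
  subst ha; rfl

end eval

/-- Started in `s`, the program `p` halts after at most `T` steps in a state that satisfies `Q`. -/
def Runs (E : Env) (p : Cmd) (s : State) (T : ℕ) (Q : State → Prop) : Prop :=
  ∃ s' t, Exec E p s s' t ∧ t ≤ T ∧ Q s'

namespace Runs

variable {E : Env} {p q : Cmd} {s : State} {a b : Expr} {T T' : ℕ} {Q Q' : State → Prop}

theorem mono (h : Runs E p s T Q) (hT : T ≤ T') (hQ : ∀ s', Q s' → Q' s') :
    Runs E p s T' Q' := by
  obtain ⟨s', t, he, ht, hq⟩ := h
  exact ⟨s', t, he, ht.trans hT, hQ _ hq⟩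

theorem assign {x v : ℕ} (hv : a.eval E s = v)
    (hQ : Q { s with reg := Function.update s.reg x v }) :
    Runs E (.assign x a) s (a.cost + 1) Q := by
  subst hv; exact ⟨_, _, .assign x a s, le_rfl, hQ⟩

theorem store {u v : ℕ} (hu : a.eval E s = u) (hv : b.eval E s = v)
    (hQ : Q { s with mem := Function.update s.mem u v }) :
    Runs E (.store a b) s (a.cost + b.cost + 1) Q := by
  subst hu hv; exact ⟨_, _, .store a b s, le_rfl, hQ⟩

theorem rand {x : ℕ} (hQ : Q { s with
      reg := Function.update s.reg x (E.coin s.drawn), drawn := s.drawn + 1 }) :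
    Runs E (.rand x) s 1 Q := ⟨_, _, .rand x s, le_rfl, hQ⟩

theorem seq (h : Runs E p s T fun s' => Runs E q s' T' Q) : Runs E (.seq p q) s (T + T') Q := by
  obtain ⟨s', t, he, ht, s'', t', he', ht', hq⟩ := h
  exact ⟨s'', _, .seq he he', by omega, hq⟩

theorem ite (h : a.eval E s ≠ 0 → Runs E p s T Q) (h' : a.eval E s = 0 → Runs E q s T Q) :
    Runs E (.ite a p q) s (a.cost + 1 + T) Q := by
  by_cases ha : a.eval E s = 0
  · obtain ⟨s', t, he, ht, hq⟩ := h' ha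
    exact ⟨s', _, .ite_false ha he, by omega, hq⟩
  · obtain ⟨s', t, he, ht, hq⟩ := h ha
    exact ⟨s', _, .ite_true ha he, by omega, hq⟩

/-- A loop with invariant `I` whose body runs `N` times. -/
theorem loop (I : ℕ → State → Prop) (N : ℕ) (h0 : I 0 s)
    (step : ∀ j < N, ∀ s, I j s → a.eval E s ≠ 0 ∧ Runs E p s T (I (j + 1)))
    (hend : ∀ s, I N s → a.eval E s = 0 ∧ Q s) :
    Runs E (.while a p) s (N * (a.cost + 1 + T) + (a.cost + 1)) Q := by
  have key : ∀ m j, j + m = N → ∀ s, I j s →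
      Runs E (.while a p) s (m * (a.cost + 1 + T) + (a.cost + 1)) Q := by
    intro m
    induction m with
    | zero =>
      intro j hj s hs
      rw [add_zero] at hj
      subst hj
      exact ⟨s, _, .while_false (hend s hs).1, by omega, (hend s hs).2⟩
    | succ m ih =>
      intro j hj s hs
      obtain ⟨ha, s', t, he, ht, hI⟩ := step j (by omega) s hs
      obtain ⟨s'', t', he', ht', hq⟩ := ih (j + 1) (by omega) s' hI
      exact ⟨s'', _, .while_true ha he he', by rw [Nat.add_mul]; omega, hq⟩
  exact key N 0 (by omega) s h0

end Runs

open Classical in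
/-- The truth value of a proposition as a number. -/
noncomputable def truth (p : Prop) : ℕ := if p then 1 else 0

theorem truth_true {p : Prop} (h : p) : truth p = 1 := if_pos h

theorem truth_false {p : Prop} (h : ¬ p) : truth p = 0 := if_neg h

theorem truth_le_one (p : Prop) : truth p ≤ 1 := by
  unfold truth; split_ifs <;> norm_num

theorem truth_congr {p q : Prop} (h : p ↔ q) : truth p = truth q := by rw [propext h]

theorem truth_or (p q : Prop) : (if 0 < truth p + truth q then 1 else 0) = truth (p ∨ q) := by
  by_cases hp : p <;> by_cases hq : q <;> simp [truth, hp, hq]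

theorem truth_not (p : Prop) : (if truth p = 0 then 1 else 0) = truth (¬ p) := by
  by_cases hp : p <;> simp [truth, hp]

/-! ## One step of the dynamic program -/

/-- The running values of a sweep: from one index to the next the value grows by one or drops to
the entry of `f`. -/
def sweep (v : ℕ) (f : ℕ → ℕ) : ℕ → ℕ
  | 0 => v
  | j + 1 => min (sweep v f j + 1) (f j)

theorem sweep_le (v : ℕ) (f : ℕ → ℕ) {i j : ℕ} (h : i ≤ j) : sweep v f (j + 1) ≤ f i + (j - i) := by
  induction j, h using Nat.le_induction with
  | base => simp [sweep]
  | succ j h ih =>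
    have : sweep v f (j + 1 + 1) ≤ sweep v f (j + 1) + 1 := min_le_left _ _
    omega

theorem exists_le_sweep {v : ℕ} {f : ℕ → ℕ} (hv : f 0 ≤ v + 1) (j : ℕ) :
    ∃ i ≤ j, f i + (j - i) ≤ sweep v f (j + 1) := by
  induction j with
  | zero => exact ⟨0, le_rfl, by simpa [sweep] using hv⟩
  | succ j ih =>
    obtain ⟨i, hi, h⟩ := ih
    rcases min_choice (sweep v f (j + 1) + 1) (f (j + 1)) with h' | h'
    · exact ⟨i, by omega, by rw [sweep, h']; omega⟩
    · exact ⟨j + 1, le_rfl, by rw [sweep, h']; omega⟩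

/-- `f'` arises from `f` by adding the local costs `c` and relaxing along all shift changes. -/
def Relaxed (c : ℕ → ℕ) (k : ℕ) (f f' : ℕ → ℕ) : Prop :=
  (∀ s ≤ k, ∀ s' ≤ k, f' s ≤ f s' + c s' + Nat.dist s s') ∧
    ∀ s ≤ k, ∃ s' ≤ k, f s' + c s' + Nat.dist s s' ≤ f' s

/-- The minimum over `s'` of `f s' + c s' + |s - s'|` splits by the sign of `s - s'`: the upward
sweep handles `s' ≤ s`, the downward sweep of its result the rest, so one relaxation takes time
linear in `k`. The starting values never win, since they grow by 1 before the first comparison and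
`c 0 ≤ 1`. -/
theorem relaxed_sweep {c : ℕ → ℕ} (hc : ∀ s, c s ≤ 1) {k : ℕ} {f f₁ f₂ : ℕ → ℕ}
    (h₁ : ∀ s ≤ k, f₁ s = sweep (f 0) (fun t => f t + c t) (s + 1))
    (h₂ : ∀ s ≤ k, f₂ s = sweep (f₁ k) (fun t => f₁ (k - t)) (k + 1 - s)) :
    Relaxed c k f f₂ := by
  constructor
  · intro s hs s' hs'
    rw [h₂ s hs, show k + 1 - s = k - s + 1 by omega]
    rcases Nat.le_total s' s with h | h
    · refine (sweep_le _ _ le_rfl).trans ?_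
      have := sweep_le (f 0) (fun t => f t + c t) h
      rw [show k - (k - s) = s by omega, h₁ s hs]
      unfold Nat.dist; omega
    · refine (sweep_le (i := k - s') _ _ (by omega)).trans ?_
      have := sweep_le (f 0) (fun t => f t + c t) (le_refl s')
      rw [show k - (k - s') = s' by omega, h₁ s' hs']
      unfold Nat.dist; omega
  · intro s hs
    rw [h₂ s hs, show k + 1 - s = k - s + 1 by omega]
    obtain ⟨i, hi, h⟩ := exists_le_sweep (v := f₁ k) (f := fun t => f₁ (k - t)) (by simp) (k - s)
    obtain ⟨s', hs', h'⟩ := exists_le_sweep (v := f 0) (f := fun t => f t + c t)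
      (Nat.add_le_add_left (hc 0) _) (k - i)
    rw [h₁ (k - i) (by omega)] at h
    refine ⟨s', by omega, ?_⟩
    unfold Nat.dist; omega

/-- The table `f` holds, for every final shift, the least cost of a path on `x ≤ i < y`. -/
structure IsTable (c : ℕ → ℕ → ℕ) (k x y : ℕ) (f : ℕ → ℕ) : Prop where
  le : ∀ p : ℕ → ℕ, (∀ i, p i ≤ k) → f (p y) ≤ pathCost c p x y
  exists_path : ∀ s ≤ k, ∃ p : ℕ → ℕ, (∀ i, p i ≤ k) ∧ p y = s ∧ pathCost c p x y ≤ f s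
  lipschitz : ∀ s ≤ k, ∀ s' ≤ k, f s ≤ f s' + Nat.dist s s'

theorem isTable_zero (c : ℕ → ℕ → ℕ) (k x : ℕ) {f : ℕ → ℕ} (hf : ∀ s ≤ k, f s = 0) :
    IsTable c k x x f where
  le p hp := by rw [hf _ (hp x)]; exact Nat.zero_le _
  exists_path s hs := ⟨fun _ => s, fun _ => hs, rfl, by simp [pathCost_self]⟩
  lipschitz s hs s' _ := by rw [hf s hs]; exact Nat.zero_le _

/-- A whole group needs a single relaxation because only position `i` carries local costs. Shift
changes before `i` are absorbed by the Lipschitz property of the old table, those after `i` by the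
relaxation. -/
theorem IsTable.step {c : ℕ → ℕ → ℕ} {k x y i g : ℕ} {f f' : ℕ → ℕ} (h : IsTable c k x y f)
    (hxy : x ≤ y) (hi : y ≤ i) (hig : i < y + g)
    (hc : ∀ j, y ≤ j → j < y + g → j ≠ i → ∀ s, c j s = 0) (hr : Relaxed (c i) k f f') :
    IsTable c k x (y + g) f' where
  le p hp := by
    rw [← pathCost_add c p hxy (by omega), ← pathCost_add c p hi hig.le,
      ← pathCost_add c p (Nat.le_succ i) (Nat.succ_le_of_lt hig), Nat.succ_eq_add_one,
      pathCost_succ c p le_rfl, pathCost_self]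
    have h1 := h.le p hp
    have h2 := dist_le_pathCost c p hi
    have h3 := dist_le_pathCost c p (Nat.succ_le_of_lt hig)
    have h4 := h.lipschitz (p i) (hp _) (p y) (hp _)
    have h5 := hr.1 (p (y + g)) (hp _) (p i) (hp _)
    have h6 := Nat.dist.triangle_inequality (p i) (p (i + 1)) (p (y + g))
    rw [Nat.dist_comm] at h4 h5
    rw [Nat.succ_eq_add_one] at h3
    omega
  exists_path s hs := by
    obtain ⟨s', hs', hle⟩ := hr.2 s hs
    obtain ⟨p, hp, hpy, hpc⟩ := h.exists_path s' hs'
    -- The extended path keeps the shift `s'` throughout the group and jumps to `s` in its last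
    -- step.
    refine ⟨fun j => if j ≤ y then p j else if j < y + g then s' else s, fun j => ?_, ?_, ?_⟩
    · dsimp only; split_ifs
      exacts [hp j, hs', hs]
    · simp [show ¬ y + g ≤ y by omega]
    · set q : ℕ → ℕ := fun j => if j ≤ y then p j else if j < y + g then s' else s with hq
      have q1 : ∀ j, y ≤ j → j < y + g → q j = s' := fun j h1 h2 => by
        simp only [hq]
        split_ifs with h3
        · rw [le_antisymm h3 h1, hpy]
        · rfl
      have e1 : pathCost c q x y = pathCost c p x y :=
        pathCost_congr (fun _ _ _ => rfl) fun j _ hj => by simp [hq, hj]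
      have e2 : ∀ z, y ≤ z → z < y + g → pathCost c q y z ≤ c i s' := by
        intro z hz hz'
        rw [pathCost]
        calc _ ≤ ∑ j ∈ Finset.Ico y z, if j = i then c i s' else 0 := by
              refine Finset.sum_le_sum fun j hj => ?_
              rw [Finset.mem_Ico] at hj
              rw [q1 j hj.1 (by omega), q1 (j + 1) (by omega) (by omega), Nat.dist_self]
              split_ifs with h
              · rw [h]; rfl
              · rw [hc j hj.1 (by omega) h]
          _ ≤ _ := by
              rw [Finset.sum_ite_eq']
              split_ifs <;> omega
      obtain ⟨g, rfl⟩ : ∃ g', g = g' + 1 := ⟨g - 1, by omega⟩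
      rw [← pathCost_add c q hxy (by omega), e1, ← add_assoc y, pathCost_succ c q (by omega),
        q1 (y + g) (by omega) (by omega)]
      have e3 : q (y + g + 1) = s := by simp [hq]; omega
      rw [e3, Nat.dist_comm]
      by_cases hlast : y + g = i
      · have e4 : pathCost c q y (y + g) = 0 := by
          refine Finset.sum_eq_zero fun j hj => ?_
          rw [Finset.mem_Ico] at hj
          rw [q1 j hj.1 (by omega), q1 (j + 1) (by omega) (by omega), Nat.dist_self,
            hc j hj.1 (by omega) (by omega), add_zero]
        rw [e4, hlast]; omega
      · have := e2 (y + g) (by omega) (by omega)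
        rw [hc (y + g) (by omega) (by omega) hlast]; omega
  lipschitz s hs s' hs' := by
    obtain ⟨t, ht, hle⟩ := hr.2 s' hs'
    have h1 := hr.1 s hs t ht
    have := Nat.dist.triangle_inequality s s' t
    omega

end WordRAM

namespace WordRAM

/-! ## The program -/

/-- Whether the characters at the position in register `21` of the first string and, with the shift
in register `22`, of the second string differ. -/
def mismatchExpr : Expr :=
  1 - (Expr.charA (.reg 21)).beq (.charB (.reg 21 + .reg 22 - .reg 7))

/-- Adds the mismatches at the position in register `21` and relaxes the table upwards. -/
def upSweep : Cmd :=
  .seq (.assign 22 0) <| .seq (.assign 24 (.load 0)) <|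
  .while ((Expr.reg 22).lt (.reg 7 + .reg 7 + 1)) <|
    .seq (.assign 24 ((Expr.reg 24 + 1).min (.load (.reg 22) + mismatchExpr))) <|
    .seq (.store (.reg 22) (.reg 24)) <|
    .assign 22 (.reg 22 + 1)

/-- Relaxes the table downwards. -/
def downSweep : Cmd :=
  .seq (.assign 22 (.reg 7 + .reg 7 + 1)) <| .seq (.assign 24 (.load (.reg 7 + .reg 7))) <|
  .while (.reg 22) <|
    .seq (.assign 22 (.reg 22 - 1)) <|
    .seq (.assign 24 ((Expr.reg 24 + 1).min (.load (.reg 22)))) <|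
    .store (.reg 22) (.reg 24)

/-- Sets the table to `0`. -/
def clearTable : Cmd :=
  .seq (.assign 22 0) <|
  .while ((Expr.reg 22).lt (.reg 7 + .reg 7 + 1)) <|
    .seq (.store (.reg 22) 0) <|
    .assign 22 (.reg 22 + 1)

/-- Sets register `23` to `1` if all table entries are at least the value of register `4`, and to
`0` otherwise. -/
def checkTable : Cmd :=
  .seq (.assign 23 1) <| .seq (.assign 22 0) <|
  .while ((Expr.reg 22).lt (.reg 7 + .reg 7 + 1)) <|
    .seq (.assign 23 (.reg 23 * (1 - (Expr.load (.reg 22)).lt (.reg 4)))) <|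
    .assign 22 (.reg 22 + 1)

/-- The dynamic program on a block that starts at the position in register `19` and has as many
groups, of the length in register `8`, as register `17` says; from every group one random position
is taken. The result of the test whether the sampled cost is large goes to register `23`. -/
def testBlock : Cmd :=
  .seq clearTable <| .seq (.assign 20 0) <| .seq
  (.while ((Expr.reg 20).lt (.reg 17)) <|
    .seq (.rand 21) <|
    .seq (.assign 21 (.reg 19 + .reg 20 * .reg 8 + .reg 21 % .reg 8)) <|
    .seq upSweep <| .seq downSweep <|
    .assign 20 (.reg 20 + 1))
  checkTable

/-! ### Correctness and time of the table routines -/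

variable {E : Env} {s : State}

theorem eval_mismatchExpr {i t k : ℕ} (h21 : s.reg 21 = i) (h22 : s.reg 22 = t)
    (h7 : s.reg 7 = k) (hW : i + t + 1 < 2 ^ E.wordSize) :
    mismatchExpr.eval E s = mismatch E.charA E.charB k i t := by
  have h1 := eval_charA (E := E) (a := .reg 21) h21
  have h2 := eval_charB (E := E) (eval_sub (eval_add (a := .reg 21) (b := .reg 22) h21 h22
    (by omega)) (b := .reg 7) h7 (by omega))
  rw [mismatchExpr, eval_sub (eval_one (by omega)) (eval_beq h1 h2 (by omega)) (by omega),
    mismatch]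
  split_ifs <;> rfl

/-- The sweep can work in place: at index `j` it reads only the old entry `j` and the previous new
value, which register `24` keeps. The bound `B` on the entries rules out wrap-around. -/
theorem upSweep_runs {k i B : ℕ} (h7 : s.reg 7 = k) (h21 : s.reg 21 = i)
    (hmem : ∀ t ≤ 2 * k, s.mem t ≤ B) (hW : i + 2 * k + B + 5 < 2 ^ E.wordSize) :
    Runs E upSweep s (60 * (2 * k + 1) + 20) fun s' =>
      (∀ x < 22, s'.reg x = s.reg x) ∧ s'.drawn = s.drawn ∧ ∀ t ≤ 2 * k, s'.mem t =
        sweep (s.mem 0) (fun t => s.mem t + mismatch E.charA E.charB k i t) (t + 1) := by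
  set h := sweep (s.mem 0) (fun t => s.mem t + mismatch E.charA E.charB k i t) with hh
  have hB : ∀ j ≤ 2 * k + 1, h j ≤ B + 1 := by
    intro j hj
    cases j with
    | zero => exact (hmem 0 (by omega)).trans (by omega)
    | succ j =>
      refine (min_le_right _ _).trans ?_
      dsimp only
      have := hmem j (by omega)
      have := mismatch_le_one E.charA E.charB k i j
      omega
  refine Runs.mono (T := _) (Runs.seq (Runs.assign eval_zero
    (Runs.seq (Runs.assign (eval_load eval_zero)
    (Runs.loop (fun j s' => (∀ x < 22, s'.reg x = s.reg x) ∧ s'.drawn = s.drawn ∧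
      s'.reg 22 = j ∧ s'.reg 24 = h j ∧ (∀ t < j, s'.mem t = h (t + 1)) ∧
      ∀ t, j ≤ t → s'.mem t = s.mem t) (2 * k + 1) (T := 50) ?_ ?_ ?_))))) ?_ fun _ h => h
  · refine ⟨fun x hx => ?_, rfl, rfl, rfl, fun t ht => by omega, fun t _ => rfl⟩
    simp [Function.update, show x ≠ 22 by omega, show x ≠ 24 by omega]
  · rintro j hj s' ⟨hr, hd, h22, h24, hlt, hge⟩
    have e7 : Expr.eval E s' (.reg 7) = k := (hr 7 (by omega)).trans h7
    have e22 : Expr.eval E s' (.reg 22) = j := h22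
    have hj' := hB j (by omega)
    have hm := hmem j (by omega)
    have hmis := mismatch_le_one E.charA E.charB k i j
    constructor
    · rw [eval_lt e22 (eval_add (eval_add e7 e7 (by omega)) (eval_one (by omega)) (by omega))
        (by omega), if_pos (by omega)]
      norm_num
    refine Runs.mono (Runs.seq (Runs.assign (eval_min (eval_add (a := .reg 24) h24
      (eval_one (by omega)) (by omega)) (eval_add (eval_load e22)
      (eval_mismatchExpr ((hr 21 (by omega)).trans h21) h22 e7 (by omega))
      (by rw [hge j le_rfl]; omega)) (by omega)) (Runs.seq (Runs.store (u := j) (v := h (j + 1))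
      e22 ?_ (Runs.assign (eval_add (x := j) (y := 1) (a := .reg 22) ?_ (eval_one (by omega))
      (by omega)) ?_))))) (by decide) fun _ h => h
    · rw [hge j le_rfl]; rfl
    · exact h22
    · refine ⟨fun x hx => ?_, hd, rfl, ?_, fun t ht => ?_, fun t ht => ?_⟩
      · simp only [Function.update, show x ≠ 22 by omega, show x ≠ 24 by omega]
        exact hr x hx
      · simp only [Function.update]; rw [hge j le_rfl]; rfl
      · rcases Nat.lt_succ_iff_lt_or_eq.1 ht with h' | rfl
        · simpa [Function.update, h'.ne] using hlt t h'
        · simp [Function.update]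
      · simpa [Function.update, show t ≠ j by omega] using hge t (by omega)
  · rintro s' ⟨hr, hd, h22, h24, hlt, hge⟩
    have e7 : Expr.eval E s' (.reg 7) = k := (hr 7 (by omega)).trans h7
    refine ⟨?_, hr, hd, fun t ht => hlt t (by omega)⟩
    rw [eval_lt (a := .reg 22) h22 (eval_add (eval_add e7 e7 (by omega)) (eval_one (by omega))
      (by omega)) (by omega), if_neg (by omega)]
  · simp only [show (Expr.lt (.reg 22) (.reg 7 + .reg 7 + 1)).cost = 7 from rfl,
      show (Expr.load 0).cost = 2 from rfl, show (0 : Expr).cost = 1 from rfl]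
    omega

theorem downSweep_runs {k B : ℕ} (h7 : s.reg 7 = k) (hmem : ∀ t ≤ 2 * k, s.mem t ≤ B)
    (hW : 2 * k + B + 5 < 2 ^ E.wordSize) :
    Runs E downSweep s (60 * (2 * k + 1) + 20) fun s' =>
      (∀ x < 22, s'.reg x = s.reg x) ∧ s'.drawn = s.drawn ∧ ∀ t ≤ 2 * k, s'.mem t =
        sweep (s.mem (2 * k)) (fun t => s.mem (2 * k - t)) (2 * k + 1 - t) := by
  set h := sweep (s.mem (2 * k)) (fun t => s.mem (2 * k - t)) with hh
  have hB : ∀ j ≤ 2 * k + 1, h j ≤ B := by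
    intro j hj
    cases j with
    | zero => exact hmem _ le_rfl
    | succ j => exact (min_le_right _ _).trans (hmem _ (by omega))
  have e7' : ∀ s' : State, s'.reg 7 = k → (Expr.reg 7 + .reg 7).eval E s' = k + k :=
    fun s' h => eval_add (a := .reg 7) (b := .reg 7) h h (by omega)
  refine Runs.mono (T := _) (Runs.seq (Runs.assign (eval_add (e7' _ h7) (eval_one (by omega))
    (by omega)) (Runs.seq (Runs.assign (eval_load (e7' _ h7))
    (Runs.loop (fun j s' => (∀ x < 22, s'.reg x = s.reg x) ∧ s'.drawn = s.drawn ∧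
      s'.reg 22 = 2 * k + 1 - j ∧ s'.reg 24 = h j ∧
      (∀ t ≤ 2 * k, 2 * k + 1 - j ≤ t → s'.mem t = h (2 * k + 1 - t)) ∧
      ∀ t, t < 2 * k + 1 - j → s'.mem t = s.mem t) (2 * k + 1) (T := 50) ?_ ?_ ?_)))))
      ?_ fun _ h => h
  · refine ⟨fun x hx => ?_, rfl, ?_, ?_, fun t ht ht' => by omega, fun t _ => rfl⟩
    · simp [Function.update, show x ≠ 22 by omega, show x ≠ 24 by omega]
    · simp [Function.update]; omega
    · simp [Function.update, hh, sweep, two_mul]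
  · rintro j hj s' ⟨hr, hd, h22, h24, hge, hlt⟩
    have e22 : Expr.eval E s' (.reg 22) = 2 * k + 1 - j := h22
    have hj' := hB j (by omega)
    have hm := hmem (2 * k - j) (by omega)
    have hmj : s'.mem (2 * k - j) = s.mem (2 * k - j) := hlt _ (by omega)
    constructor
    · rw [e22]; omega
    refine Runs.mono (Runs.seq (Runs.assign (v := 2 * k - j) ?_
      (Runs.seq (Runs.assign (v := h (j + 1)) ?_ (Runs.store (u := 2 * k - j) (v := h (j + 1))
      rfl rfl ?_))))) (T := _) (by decide) fun _ h => h
    · rw [eval_sub e22 (eval_one (by omega)) (by omega)]; omega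
    · refine (eval_min (E := E) (s := { s' with reg := Function.update s'.reg 22 (2 * k - j) })
        (eval_add (a := .reg 24) (x := h j) h24 (eval_one (by omega)) (by omega))
        (eval_load (a := .reg 22) (x := 2 * k - j) rfl) (by omega)).trans ?_
      exact congrArg (min (h j + 1)) hmj
    · refine ⟨fun x hx => ?_, hd, ?_, rfl, fun t ht ht' => ?_, fun t ht => ?_⟩
      · simp only [Function.update, show x ≠ 22 by omega, show x ≠ 24 by omega]
        exact hr x hx
      · simp [Function.update]
      · rcases eq_or_ne t (2 * k - j) with rfl | h'
        · rw [show 2 * k + 1 - (2 * k - j) = j + 1 by omega]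
          simp [Function.update]
        · simpa [Function.update, h'] using hge t ht (by omega)
      · simpa [Function.update, show t ≠ 2 * k - j by omega] using hlt t (by omega)
  · rintro s' ⟨hr, hd, h22, h24, hge, hlt⟩
    exact ⟨h22.trans (by omega), hr, hd, fun t ht => hge t ht (by omega)⟩
  · simp only [show (Expr.reg 7 + Expr.reg 7 + 1).cost = 5 from rfl,
      show (Expr.load (Expr.reg 7 + Expr.reg 7)).cost = 4 from rfl,
      show (Expr.reg 22).cost = 1 from rfl]
    omega

theorem clearTable_runs {k : ℕ} (h7 : s.reg 7 = k) (hW : 2 * k + 5 < 2 ^ E.wordSize) :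
    Runs E clearTable s (60 * (2 * k + 1) + 20) fun s' =>
      (∀ x < 22, s'.reg x = s.reg x) ∧ s'.drawn = s.drawn ∧ ∀ t ≤ 2 * k, s'.mem t = 0 := by
  refine Runs.mono (T := _) (Runs.seq (Runs.assign eval_zero
    (Runs.loop (fun j s' => (∀ x < 22, s'.reg x = s.reg x) ∧ s'.drawn = s.drawn ∧
      s'.reg 22 = j ∧ ∀ t < j, s'.mem t = 0) (2 * k + 1) (T := 50) ?_ ?_ ?_))) ?_ fun _ h => h
  · refine ⟨fun x hx => ?_, rfl, rfl, fun t ht => by omega⟩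
    simp [Function.update, show x ≠ 22 by omega]
  · rintro j hj s' ⟨hr, hd, h22, hlt⟩
    have e7 : Expr.eval E s' (.reg 7) = k := (hr 7 (by omega)).trans h7
    have e22 : Expr.eval E s' (.reg 22) = j := h22
    constructor
    · rw [eval_lt e22 (eval_add (eval_add e7 e7 (by omega)) (eval_one (by omega)) (by omega))
        (by omega), if_pos (by omega)]
      norm_num
    refine Runs.mono (Runs.seq (Runs.store e22 eval_zero (Runs.assign (eval_add (x := j) (y := 1)
      (a := .reg 22) h22 (eval_one (by omega)) (by omega)) ?_))) (T := _) (by decide) fun _ h => h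
    refine ⟨fun x hx => ?_, hd, rfl, fun t ht => ?_⟩
    · simp only [Function.update, show x ≠ 22 by omega]
      exact hr x hx
    · rcases Nat.lt_succ_iff_lt_or_eq.1 ht with h' | rfl
      · simpa [Function.update, h'.ne] using hlt t h'
      · simp [Function.update]
  · rintro s' ⟨hr, hd, h22, hlt⟩
    have e7 : Expr.eval E s' (.reg 7) = k := (hr 7 (by omega)).trans h7
    refine ⟨?_, hr, hd, fun t ht => hlt t (by omega)⟩
    rw [eval_lt (a := .reg 22) h22 (eval_add (eval_add e7 e7 (by omega)) (eval_one (by omega))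
      (by omega)) (by omega), if_neg (by omega)]
  · simp only [show (Expr.lt (.reg 22) (.reg 7 + .reg 7 + 1)).cost = 7 from rfl,
      show (0 : Expr).cost = 1 from rfl]
    omega

theorem checkTable_runs {k r : ℕ} (h7 : s.reg 7 = k) (h4 : s.reg 4 = r)
    (hW : 2 * k + 5 < 2 ^ E.wordSize) :
    Runs E checkTable s (60 * (2 * k + 1) + 20) fun s' =>
      (∀ x < 22, s'.reg x = s.reg x) ∧ s'.drawn = s.drawn ∧
        s'.reg 23 = truth (∀ t ≤ 2 * k, r ≤ s.mem t) := by
  refine Runs.mono (T := _) (Runs.seq (Runs.assign (eval_one (by omega)) (Runs.seq (Runs.assign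
    eval_zero (Runs.loop (fun j s' => (∀ x < 22, s'.reg x = s.reg x) ∧ s'.drawn = s.drawn ∧
      s'.mem = s.mem ∧ s'.reg 22 = j ∧ s'.reg 23 = truth (∀ t < j, r ≤ s.mem t))
      (2 * k + 1) (T := 50) ?_ ?_ ?_))))) ?_ fun _ h => h
  · refine ⟨fun x hx => ?_, rfl, rfl, rfl, ?_⟩
    · simp [Function.update, show x ≠ 22 by omega, show x ≠ 23 by omega]
    · simp [Function.update, truth]
  · rintro j hj s' ⟨hr, hd, hm, h22, h23⟩
    have e7 : Expr.eval E s' (.reg 7) = k := (hr 7 (by omega)).trans h7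
    have e4 : Expr.eval E s' (.reg 4) = r := (hr 4 (by omega)).trans h4
    have e22 : Expr.eval E s' (.reg 22) = j := h22
    constructor
    · rw [eval_lt e22 (eval_add (eval_add e7 e7 (by omega)) (eval_one (by omega)) (by omega))
        (by omega), if_pos (by omega)]
      norm_num
    refine Runs.mono (Runs.seq (Runs.assign (eval_mul (a := .reg 23) h23 (eval_sub (eval_one
      (by omega)) (eval_lt (eval_load e22) e4 (by omega)) (by omega)) ?_) (Runs.assign
      (eval_add (x := j) (y := 1) (a := .reg 22) h22 (eval_one (by omega)) (by omega)) ?_)))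
      (T := _) (by decide) fun _ h => h
    · have := truth_le_one (∀ t < j, r ≤ s.mem t)
      split_ifs <;> omega
    · refine ⟨fun x hx => ?_, hd, hm, rfl, ?_⟩
      · simp only [Function.update, show x ≠ 22 by omega, show x ≠ 23 by omega]
        exact hr x hx
      · have : (∀ t < j + 1, r ≤ s.mem t) ↔ (∀ t < j, r ≤ s.mem t) ∧ r ≤ s.mem j := by
          constructor
          · exact fun h => ⟨fun t ht => h t (by omega), h j (by omega)⟩
          · rintro ⟨h, h'⟩ t ht
            rcases Nat.lt_succ_iff_lt_or_eq.1 ht with h1 | rfl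
            exacts [h t h1, h']
        simp only [Function.update, this, hm]
        by_cases h1 : ∀ t < j, r ≤ s.mem t <;> by_cases h2 : r ≤ s.mem j <;>
          simp [truth, h1, h2, not_lt.2, lt_of_not_ge]
  · rintro s' ⟨hr, hd, hm, h22, h23⟩
    have e7 : Expr.eval E s' (.reg 7) = k := (hr 7 (by omega)).trans h7
    refine ⟨?_, hr, hd, ?_⟩
    · rw [eval_lt (a := .reg 22) h22 (eval_add (eval_add e7 e7 (by omega)) (eval_one (by omega))
        (by omega)) (by omega), if_neg (by omega)]
    · rw [h23]
      exact truth_congr (by simp only [Nat.lt_succ_iff])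
  · simp only [show (Expr.lt (.reg 22) (.reg 7 + .reg 7 + 1)).cost = 7 from rfl,
      show (0 : Expr).cost = 1 from rfl, show (1 : Expr).cost = 1 from rfl]
    omega

/-- The sampled positions in the `G` groups of length `g` from position `x` on. -/
def sampled (coin : ℕ → ℕ) (D x g G : ℕ) : Set ℕ :=
  {i | ∃ γ < G, i = x + γ * g + coin (D + γ) % g}

open Classical in
/-- Local costs restricted to a set of positions. -/
noncomputable def restrictCost (c : ℕ → ℕ → ℕ) (S : Set ℕ) (i s : ℕ) : ℕ :=
  if i ∈ S then c i s else 0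

theorem restrictCost_le (c : ℕ → ℕ → ℕ) (S : Set ℕ) (i s : ℕ) : restrictCost c S i s ≤ c i s := by
  unfold restrictCost; split_ifs
  exacts [le_rfl, Nat.zero_le _]

/-- The test of a block finds that the sampled cost of every path is at least `r`. -/
def Flagged (c : ℕ → ℕ → ℕ) (k r : ℕ) (coin : ℕ → ℕ) (D x g G : ℕ) : Prop :=
  ∀ p : ℕ → ℕ, (∀ i, p i ≤ k) →
    r ≤ pathCost (restrictCost c (sampled coin D x g G)) p x (x + G * g)

theorem IsTable.forall_le_iff {c : ℕ → ℕ → ℕ} {k x y : ℕ} {f : ℕ → ℕ} (h : IsTable c k x y f)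
    (r : ℕ) : (∀ t ≤ k, r ≤ f t) ↔ ∀ p : ℕ → ℕ, (∀ i, p i ≤ k) → r ≤ pathCost c p x y := by
  constructor
  · exact fun h' p hp => (h' _ (hp y)).trans (h.le p hp)
  · intro h' t ht
    obtain ⟨p, hp, _, hc⟩ := h.exists_path t ht
    exact (h' p hp).trans hc

theorem IsTable.le_length {c : ℕ → ℕ → ℕ} (hc : ∀ i s, c i s ≤ 1) {k x y : ℕ} {f : ℕ → ℕ}
    (h : IsTable c k x y f) {t : ℕ} (ht : t ≤ k) : f t ≤ y - x := by
  refine (h.le (fun _ => t) fun _ => ht).trans ?_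
  have := Finset.sum_le_card_nsmul (Finset.Ico x y) (fun i => c i t + Nat.dist t t) 1
    fun i _ => by simpa [Nat.dist_self] using hc i t
  simpa [pathCost] using this

/-- After `γ` groups the memory is a table for the sampled cost of these groups. Its entries are at
most the length `γ * g`, as a constant path pays at most 1 per position, and this keeps the
arithmetic exact. A path being free in its last shift, checking all final entries decides `Flagged`.
-/
theorem testBlock_runs {k r x g G : ℕ} (h7 : s.reg 7 = k) (h4 : s.reg 4 = r) (h8 : s.reg 8 = g)
    (h19 : s.reg 19 = x) (h17 : s.reg 17 = G) (hg : 0 < g)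
    (hW : x + 2 * (G * g) + 2 * k + 10 < 2 ^ E.wordSize) :
    Runs E testBlock s ((G + 2) * (200 * (2 * k + 1) + 100)) fun s' =>
      (∀ y < 20, s'.reg y = s.reg y) ∧ s'.drawn = s.drawn + G ∧
        s'.reg 23 = truth (Flagged (mismatch E.charA E.charB k) (2 * k) r (fun i => E.coin i)
          s.drawn x g G) := by
  set c := mismatch E.charA E.charB k with hc
  set S := sampled (fun i => E.coin i) s.drawn x g G with hS
  have hc1 : ∀ i s, restrictCost c S i s ≤ 1 := fun i s =>
    (restrictCost_le c S i s).trans (mismatch_le_one _ _ _ _ _)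
  have hGg : G ≤ G * g := Nat.le_mul_of_pos_right G hg
  refine Runs.mono (T := _) (Runs.seq (Runs.mono (clearTable_runs (E := E) h7 (by omega)) le_rfl ?_)
    (T' := 2 + (G * (4 + (200 * (2 * k + 1) + 90)) + 4 + (60 * (2 * k + 1) + 20)))) ?_ fun _ h => h
  · rintro s₁ ⟨hr₁, hd₁, hm₁⟩
    refine Runs.seq (Runs.assign eval_zero (Runs.seq (Runs.loop (fun γ s' =>
      (∀ y < 20, s'.reg y = s.reg y) ∧ s'.drawn = s.drawn + γ ∧ s'.reg 20 = γ ∧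
      IsTable (restrictCost c S) (2 * k) x (x + γ * g) s'.mem) G
      (T := 200 * (2 * k + 1) + 90) ?_ ?_ ?_)))
    · refine ⟨fun y hy => ?_, hd₁, rfl, ?_⟩
      · simpa [Function.update, show y ≠ 20 by omega] using hr₁ y (by omega)
      · simpa using isTable_zero _ _ _ hm₁
    · rintro γ hγ s₂ ⟨hr, hd, h20, htab⟩
      have hγg : γ * g + g ≤ G * g := by
        rw [← Nat.succ_mul]; exact Nat.mul_le_mul_right g hγ
      constructor
      · rw [eval_lt (a := .reg 20) h20 (b := .reg 17) (y := G) ((hr 17 (by omega)).trans h17)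
          (by omega), if_pos hγ]
        norm_num
      set i := x + γ * g + E.coin (s.drawn + γ) % g with hi
      have hmod : (E.coin (s.drawn + γ) : ℕ) % g < g := Nat.mod_lt _ hg
      refine Runs.mono (T := 1 + (10 + ((60 * (2 * k + 1) + 20) + ((60 * (2 * k + 1) + 20) + 4))))
        (Runs.seq (Runs.rand (Runs.seq (Runs.assign (v := i) ?_ (Runs.seq
        (Runs.mono (upSweep_runs (k := k) (i := i) (B := G * g) ?_ rfl ?_ ?_) le_rfl ?_)))))) ?_
        fun _ h => h
      · rw [hi, ← hd]
        refine eval_add (eval_add (a := .reg 19) ((hr 19 (by omega)).trans h19) (eval_mul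
          (a := .reg 20) h20 (b := .reg 8) ((hr 8 (by omega)).trans h8) (by omega)) (by omega))
          (eval_mod (a := .reg 21) rfl (b := .reg 8) ((hr 8 (by omega)).trans h8) ?_) ?_
        · exact Fin.isLt _
        · rw [← hd] at hmod; omega
      · exact (hr 7 (by omega)).trans h7
      · intro t ht
        have := htab.le_length hc1 ht
        dsimp only; omega
      · omega
      · rintro s₃ ⟨hr₃, hd₃, hm₃⟩
        have e7₃ : s₃.reg 7 = k := (hr₃ 7 (by omega)).trans ((hr 7 (by omega)).trans h7)
        refine Runs.seq (Runs.mono (downSweep_runs (k := k) (B := G * g + 1) e7₃ ?_ (by omega))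
          le_rfl ?_)
        · intro t ht
          rw [hm₃ t ht]
          refine (min_le_right _ _).trans ?_
          have := htab.le_length hc1 ht
          have := mismatch_le_one E.charA E.charB k i t
          dsimp only; omega
        · rintro s₄ ⟨hr₄, hd₄, hm₄⟩
          have e20 : s₄.reg 20 = γ := (hr₄ 20 (by omega)).trans ((hr₃ 20 (by omega)).trans h20)
          refine Runs.assign (eval_add (a := .reg 20) e20 (eval_one (by omega)) (by omega)) ?_
          refine ⟨fun y hy => ?_, ?_, rfl, ?_⟩
          · simp only [Function.update, show y ≠ 20 by omega]
            refine (hr₄ y (by omega)).trans ((hr₃ y (by omega)).trans ?_)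
            simpa [Function.update, show y ≠ 21 by omega] using hr y hy
          · change s₄.drawn = _
            rw [hd₄, hd₃]
            change s₂.drawn + 1 = _
            omega
          · rw [Nat.add_mul, one_mul, ← add_assoc]
            refine htab.step (i := i) (by omega) (by omega) (by omega) ?_ ?_
            -- The sample of any other group `γ'` lies in a disjoint interval, so `i` is the only
            -- sampled position of this group.
            · intro j hj hj' hne t
              rw [restrictCost, if_neg]
              rintro ⟨γ', hγ', rfl⟩
              have hm' : (E.coin (s.drawn + γ') : ℕ) % g < g := Nat.mod_lt _ hg
              dsimp only at hj hj' hne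
              rcases lt_trichotomy γ' γ with h | rfl | h
              · have := Nat.mul_le_mul_right g (Nat.succ_le_of_lt h)
                rw [Nat.succ_mul] at this; omega
              · exact hne rfl
              · have := Nat.mul_le_mul_right g (Nat.succ_le_of_lt h)
                rw [Nat.succ_mul] at this; omega
            · have hiS : i ∈ S := ⟨γ, hγ, rfl⟩
              have hri : restrictCost c S i = c i := by
                funext t; rw [restrictCost, if_pos hiS]
              rw [hri]
              exact relaxed_sweep (mismatch_le_one _ _ _ _) (f₁ := s₃.mem) hm₃ hm₄
      · omega
    · rintro s₂ ⟨hr, hd, h20, htab⟩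
      refine ⟨?_, Runs.mono (checkTable_runs (k := k) (r := r) ((hr 7 (by omega)).trans h7)
        ((hr 4 (by omega)).trans h4) (by omega)) le_rfl ?_⟩
      · rw [eval_lt (a := .reg 20) h20 (b := .reg 17) (y := G) ((hr 17 (by omega)).trans h17)
          (by omega), if_neg (by omega)]
      · rintro s₃ ⟨hr₃, hd₃, h23⟩
        refine ⟨fun y hy => (hr₃ y (by omega)).trans (hr y hy), hd₃.trans hd, ?_⟩
        rw [h23]
        exact truth_congr (htab.forall_le_iff r)
  · ring_nf; omega

end WordRAM

namespace WordRAM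

/-! ### Sampling blocks on all levels -/

/-- Tests random blocks of one level, and sets register `15` to `1` if one of them is flagged. -/
def sampleLevel : Cmd :=
  .seq (.assign 18 0) <|
  .while ((Expr.reg 18).lt (.reg 16 * .reg 12)) <|
    .seq (.rand 19) <|
    .seq (.assign 19 (.reg 19 % (.reg 11 * .reg 16) * (.reg 17 * .reg 8))) <|
    .seq testBlock <|
    .seq (.assign 15 ((0 : Expr).lt (.reg 15 + .reg 23))) <|
    .assign 18 (.reg 18 + 1)

/-- Runs through the levels, from the smallest blocks to the largest. -/
def sampleLevels : Cmd :=
  .seq (.assign 16 (.reg 10)) <| .seq (.assign 17 (.reg 9)) <|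
  .while (.reg 16) <|
    .seq sampleLevel <|
    .seq (.assign 16 (.reg 16 / 2)) <|
    .assign 17 (.reg 17 + .reg 17)

/-- Repeats the search, and sets register `13` to `1` if one of the runs flags no block. -/
def repeatSearch : Cmd :=
  .seq (.assign 13 0) <| .seq (.assign 14 0) <|
  .while ((Expr.reg 14).lt (.reg 5)) <|
    .seq (.assign 15 0) <|
    .seq sampleLevels <|
    .seq (.assign 13 ((0 : Expr).lt (.reg 13 + (Expr.reg 15).beq 0))) <|
    .assign 14 (.reg 14 + 1)

/-- The numerical parameters of the search: flagging threshold, centre of the shifts, group length,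
groups in a block of the lowest level, levels above the lowest one, blocks of the highest level,
sample factor, and repetitions. -/
structure Params where
  r : ℕ
  K : ℕ
  g : ℕ
  G : ℕ
  U : ℕ
  J : ℕ
  L : ℕ
  reps : ℕ

namespace Params

variable (P : Params)

/-- The groups in a block on level `u`. -/
def groups (u : ℕ) : ℕ := P.G * 2 ^ u

/-- The length of a block on level `u`. -/
def len (u : ℕ) : ℕ := P.groups u * P.g

/-- The number of blocks on level `u`. -/
def blocks (u : ℕ) : ℕ := P.J * 2 ^ (P.U - u)

/-- The number of blocks sampled on level `u`. -/
def samples (u : ℕ) : ℕ := 2 ^ (P.U - u) * P.L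

/-- The number of random words drawn on the levels below `u`. -/
def offset (u : ℕ) : ℕ := ∑ v ∈ Finset.range u, P.samples v * (1 + P.groups v)

/-- The words drawn in one run of the search. -/
def period : ℕ := P.offset (P.U + 1)

/-- The block sampled on level `u` with the random words from index `D` on is flagged. -/
def SampleHit (c : ℕ → ℕ → ℕ) (coin : ℕ → ℕ) (u D : ℕ) : Prop :=
  Flagged c (2 * P.K) P.r coin (D + 1) (coin D % P.blocks u * P.len u) P.g (P.groups u)

/-- Some block is flagged in the run of the search that uses the random words from index `D` on. -/
def SearchHit (c : ℕ → ℕ → ℕ) (coin : ℕ → ℕ) (D : ℕ) : Prop :=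
  ∃ u ≤ P.U, ∃ a < P.samples u,
    P.SampleHit c coin u (D + P.offset u + a * (1 + P.groups u))

/-- The registers hold the parameters. -/
structure Loaded (s : State) : Prop where
  reg4 : s.reg 4 = P.r
  reg5 : s.reg 5 = P.reps
  reg7 : s.reg 7 = P.K
  reg8 : s.reg 8 = P.g
  reg9 : s.reg 9 = P.G
  reg10 : s.reg 10 = 2 ^ P.U
  reg11 : s.reg 11 = P.J
  reg12 : s.reg 12 = P.L

/-- The parameters are positive and not too large for words below `W`. -/
structure Fits (W : ℕ) : Prop where
  g_pos : 0 < P.g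
  G_pos : 0 < P.G
  K_pos : 0 < P.K
  J_pos : 0 < P.J
  total : P.J * P.len P.U + 2 * P.len P.U + 2 * P.K + 10 < W
  sample : 2 ^ P.U * P.L + 1 < W
  rep : P.reps + 1 < W

variable {P}

theorem Loaded.congr {s s' : State} (h : P.Loaded s) (hs : ∀ y < 13, s'.reg y = s.reg y) :
    P.Loaded s' where
  reg4 := (hs 4 (by omega)).trans h.reg4
  reg5 := (hs 5 (by omega)).trans h.reg5
  reg7 := (hs 7 (by omega)).trans h.reg7
  reg8 := (hs 8 (by omega)).trans h.reg8
  reg9 := (hs 9 (by omega)).trans h.reg9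
  reg10 := (hs 10 (by omega)).trans h.reg10
  reg11 := (hs 11 (by omega)).trans h.reg11
  reg12 := (hs 12 (by omega)).trans h.reg12

/-- From level to level the blocks double and the number of samples halves, so the total amount of
sampled groups is the same everywhere. -/
theorem two_pow_mul_groups {u : ℕ} (hu : u ≤ P.U) :
    2 ^ (P.U - u) * P.groups u = P.groups P.U := by
  rw [groups, groups, mul_left_comm, ← pow_add, Nat.sub_add_cancel hu]

theorem blocks_mul_len {u : ℕ} (hu : u ≤ P.U) : P.blocks u * P.len u = P.J * P.len P.U := by
  rw [blocks, len, len, mul_assoc, ← mul_assoc _ (P.groups u), two_pow_mul_groups hu]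

theorem len_le {u : ℕ} (hu : u ≤ P.U) : P.len u ≤ P.len P.U := by
  rw [len, len, ← two_pow_mul_groups hu, mul_assoc]
  exact Nat.le_mul_of_pos_left _ (by positivity)

theorem groups_pos {W : ℕ} (h : P.Fits W) (u : ℕ) : 0 < P.groups u :=
  Nat.mul_pos h.G_pos (by positivity)

theorem len_pos {W : ℕ} (h : P.Fits W) (u : ℕ) : 0 < P.len u :=
  Nat.mul_pos (groups_pos h u) h.g_pos

theorem blocks_pos {W : ℕ} (h : P.Fits W) (u : ℕ) : 0 < P.blocks u :=
  Nat.mul_pos h.J_pos (by positivity)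

theorem blocks_le {W u : ℕ} (h : P.Fits W) (hu : u ≤ P.U) :
    P.blocks u ≤ P.J * P.len P.U := by
  rw [← blocks_mul_len hu]; exact Nat.le_mul_of_pos_right _ (len_pos h u)

end Params

/-! ### Execution of the levels and of the repeated search -/

open Params

variable {E : Env} {s : State} {P : Params}

/-- The proposition `q` stands for a flag raised on lower levels; register `15` accumulates a
disjunction across levels. -/
theorem sampleLevel_runs (hP : P.Loaded s) (hF : P.Fits (2 ^ E.wordSize)) {u : ℕ} (hu : u ≤ P.U)
    (h16 : s.reg 16 = 2 ^ (P.U - u)) (h17 : s.reg 17 = P.groups u) {q : Prop}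
    (h15 : s.reg 15 = truth q) :
    Runs E sampleLevel s (P.samples u * ((P.groups u + 2) * (200 * (2 * P.K + 1) + 100) + 40) + 10)
      fun s' => (∀ y < 18, y ≠ 15 → s'.reg y = s.reg y) ∧
        s'.drawn = s.drawn + P.samples u * (1 + P.groups u) ∧
        s'.reg 15 = truth (q ∨ ∃ a < P.samples u, P.SampleHit (mismatch E.charA E.charB P.K)
          (fun i => E.coin i) u (s.drawn + a * (1 + P.groups u))) := by
  have hW := hF.total
  have hbl := blocks_mul_len (P := P) hu
  have hle := len_le (P := P) hu
  have hb := blocks_le hF hu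
  have hs : P.samples u ≤ 2 ^ P.U * P.L :=
    Nat.mul_le_mul_right _ (Nat.pow_le_pow_right (by norm_num) (Nat.sub_le _ _))
  have hsW := hF.sample
  refine Runs.mono (T := _) (Runs.seq (Runs.assign eval_zero (Runs.loop (fun a s' =>
    (∀ y < 18, y ≠ 15 → s'.reg y = s.reg y) ∧ s'.drawn = s.drawn + a * (1 + P.groups u) ∧
    s'.reg 18 = a ∧ s'.reg 15 = truth (q ∨ ∃ a' < a, P.SampleHit (mismatch E.charA E.charB P.K)
          (fun i => E.coin i) u (s.drawn + a' * (1 + P.groups u))))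
    (P.samples u) (T := (P.groups u + 2) * (200 * (2 * P.K + 1) + 100) + 30) ?_ ?_ ?_)))
    ?_ fun _ h => h
  · refine ⟨fun y hy _ => ?_, by simp, rfl, ?_⟩
    · simp [Function.update, show y ≠ 18 by omega]
    · simpa [Function.update] using h15
  · rintro a ha s₁ ⟨hr, hd, h18, h15⟩
    have hP₁ : P.Loaded s₁ := hP.congr fun y hy => hr y (by omega) (by omega)
    have h16₁ := (hr 16 (by omega) (by omega)).trans h16
    have h17₁ := (hr 17 (by omega) (by omega)).trans h17
    constructor
    · rw [eval_lt (a := .reg 18) h18 (eval_mul (a := .reg 16) (b := .reg 12) h16₁ hP₁.reg12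
        (by rw [← samples]; omega)) (by omega), if_pos (by rw [← samples]; exact ha)]
      norm_num
    set x := (E.coin s₁.drawn : ℕ) % P.blocks u * P.len u with hx
    have hxle : x ≤ P.J * P.len P.U := by
      rw [← hbl, hx]
      exact Nat.mul_le_mul_right _ (Nat.mod_lt _ (blocks_pos hF u)).le
    refine Runs.mono (T := 1 + (10 + ((P.groups u + 2) * (200 * (2 * P.K + 1) + 100) + (6 + 4))))
      (Runs.seq (Runs.rand (Runs.seq (Runs.assign (v := x) ?_ (Runs.seq (Runs.mono
      (testBlock_runs (k := P.K) (r := P.r) (x := x) (g := P.g) (G := P.groups u)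
        hP₁.reg7 hP₁.reg4 hP₁.reg8 rfl h17₁ hF.g_pos ?_)
      le_rfl ?_)))))) (by omega) fun _ h => h
    · refine eval_mul (eval_mod (a := .reg 19) rfl (eval_mul (a := .reg 11) (b := .reg 16)
        hP₁.reg11 h16₁ ?_) ?_) (eval_mul (a := .reg 17) (b := .reg 8) h17₁ hP₁.reg8 ?_) ?_
      · rw [← blocks]; omega
      · exact Fin.isLt _
      · rw [← len]; omega
      · change x < _; omega
    · rw [← len]; omega
    · rintro s₂ ⟨hr₂, hd₂, h23⟩
      dsimp only at hd₂ h23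
      refine Runs.seq (Runs.assign (eval_lt eval_zero (eval_add (a := .reg 15) (b := .reg 23)
        ((hr₂ 15 (by omega)).trans h15) h23 ?_) (by omega)) (Runs.assign (eval_add (a := .reg 18)
        (x := a) (y := 1) ?_ (eval_one (by omega)) (by omega)) ?_))
      · exact (Nat.add_le_add (truth_le_one _) (truth_le_one _)).trans_lt (by omega)
      · exact (hr₂ 18 (by omega)).trans h18
      · refine ⟨fun y hy hy' => ?_, ?_, rfl, ?_⟩
        · simp only [Function.update, show y ≠ 18 by omega, hy']
          refine (hr₂ y (by omega)).trans ?_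
          simpa [Function.update, show y ≠ 19 by omega] using hr y hy hy'
        · change s₂.drawn = _
          rw [hd₂, hd]; ring
        · have e : (∃ a' < a + 1, P.SampleHit (mismatch E.charA E.charB P.K)
              (fun i => E.coin i) u (s.drawn + a' * (1 + P.groups u))) ↔
              (∃ a' < a, P.SampleHit (mismatch E.charA E.charB P.K)
              (fun i => E.coin i) u (s.drawn + a' * (1 + P.groups u))) ∨
              Flagged (mismatch E.charA E.charB P.K) (2 * P.K) P.r (fun i => E.coin i)
                (s₁.drawn + 1) x P.g (P.groups u) := by
            constructor
            · rintro ⟨a', ha', h⟩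
              rcases Nat.lt_succ_iff_lt_or_eq.1 ha' with h' | rfl
              · exact .inl ⟨a', h', h⟩
              · rw [← hd] at h; exact .inr h
            · rintro (⟨a', ha', h⟩ | h)
              · exact ⟨a', by omega, h⟩
              · refine ⟨a, by omega, ?_⟩
                rw [← hd]; exact h
          exact (truth_or _ _).trans (truth_congr (by rw [e, or_assoc]))
  · rintro s₁ ⟨hr, hd, h18, h15⟩
    have hP₁ : P.Loaded s₁ := hP.congr fun y hy => hr y (by omega) (by omega)
    have h16₁ := (hr 16 (by omega) (by omega)).trans h16
    refine ⟨?_, hr, hd, h15⟩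
    rw [eval_lt (a := .reg 18) h18 (eval_mul (a := .reg 16) (b := .reg 12) h16₁ hP₁.reg12
        (by rw [← samples]; omega)) (by omega), if_neg (by rw [samples]; omega)]
  · simp only [show (Expr.lt (.reg 18) (.reg 16 * .reg 12)).cost = 5 from rfl,
      show (0 : Expr).cost = 1 from rfl]
    have : P.samples u * (5 + 1 + ((P.groups u + 2) * (200 * (2 * P.K + 1) + 100) + 30)) ≤
      P.samples u * ((P.groups u + 2) * (200 * (2 * P.K + 1) + 100) + 40) :=
      Nat.mul_le_mul_left _ (by omega)
    omega

/-- A bound on the time that the search spends on a level. -/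
def Params.levelTime (P : Params) : ℕ := 3000 * (P.L * P.groups P.U * P.K) + 50

/-- `samples u * groups u` equals `L * groups U` on every level, which makes the bound independent
of `u`; additive constants are absorbed by `groups u * K ≥ 1`. -/
theorem Params.levelTime_spec (hF : P.Fits (2 ^ E.wordSize)) {u : ℕ} (hu : u ≤ P.U) :
    P.samples u * ((P.groups u + 2) * (200 * (2 * P.K + 1) + 100) + 40) + 30 ≤ P.levelTime := by
  have h1 := groups_pos hF u
  have h2 := hF.K_pos
  have h3 : (P.groups u + 2) * (200 * (2 * P.K + 1) + 100) + 40 ≤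
      3000 * (P.groups u * P.K) := by
    have e1 : P.groups u + 2 ≤ 3 * P.groups u := by omega
    have e2 : 200 * (2 * P.K + 1) + 100 ≤ 700 * P.K := by omega
    have e3 := Nat.mul_le_mul e1 e2
    have e4 : 1 ≤ P.groups u * P.K := Nat.mul_pos h1 h2
    nlinarith
  have h4 := Nat.mul_le_mul_left (P.samples u) h3
  have h5 : P.samples u * (3000 * (P.groups u * P.K)) =
      3000 * (P.L * P.groups P.U * P.K) := by
    rw [← two_pow_mul_groups hu, samples]; ring
  rw [h5] at h4
  rw [levelTime]
  linarith

theorem sampleLevels_runs (hP : P.Loaded s) (hF : P.Fits (2 ^ E.wordSize)) (h15 : s.reg 15 = 0) :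
    Runs E sampleLevels s ((P.U + 1) * (P.levelTime + 20) + 20)
      fun s' => (∀ y < 15, s'.reg y = s.reg y) ∧ s'.drawn = s.drawn + P.period ∧
        s'.reg 15 = truth (P.SearchHit (mismatch E.charA E.charB P.K) (fun i => E.coin i) s.drawn) := by
  have hW := hF.total
  have hGU : P.groups P.U ≤ P.len P.U := Nat.le_mul_of_pos_right _ hF.g_pos
  have hgr : ∀ u ≤ P.U, P.groups u ≤ P.groups P.U := fun u hu =>
    Nat.mul_le_mul_left _ (Nat.pow_le_pow_right (by norm_num) hu)
  -- The truncating quotient in the invariant is `2 ^ (U - u)` on all levels and becomes 0 at `u = U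
  -- + 1`, which is what stops the loop.
  refine Runs.mono (T := _) (Runs.seq (Runs.assign (a := .reg 10) hP.reg10 (Runs.seq
    (Runs.assign (a := .reg 9) hP.reg9 (Runs.loop (fun u s' =>
    (∀ y < 15, s'.reg y = s.reg y) ∧ s'.drawn = s.drawn + P.offset u ∧
    s'.reg 16 = 2 ^ P.U / 2 ^ u ∧ s'.reg 17 = P.groups u ∧
    s'.reg 15 = truth (∃ v < u, ∃ a < P.samples v, P.SampleHit (mismatch E.charA E.charB P.K)
      (fun i => E.coin i) v (s.drawn + P.offset v + a * (1 + P.groups v))))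
    (P.U + 1) (T := P.levelTime) ?_ ?_ ?_))))) ?_ fun _ h => h
  · refine ⟨fun y hy => ?_, by simp [offset], by simp [Function.update],
      by simp [Function.update, groups], by simpa [Function.update, truth] using h15⟩
    simp [Function.update, show y ≠ 16 by omega, show y ≠ 17 by omega]
  · rintro u hu s₁ ⟨hr, hd, h16, h17, h15⟩
    have hu' : u ≤ P.U := by omega
    have hP₁ : P.Loaded s₁ := hP.congr fun y hy => hr y (by omega)
    have h16' := h16
    rw [Nat.pow_div hu' (by norm_num)] at h16'
    have hgu := hgr u hu'
    have hpow : 2 ^ (P.U - u) < 2 ^ E.wordSize := by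
      have e := two_pow_mul_groups (P := P) hu'
      have := Nat.le_mul_of_pos_right (2 ^ (P.U - u)) (groups_pos hF u)
      omega
    constructor
    · change s₁.reg 16 ≠ 0
      rw [h16']; positivity
    refine Runs.mono (Runs.seq (Runs.mono (sampleLevel_runs hP₁ hF hu' h16' h17 h15)
      le_rfl ?_) (T' := 4 + 4)) (le_trans (Nat.add_le_add_left (by norm_num : 4 + 4 ≤ 20) _) (by
        have := levelTime_spec hF hu'; linarith)) fun _ h => h
    rintro s₂ ⟨hr₂, hd₂, h15₂⟩
    have h16₂ := (hr₂ 16 (by omega) (by omega)).trans h16'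
    have h17₂ := (hr₂ 17 (by omega) (by omega)).trans h17
    refine Runs.seq (Runs.assign (eval_div (a := .reg 16) h16₂ (eval_two (by omega)) hpow)
      (Runs.assign (eval_add (a := .reg 17) (b := .reg 17) (x := P.groups u) (y := P.groups u)
        h17₂ h17₂ (by omega)) ?_))
    refine ⟨fun y hy => ?_, ?_, ?_, ?_, ?_⟩
    · simp only [Function.update, show y ≠ 16 by omega, show y ≠ 17 by omega]
      exact (hr₂ y (by omega) (by omega)).trans (hr y hy)
    · change s₂.drawn = _
      rw [hd₂, hd, offset, offset, Finset.sum_range_succ, add_assoc]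
    · simp only [Function.update]
      change 2 ^ (P.U - u) / 2 = _
      rw [pow_succ, ← Nat.div_div_eq_div_mul, Nat.pow_div hu' (by norm_num)]
    · simp only [Function.update]
      change P.groups u + P.groups u = _
      rw [groups, groups, pow_succ]; ring
    · refine h15₂.trans (truth_congr ?_)
      rw [hd]
      constructor
      · rintro (⟨v, hv, h⟩ | h)
        · exact ⟨v, by omega, h⟩
        · exact ⟨u, by omega, h⟩
      · rintro ⟨v, hv, h⟩
        rcases Nat.lt_succ_iff_lt_or_eq.1 hv with h' | rfl
        · exact .inl ⟨v, h', h⟩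
        · exact .inr h
  · rintro s₁ ⟨hr, hd, h16, h17, h15⟩
    refine ⟨?_, hr, hd, h15.trans (truth_congr ?_)⟩
    · change s₁.reg 16 = 0
      rw [h16]
      exact Nat.div_eq_of_lt (Nat.pow_lt_pow_right (by norm_num) (by omega))
    · simp only [SearchHit, Nat.lt_succ_iff]
  · simp only [show ∀ x, (Expr.reg x).cost = 1 from fun _ => rfl]
    have : (P.U + 1) * (1 + 1 + P.levelTime) ≤ (P.U + 1) * (P.levelTime + 20) :=
      Nat.mul_le_mul_left _ (by omega)
    omega

/-- A bound on the time of the whole search. -/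
def Params.searchTime (P : Params) : ℕ :=
  P.reps * ((P.U + 1) * (P.levelTime + 20) + 60) + 20

theorem repeatSearch_runs (hP : P.Loaded s) (hF : P.Fits (2 ^ E.wordSize)) (hd0 : s.drawn = 0) :
    Runs E repeatSearch s P.searchTime fun s' =>
        s'.reg 13 = truth (∃ i < P.reps, ¬ P.SearchHit (mismatch E.charA E.charB P.K)
          (fun i => E.coin i) (i * P.period)) := by
  have hW := hF.total
  have hW' := hF.rep
  refine Runs.mono (T := _) (Runs.seq (Runs.assign eval_zero (Runs.seq (Runs.assign eval_zero
    (Runs.loop (fun j s' => (∀ y < 13, s'.reg y = s.reg y) ∧ s'.drawn = j * P.period ∧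
    s'.reg 14 = j ∧ s'.reg 13 = truth (∃ i < j, ¬ P.SearchHit (mismatch E.charA E.charB P.K)
          (fun i => E.coin i) (i * P.period)))
    P.reps (T := (P.U + 1) * (P.levelTime + 20) + 50) ?_ ?_ ?_))))) ?_ fun _ h => h
  · refine ⟨fun y hy => ?_, by simpa using hd0, rfl, by simp [Function.update, truth]⟩
    simp [Function.update, show y ≠ 13 by omega, show y ≠ 14 by omega]
  · rintro j hj s₁ ⟨hr, hd, h14, h13⟩
    have hP₁ : P.Loaded s₁ := hP.congr hr
    constructor
    · rw [eval_lt (a := .reg 14) (b := .reg 5) h14 hP₁.reg5 (by omega), if_pos hj]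
      norm_num
    refine Runs.mono (T := 2 + (((P.U + 1) * (P.levelTime + 20) + 20) + (8 + 4)))
      (Runs.seq (Runs.assign eval_zero (Runs.seq (Runs.mono
      (sampleLevels_runs (hP₁.congr fun y hy => ?_) hF rfl) le_rfl ?_)))) (by omega) fun _ h => h
    · simp [Function.update, show y ≠ 15 by omega]
    rintro s₂ ⟨hr₂, hd₂, h15⟩
    dsimp only at hd₂ h15
    have h13₂ : s₂.reg 13 = s₁.reg 13 := hr₂ 13 (by omega)
    rw [h13] at h13₂
    refine Runs.seq (Runs.assign (eval_lt eval_zero (eval_add (a := .reg 13) h13₂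
      (eval_beq (a := .reg 15) h15 eval_zero (by omega)) ?_) (by omega)) (Runs.assign
      (eval_add (a := .reg 14) (x := j) (y := 1) ?_ (eval_one (by omega)) (by omega)) ?_))
    · rw [truth_not]
      exact (Nat.add_le_add (truth_le_one _) (truth_le_one _)).trans_lt (by omega)
    · exact (hr₂ 14 (by omega)).trans h14
    · refine ⟨fun y hy => ?_, ?_, rfl, ?_⟩
      · simp only [Function.update, show y ≠ 13 by omega, show y ≠ 14 by omega]
        refine (hr₂ y (by omega)).trans ?_
        simpa [Function.update, show y ≠ 15 by omega] using hr y hy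
      · change s₂.drawn = _
        rw [hd₂, hd]; ring
      · have e : (∃ i < j + 1, ¬ P.SearchHit (mismatch E.charA E.charB P.K)
            (fun i => E.coin i) (i * P.period)) ↔ (∃ i < j, ¬ P.SearchHit
            (mismatch E.charA E.charB P.K) (fun i => E.coin i) (i * P.period)) ∨
            ¬ P.SearchHit (mismatch E.charA E.charB P.K) (fun i => E.coin i) s₁.drawn := by
          rw [hd]
          constructor
          · rintro ⟨i, hi, h⟩
            rcases Nat.lt_succ_iff_lt_or_eq.1 hi with h' | rfl
            · exact .inl ⟨i, h', h⟩
            · exact .inr h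
          · rintro (⟨i, hi, h⟩ | h)
            · exact ⟨i, by omega, h⟩
            · exact ⟨j, by omega, h⟩
        rw [truth_not]
        exact (truth_or _ _).trans (truth_congr e.symm)
  · rintro s₁ ⟨hr, hd, h14, h13⟩
    have hP₁ : P.Loaded s₁ := hP.congr hr
    refine ⟨?_, h13⟩
    rw [eval_lt (a := .reg 14) (b := .reg 5) h14 hP₁.reg5 (by omega), if_neg (by omega)]
  · simp only [show (Expr.lt (.reg 14) (.reg 5)).cost = 3 from rfl,
      show (0 : Expr).cost = 1 from rfl, searchTime]
    have : P.reps * (3 + 1 + ((P.U + 1) * (P.levelTime + 20) + 50)) ≤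
      P.reps * ((P.U + 1) * (P.levelTime + 20) + 60) := Nat.mul_le_mul_left _ (by omega)
    omega

end WordRAM

namespace WordRAM

/-! ### The complete program -/

/-- Register `4` becomes the integer square root of register `2`. -/
def computeSqrt : Cmd :=
  .seq (.assign 4 0) <|
  .while (((Expr.reg 4 + 1) * (.reg 4 + 1)).lt (.reg 2 + 1)) <| .assign 4 (.reg 4 + 1)

/-- Register `5` becomes the bit length of register `0`. -/
def computeSize : Cmd :=
  .seq (.assign 5 0) <| .seq (.assign 6 1) <|
  .while ((Expr.reg 6).lt (.reg 0 + 1)) <|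
    .seq (.assign 6 (.reg 6 + .reg 6)) <| .assign 5 (.reg 5 + 1)

/-- Computes the parameters of the search, except for the number of levels. -/
def setup : Cmd :=
  .seq computeSqrt <| .seq computeSize <|
  .seq (.assign 7 (.reg 4 * .reg 4)) <|
  .seq (.assign 8 (.reg 4 / (.const 128 * .reg 5) + 1)) <|
  .seq (.assign 9 (.reg 7 / .reg 8 + 1)) <|
  .assign 12 (.const 128 * (.reg 5 * .reg 5))

/-- Computes the number of levels and of blocks on the highest level. -/
def setupLevels : Cmd :=
  .seq (.assign 10 1) <| .seq
  (.while ((Expr.reg 9 * .reg 10 * .reg 8 * .reg 3).lt (.reg 0)) <|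
    .assign 10 (.reg 10 + .reg 10)) <|
  .assign 11 (.reg 0 / (.reg 9 * .reg 10 * .reg 8) + 1)

/-- The program for gap edit distance. -/
def gapProgram : Cmd :=
  .seq setup <|
  .ite (((Expr.reg 7 + .reg 7) * .reg 3).lt (.reg 0))
    (.seq setupLevels <| .seq repeatSearch <| .assign 0 (.reg 13))
    (.assign 0 1)

/-- The parameters that the program computes. -/
noncomputable def gapParams (n k l : ℕ) : Params :=
  let r := k.sqrt
  let lam := n.size
  let K := r * r
  -- A stretch with `r` mismatches is missed with probability at most `exp (-r / (2 * g))`, which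
  -- this choice makes at most `2 ^ (-32 * lam)` unless `g = 1`, when every position is sampled.
  let g := r / (128 * lam) + 1
  let G := K / g + 1
  -- The top level is the first whose blocks have length at least `n / l`, so that there are about
  -- `l` of them.
  let U := sInf {u | n ≤ G * 2 ^ u * g * l}
  { r := r, K := K, g := g, G := G, U := U, J := n / (G * 2 ^ U * g) + 1
    L := 128 * (lam * lam), reps := lam }

/-! ### Sizes of the computed parameters -/

section arith

variable {n k l : ℕ}

theorem gapParams_r_pos (hk : 1 ≤ k) : 1 ≤ (gapParams n k l).r := Nat.sqrt_pos.2 hk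

theorem gapParams_r_le_K : (gapParams n k l).r ≤ (gapParams n k l).K := Nat.le_mul_self _

theorem gapParams_K_le : (gapParams n k l).K ≤ k := Nat.sqrt_le k

theorem gapParams_K_pos (hk : 1 ≤ k) : 1 ≤ (gapParams n k l).K :=
  (gapParams_r_pos (n := n) (l := l) hk).trans gapParams_r_le_K

theorem gapParams_g_le (hk : 1 ≤ k) (hn : 1 ≤ n) : (gapParams n k l).g ≤ (gapParams n k l).r := by
  have h1 : 1 ≤ (gapParams n k l).r := gapParams_r_pos hk
  change (gapParams n k l).r / (128 * n.size) + 1 ≤ _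
  have h2 : 0 < n.size := Nat.size_pos.2 hn
  have h3 := Nat.div_le_div_left (a := (gapParams n k l).r) (show 2 ≤ 128 * n.size by omega)
    (by norm_num)
  rcases h1.eq_or_lt with h | h
  · rw [← h, Nat.div_eq_of_lt (by omega)]
  · omega

/-- Rounding up to whole groups adds at most `g ≤ r ≤ K`. A lowest block is thus no longer than the
largest jump `2 * K`, as the bottom of the hierarchy requires. -/
theorem gapParams_len_zero (hk : 1 ≤ k) (hn : 1 ≤ n) :
    (gapParams n k l).len 0 ≤ 2 * (gapParams n k l).K := by
  have h1 := gapParams_g_le (l := l) hk hn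
  have h2 := gapParams_r_le_K (n := n) (k := k) (l := l)
  have h3 := Nat.div_mul_le_self (gapParams n k l).K (gapParams n k l).g
  have h4 : (gapParams n k l).len 0 =
      ((gapParams n k l).K / (gapParams n k l).g + 1) * (gapParams n k l).g := by
    change ((gapParams n k l).K / (gapParams n k l).g + 1) * 2 ^ 0 * (gapParams n k l).g = _
    rw [pow_zero, mul_one]
  rw [h4, Nat.add_mul, one_mul]
  omega

theorem gapParams_len_zero_pos : 1 ≤ (gapParams n k l).len 0 :=
  Nat.mul_pos (Nat.mul_pos (Nat.succ_pos _) (by positivity)) (Nat.succ_pos _)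

theorem Params.len_eq (P : Params) (u : ℕ) : P.len u = P.len 0 * 2 ^ u := by
  simp only [len, groups]; ring

theorem gapParams_le_len (hl : 1 ≤ l) :
    n ≤ (gapParams n k l).len (gapParams n k l).U * l := by
  refine Nat.sInf_mem (s := {u | n ≤ (gapParams n k l).len u * l}) ⟨n, ?_⟩
  change n ≤ (gapParams n k l).len n * l
  rw [Params.len_eq]
  have h1 := gapParams_len_zero_pos (n := n) (k := k) (l := l)
  calc n ≤ 2 ^ n := Nat.lt_two_pow_self.le
    _ ≤ (gapParams n k l).len 0 * 2 ^ n := Nat.le_mul_of_pos_left _ h1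
    _ ≤ _ := Nat.le_mul_of_pos_right _ hl

theorem gapParams_len_lt {u : ℕ} (hu : u < (gapParams n k l).U) :
    (gapParams n k l).len u * l < n :=
  not_le.1 (Nat.notMem_of_lt_sInf (s := {u | n ≤ (gapParams n k l).len u * l}) hu)

/-- By minimality of `U`, blocks of half the length are too short; if `U = 0`, the hypothesis of the
search branch bounds the lowest blocks instead. -/
theorem gapParams_len_top_lt (hk : 1 ≤ k) (hkn : k ≤ n)
    (h : 2 * (gapParams n k l).K * l < n) :
    (gapParams n k l).len (gapParams n k l).U * l < 2 * n := by
  have h0 := gapParams_len_zero (n := n) (l := l) hk (hk.trans hkn)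
  have h1 := Nat.mul_le_mul_right l h0
  rcases Nat.eq_zero_or_pos (gapParams n k l).U with hU | hU
  · rw [hU]; omega
  · have h2 := gapParams_len_lt (n := n) (k := k) (l := l) (u := (gapParams n k l).U - 1)
      (by omega)
    have h3 : (gapParams n k l).len (gapParams n k l).U * l =
        2 * ((gapParams n k l).len ((gapParams n k l).U - 1) * l) := by
      rw [Params.len_eq, Params.len_eq _ ((gapParams n k l).U - 1)]
      obtain ⟨v, hv⟩ : ∃ v, (gapParams n k l).U = v + 1 := ⟨_, (Nat.sub_add_cancel hU).symm⟩
      rw [hv, Nat.add_sub_cancel]; ring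
    omega

theorem gapParams_U_le (hk : 1 ≤ k) (hkn : k ≤ n) (hl : 1 ≤ l)
    (h : 2 * (gapParams n k l).K * l < n) : (gapParams n k l).U ≤ n.size := by
  have h1 := gapParams_len_top_lt hk hkn h
  have h2 := gapParams_len_zero_pos (n := n) (k := k) (l := l)
  rw [Params.len_eq] at h1
  have h3 : 2 ^ (gapParams n k l).U ≤
      (gapParams n k l).len 0 * 2 ^ (gapParams n k l).U * l :=
    (Nat.le_mul_of_pos_left _ h2).trans (Nat.le_mul_of_pos_right _ hl)
  have h4 : 2 ^ (gapParams n k l).U < 2 ^ (n.size + 1) := by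
    have := Nat.lt_size_self n
    rw [pow_succ]; omega
  have := (Nat.pow_lt_pow_iff_right (by norm_num : 1 < 2)).1 h4
  omega

theorem gapParams_le_blocks :
    n ≤ (gapParams n k l).J * (gapParams n k l).len (gapParams n k l).U := by
  have h := Nat.div_add_mod n ((gapParams n k l).len (gapParams n k l).U)
  have hp : 0 < (gapParams n k l).len (gapParams n k l).U := by
    rw [Params.len_eq]; exact Nat.mul_pos gapParams_len_zero_pos (by positivity)
  have h' := Nat.mod_lt n hp
  change n ≤ (n / (gapParams n k l).len (gapParams n k l).U + 1) * _
  rw [Nat.add_mul, one_mul, mul_comm]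
  omega

theorem gapParams_blocks_le : (gapParams n k l).J * (gapParams n k l).len (gapParams n k l).U ≤
    n + (gapParams n k l).len (gapParams n k l).U := by
  change (n / (gapParams n k l).len (gapParams n k l).U + 1) * _ ≤ _
  rw [Nat.add_mul, one_mul]
  exact Nat.add_le_add_right (Nat.div_mul_le_self _ _) _

theorem gapParams_J_le (hl : 1 ≤ l) : (gapParams n k l).J ≤ l + 1 := by
  have hp : 0 < (gapParams n k l).len (gapParams n k l).U := by
    rw [Params.len_eq]; exact Nat.mul_pos gapParams_len_zero_pos (by positivity)
  exact Nat.succ_le_succ (Nat.div_le_of_le_mul (gapParams_le_len hl))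

theorem two_pow_U_le : 2 ^ (gapParams n k l).U ≤ (gapParams n k l).len (gapParams n k l).U := by
  rw [Params.len_eq]; exact Nat.le_mul_of_pos_left _ gapParams_len_zero_pos

theorem size_le_two_pow (n : ℕ) : n.size ≤ 2 ^ n.size := Nat.lt_two_pow_self.le

theorem poly_lt {L W : ℕ} (hL : 2 ≤ L) (hW : L ^ 16 ≤ W) : 1000 * L ^ 3 < W := by
  have h1 : 2 ^ 10 * L ^ 3 ≤ L ^ 10 * L ^ 3 := Nat.mul_le_mul_right _ (Nat.pow_le_pow_left hL 10)
  have h2 : L ^ 10 * L ^ 3 ≤ L ^ 16 := by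
    rw [← pow_add]; exact Nat.pow_le_pow_right (by omega) (by norm_num)
  have h3 : 0 < L ^ 3 := by positivity
  omega

/-- With `Λ = 2 ^ n.size`, all quantities are at most cubic in `Λ` up to a constant, whereas words
reach `Λ ^ 16`. -/
theorem gapParams_fits {W : ℕ} (hk : 1 ≤ k) (hkn : k ≤ n) (hl : 1 ≤ l)
    (h : 2 * (gapParams n k l).K * l < n) (hW : (2 ^ n.size) ^ 16 ≤ W) :
    (gapParams n k l).Fits W where
  g_pos := Nat.succ_pos _
  G_pos := Nat.succ_pos _
  K_pos := gapParams_K_pos hk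
  J_pos := Nat.succ_pos _
  total := by
    have h1 := gapParams_len_top_lt hk hkn h
    have h2 := gapParams_blocks_le (n := n) (k := k) (l := l)
    have h3 : (gapParams n k l).len (gapParams n k l).U ≤
      (gapParams n k l).len (gapParams n k l).U * l := Nat.le_mul_of_pos_right _ hl
    have h4 := gapParams_K_le (n := n) (k := k) (l := l)
    have h5 := Nat.lt_size_self n
    have h6 := poly_lt (L := 2 ^ n.size) (by omega) hW
    have h7 : 2 ^ n.size ≤ (2 ^ n.size) ^ 3 := Nat.le_self_pow (by norm_num) _
    omega
  sample := by
    have h1 := gapParams_len_top_lt hk hkn h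
    have h3 : (gapParams n k l).len (gapParams n k l).U ≤
      (gapParams n k l).len (gapParams n k l).U * l := Nat.le_mul_of_pos_right _ hl
    have h5 := Nat.lt_size_self n
    have h6 := poly_lt (L := 2 ^ n.size) (by omega) hW
    have h8 := two_pow_U_le (n := n) (k := k) (l := l)
    have h9 := size_le_two_pow n
    set L := 2 ^ n.size
    change 2 ^ (gapParams n k l).U * (128 * (n.size * n.size)) + 1 < W
    have h10 : 2 ^ (gapParams n k l).U * (128 * (n.size * n.size)) ≤ (2 * L) * (128 * (L * L)) :=
      Nat.mul_le_mul (by omega) (Nat.mul_le_mul_left _ (Nat.mul_le_mul h9 h9))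
    have h11 : (2 * L) * (128 * (L * L)) = 256 * L ^ 3 := by ring
    have : 0 < L ^ 3 := pow_pos (by omega) _
    omega
  rep := by
    have h5 := Nat.lt_size_self n
    have h6 := poly_lt (L := 2 ^ n.size) (by omega) hW
    have h7 : 2 ^ n.size ≤ (2 ^ n.size) ^ 3 := Nat.le_self_pow (by norm_num) _
    have h9 := size_le_two_pow n
    change n.size + 1 < W
    omega

end arith

/-! ### Execution of the setup and of the whole program -/

theorem eval_lit {E : Env} {s : State} {v : ℕ} (h : v < 2 ^ E.wordSize) :
    Expr.eval E s (.const v) = v := Nat.mod_eq_of_lt h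

variable {E : Env} {s : State}

/-- A linear search suffices: `√k` steps fit the budget `n√k/l` because `l ≤ n`. -/
theorem computeSqrt_runs {k : ℕ} (h2 : s.reg 2 = k) (hW : (k + 1) * (k + 1) + 1 < 2 ^ E.wordSize) :
    Runs E computeSqrt s (20 * k.sqrt + 20) fun s' => (∀ y, y ≠ 4 → s'.reg y = s.reg y) ∧
      s'.drawn = s.drawn ∧ s'.reg 4 = k.sqrt := by
  have hs := Nat.sqrt_le_self k
  have hk1 : k + 1 ≤ (k + 1) * (k + 1) := Nat.le_mul_self _
  have hsq : ∀ j ≤ k.sqrt, (j + 1) * (j + 1) ≤ (k + 1) * (k + 1) := fun j hj =>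
    Nat.mul_le_mul (by omega) (by omega)
  have hcond : ∀ s' : State, ∀ j ≤ k.sqrt, s'.reg 2 = k → s'.reg 4 = j →
      Expr.eval E s' (((Expr.reg 4 + 1) * (.reg 4 + 1)).lt (.reg 2 + 1)) =
      if (j + 1) * (j + 1) < k + 1 then 1 else 0 := by
    intro s' j hj e2 e4
    have := hsq j hj
    have e : Expr.eval E s' (Expr.reg 4 + 1) = j + 1 :=
      eval_add (a := .reg 4) e4 (eval_one (by omega)) (by omega)
    exact eval_lt (eval_mul e e (by omega)) (eval_add (a := .reg 2) e2 (eval_one (by omega))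
      (by omega)) (by omega)
  refine Runs.mono (T := _) (Runs.seq (Runs.assign eval_zero (Runs.loop (fun j s' =>
    (∀ y, y ≠ 4 → s'.reg y = s.reg y) ∧ s'.drawn = s.drawn ∧ s'.reg 4 = j) k.sqrt (T := 4)
    ?_ ?_ ?_))) ?_ fun _ h => h
  · exact ⟨fun y hy => by simp [Function.update, hy], rfl, rfl⟩
  · rintro j hj s₁ ⟨hr, hd, h4⟩
    constructor
    · rw [hcond s₁ j hj.le ((hr 2 (by omega)).trans h2) h4,
        if_pos (Nat.lt_succ_of_le (Nat.le_sqrt.1 hj))]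
      norm_num
    · refine Runs.assign (eval_add (a := .reg 4) h4 (eval_one (by omega)) (by omega)) ?_
      exact ⟨fun y hy => by simpa [Function.update, hy] using hr y hy, hd, rfl⟩
  · rintro s₁ ⟨hr, hd, h4⟩
    refine ⟨?_, hr, hd, h4⟩
    rw [hcond s₁ _ le_rfl ((hr 2 (by omega)).trans h2) h4,
        if_neg (not_lt.2 (Nat.succ_le_of_lt (Nat.lt_succ_sqrt k)))]
  · simp only [show (((Expr.reg 4 + 1) * (.reg 4 + 1)).lt (.reg 2 + 1)).cost = 11 from rfl,
      show (0 : Expr).cost = 1 from rfl]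
    omega

theorem computeSize_runs {n : ℕ} (h0 : s.reg 0 = n) (hW : 2 * n + 4 < 2 ^ E.wordSize) :
    Runs E computeSize s (20 * n.size + 20) fun s' =>
      (∀ y, y ≠ 5 → y ≠ 6 → s'.reg y = s.reg y) ∧
      s'.drawn = s.drawn ∧ s'.reg 5 = n.size := by
  refine Runs.mono (T := _) (Runs.seq (Runs.assign eval_zero (Runs.seq (Runs.assign
    (eval_one (by omega)) (Runs.loop (fun j s' =>
    (∀ y, y ≠ 5 → y ≠ 6 → s'.reg y = s.reg y) ∧ s'.drawn = s.drawn ∧ s'.reg 5 = j ∧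
      s'.reg 6 = 2 ^ j) n.size (T := 8)
    ?_ ?_ ?_))))) ?_ fun _ h => h
  · exact ⟨fun y hy hy' => by simp [Function.update, hy, hy'], rfl, rfl, rfl⟩
  · rintro j hj s₁ ⟨hr, hd, h5, h6⟩
    have hjn := Nat.lt_size.1 hj
    have hjj : j < 2 ^ j := Nat.lt_two_pow_self
    constructor
    · rw [eval_lt (a := .reg 6) h6 (eval_add (a := .reg 0) ((hr 0 (by omega) (by omega)).trans h0)
        (eval_one (by omega)) (by omega)) (by omega), if_pos (by omega)]
      norm_num
    · refine Runs.seq (Runs.assign (eval_add (a := .reg 6) (b := .reg 6) h6 h6 (by omega))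
        (Runs.assign (eval_add (a := .reg 5) (x := j) (y := 1) ?_ (eval_one (by omega))
        (by omega)) ?_))
      · exact h5
      refine ⟨fun y hy hy' => by simpa [Function.update, hy, hy'] using hr y hy hy', hd, rfl, ?_⟩
      simp only [Function.update]
      change 2 ^ j + 2 ^ j = _
      rw [pow_succ]; omega
  · rintro s₁ ⟨hr, hd, h5, h6⟩
    refine ⟨?_, hr, hd, h5⟩
    have := Nat.lt_size_self n
    rw [eval_lt (a := .reg 6) h6 (eval_add (a := .reg 0) ((hr 0 (by omega) (by omega)).trans h0)
        (eval_one (by omega)) (by omega)) (by omega), if_neg (by omega)]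
  · simp only [show (Expr.lt (.reg 6) (.reg 0 + 1)).cost = 5 from rfl,
      show (0 : Expr).cost = 1 from rfl, show (1 : Expr).cost = 1 from rfl]
    omega

/-- The part of the parameters that `setup` computes, together with the inputs. -/
structure PreLoaded (n k l : ℕ) (s : State) : Prop where
  reg0 : s.reg 0 = n
  reg3 : s.reg 3 = l
  reg4 : s.reg 4 = (gapParams n k l).r
  reg5 : s.reg 5 = (gapParams n k l).reps
  reg7 : s.reg 7 = (gapParams n k l).K
  reg8 : s.reg 8 = (gapParams n k l).g
  reg9 : s.reg 9 = (gapParams n k l).G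
  reg12 : s.reg 12 = (gapParams n k l).L
  drawn : s.drawn = 0

theorem setup_runs {n σ k l : ℕ} (hk : 1 ≤ k) (hkn : k ≤ n)
    (hW : (2 ^ n.size) ^ 16 ≤ 2 ^ E.wordSize) :
    Runs E setup (gapInit n σ k l) (20 * k.sqrt + 20 * n.size + 80) (PreLoaded n k l) := by
  have hn := Nat.lt_size_self n
  have hL : 2 ≤ 2 ^ n.size := by omega
  have hp := poly_lt hL hW
  have hsz := size_le_two_pow n
  set L := 2 ^ n.size with hLdef
  have h1 : L ≤ L ^ 3 := Nat.le_self_pow (by norm_num) _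
  have h2 : L * L ≤ L ^ 3 := by rw [← sq]; exact Nat.pow_le_pow_right (by omega) (by norm_num)
  have hkk : (k + 1) * (k + 1) ≤ L * L := Nat.mul_le_mul (by omega) (by omega)
  have hr := Nat.sqrt_le_self k
  have hrr := Nat.sqrt_le k
  have hlam : n.size * n.size ≤ L * L := Nat.mul_le_mul hsz hsz
  have hdiv := Nat.div_le_self k.sqrt (128 * n.size)
  have hdiv' := Nat.div_le_self (k.sqrt * k.sqrt) (k.sqrt / (128 * n.size) + 1)
  refine Runs.mono (T := (20 * k.sqrt + 20) + ((20 * n.size + 20) + (4 + (8 + (6 + 6)))))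
    (Runs.seq (Runs.mono (computeSqrt_runs (E := E) (s := gapInit n σ k l) (k := k) rfl (by omega)) le_rfl ?_))
    (by omega) fun _ h => h
  rintro s₁ ⟨hr₁, hd₁, h4₁⟩
  refine Runs.seq (Runs.mono (computeSize_runs (n := n) (hr₁ 0 (by omega)) (by omega)) le_rfl ?_)
  rintro s₂ ⟨hr₂, hd₂, h5₂⟩
  have h4₂ : s₂.reg 4 = k.sqrt := (hr₂ 4 (by omega) (by omega)).trans h4₁
  refine Runs.seq (Runs.assign (eval_mul (a := .reg 4) (b := .reg 4) h4₂ h4₂ (by omega)) ?_)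
  refine Runs.seq (Runs.assign (eval_add (eval_div (a := .reg 4) (x := k.sqrt) h4₂ (eval_mul
    (eval_lit (by omega)) (b := .reg 5) (y := n.size) h5₂ (by omega)) (by omega))
    (eval_one (by omega)) (by omega)) ?_)
  refine Runs.seq (Runs.assign (eval_add (eval_div (a := .reg 7) (b := .reg 8) rfl rfl ?_)
    (eval_one (by omega)) ?_) ?_)
  · change k.sqrt * k.sqrt < _; omega
  · change (k.sqrt * k.sqrt) / (k.sqrt / (128 * n.size) + 1) + 1 < _; omega
  refine Runs.assign (eval_mul (eval_lit (by omega)) (eval_mul (a := .reg 5) (b := .reg 5)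
    (x := n.size) (y := n.size) h5₂ h5₂ (by omega)) (by omega)) ?_
  exact ⟨(hr₂ 0 (by omega) (by omega)).trans (hr₁ 0 (by omega)),
    (hr₂ 3 (by omega) (by omega)).trans (hr₁ 3 (by omega)), h4₂, h5₂, rfl, rfl, rfl, rfl,
    hd₂.trans hd₁⟩

theorem setupLevels_runs {n k l : ℕ} (hk : 1 ≤ k) (hkn : k ≤ n) (hl : 1 ≤ l)
    (h : 2 * (gapParams n k l).K * l < n) (hW : (2 ^ n.size) ^ 16 ≤ 2 ^ E.wordSize)
    (hs : PreLoaded n k l s) :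
    Runs E setupLevels s (20 * n.size + 50) fun s' => (gapParams n k l).Loaded s' ∧
      s'.drawn = 0 := by
  have hn := Nat.lt_size_self n
  have hp := poly_lt (L := 2 ^ n.size) (by omega) hW
  have hp1 : 2 ^ n.size ≤ (2 ^ n.size) ^ 3 := Nat.le_self_pow (by norm_num) _
  have hU := gapParams_U_le hk hkn hl h
  have htop := gapParams_len_top_lt hk hkn h
  have hn2 : 2 * n < 2 ^ E.wordSize := by omega
  have hev : ∀ s' : State, ∀ u ≤ (gapParams n k l).U, s'.reg 9 = (gapParams n k l).G →
      s'.reg 10 = 2 ^ u → s'.reg 8 = (gapParams n k l).g →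
      Expr.eval E s' (.reg 9 * .reg 10 * .reg 8) = (gapParams n k l).len u ∧
      (gapParams n k l).len u * l < 2 ^ E.wordSize ∧ 2 ^ u < 2 ^ E.wordSize ∧
      (gapParams n k l).len u < 2 ^ E.wordSize := by
    intro s' u hu e9 e10 e8
    have h1 : (gapParams n k l).len u ≤ (gapParams n k l).len (gapParams n k l).U :=
      Params.len_le hu
    have h2 := Nat.mul_le_mul_right l h1
    have h3 : (gapParams n k l).len u ≤ (gapParams n k l).len u * l := Nat.le_mul_of_pos_right _ hl
    have h4 : (gapParams n k l).groups u ≤ (gapParams n k l).len u :=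
      Nat.le_mul_of_pos_right _ (Nat.succ_pos _)
    have h5 : 2 ^ u ≤ (gapParams n k l).groups u := Nat.le_mul_of_pos_left _ (Nat.succ_pos _)
    exact ⟨eval_mul (eval_mul (a := .reg 9) (b := .reg 10) e9 e10 (h4.trans_lt (by omega)))
      (b := .reg 8) e8 (show (gapParams n k l).len u < _ by omega), by omega, by omega, by omega⟩
  refine Runs.mono (T := 2 + (((gapParams n k l).U * (9 + 1 + 4) + (9 + 1)) + 10))
    (Runs.seq (Runs.assign (eval_one (by omega)) (Runs.seq (Runs.loop (T := 4) (fun u s' =>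
    (∀ y, y ≠ 10 → s'.reg y = s.reg y) ∧ s'.drawn = s.drawn ∧ s'.reg 10 = 2 ^ u)
    (gapParams n k l).U ?_ ?_ ?_)))) (by omega) fun _ h => h
  · exact ⟨fun y hy => by simp [Function.update, hy], rfl, rfl⟩
  · rintro u hu s₁ ⟨hr, hd, h10⟩
    obtain ⟨e1, e2, -, e4⟩ := hev s₁ u hu.le ((hr 9 (by omega)).trans hs.reg9) h10
      ((hr 8 (by omega)).trans hs.reg8)
    constructor
    · rw [eval_lt (eval_mul e1 (b := .reg 3) ((hr 3 (by omega)).trans hs.reg3) e2)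
        (b := .reg 0) ((hr 0 (by omega)).trans hs.reg0) (by omega), if_pos (gapParams_len_lt hu)]
      norm_num
    · have h3 : 2 ^ u + 2 ^ u ≤ 2 ^ (gapParams n k l).U := by
        rw [← two_mul, ← pow_succ']; exact Nat.pow_le_pow_right (by norm_num) hu
      have h4 := two_pow_U_le (n := n) (k := k) (l := l)
      have h5 : (gapParams n k l).len (gapParams n k l).U ≤
        (gapParams n k l).len (gapParams n k l).U * l := Nat.le_mul_of_pos_right _ hl
      refine Runs.assign (eval_add (a := .reg 10) (b := .reg 10) h10 h10 (by omega)) ?_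
      refine ⟨fun y hy => by simpa [Function.update, hy] using hr y hy, hd, ?_⟩
      change 2 ^ u + 2 ^ u = _
      rw [pow_succ]; omega
  · rintro s₁ ⟨hr, hd, h10⟩
    obtain ⟨e1, e2, -, e4⟩ := hev s₁ _ le_rfl ((hr 9 (by omega)).trans hs.reg9) h10
      ((hr 8 (by omega)).trans hs.reg8)
    have h0 := (hr 0 (by omega)).trans hs.reg0
    constructor
    · rw [eval_lt (eval_mul e1 (b := .reg 3) ((hr 3 (by omega)).trans hs.reg3) e2)
        (b := .reg 0) h0 (by omega), if_neg (not_lt.2 (gapParams_le_len hl))]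
    · have hdiv := Nat.div_le_self n ((gapParams n k l).len (gapParams n k l).U)
      refine Runs.assign (eval_add (eval_div (a := .reg 0) h0 e1
        (by omega)) (eval_one (by omega)) (by omega)) ?_
      refine ⟨⟨?_, ?_, ?_, ?_, ?_, ?_, rfl, ?_⟩, hd.trans hs.drawn⟩
      · exact (hr 4 (by omega)).trans hs.reg4
      · exact (hr 5 (by omega)).trans hs.reg5
      · exact (hr 7 (by omega)).trans hs.reg7
      · exact (hr 8 (by omega)).trans hs.reg8
      · exact (hr 9 (by omega)).trans hs.reg9
      · exact h10
      · exact (hr 12 (by omega)).trans hs.reg12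

theorem gapProgram_runs {n σ k l : ℕ} (hk : 1 ≤ k) (hkn : k ≤ n) (hln : l ≤ n)
    (hW : (2 ^ n.size) ^ 16 ≤ 2 ^ E.wordSize) {T : ℕ} {Q : State → Prop}
    (hsmall : ∀ s, n ≤ 2 * (gapParams n k l).K * l → s.reg 0 = 1 → Q s)
    (hlarge : ∀ s, PreLoaded n k l s → 2 * (gapParams n k l).K * l < n →
      Runs E (.seq setupLevels (.seq repeatSearch (.assign 0 (.reg 13)))) s (T + 2) Q) :
    Runs E gapProgram (gapInit n σ k l) (20 * k.sqrt + 20 * n.size + 100 + T) Q := by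
  have hn := Nat.lt_size_self n
  have hp := poly_lt (L := 2 ^ n.size) (by omega) hW
  have h1 : 2 ^ n.size * 2 ^ n.size ≤ (2 ^ n.size) ^ 3 := by
    rw [← sq]; exact Nat.pow_le_pow_right (by omega) (by norm_num)
  have h2 : (gapParams n k l).K * l ≤ 2 ^ n.size * 2 ^ n.size :=
    Nat.mul_le_mul ((gapParams_K_le.trans hkn).trans hn.le) (hln.trans hn.le)
  have hp1 : 2 ^ n.size ≤ (2 ^ n.size) ^ 3 := Nat.le_self_pow (by norm_num) _
  have h3 := gapParams_K_le (n := n) (k := k) (l := l)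
  have h4 : ((gapParams n k l).K + (gapParams n k l).K) * l =
      (gapParams n k l).K * l + (gapParams n k l).K * l := Nat.add_mul _ _ _
  have h5 : 2 * (gapParams n k l).K * l =
      (gapParams n k l).K * l + (gapParams n k l).K * l := by ring
  refine Runs.mono (T := (20 * k.sqrt + 20 * n.size + 80) + (7 + 1 + (T + 2))) (Runs.seq (Runs.mono
    (setup_runs hk hkn hW) le_rfl ?_)) (by omega) fun _ h => h
  intro s hs
  have ev : Expr.eval E s (((Expr.reg 7 + .reg 7) * .reg 3).lt (.reg 0)) =
      if ((gapParams n k l).K + (gapParams n k l).K) * l < n then 1 else 0 :=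
    eval_lt (eval_mul (eval_add (a := .reg 7) (b := .reg 7) hs.reg7 hs.reg7 (by omega))
      (b := .reg 3) hs.reg3 (by omega)) (b := .reg 0) hs.reg0 (by omega)
  refine Runs.ite (fun h => ?_) fun h => ?_
  · refine hlarge s hs ?_
    by_contra hcon
    exact h (by rw [ev, if_neg (by omega)])
  · refine Runs.mono (Runs.assign (v := 1) (eval_one (by omega)) (hsmall _ ?_ rfl))
      (show 2 ≤ T + 2 by omega) fun _ h => h
    by_contra hcon
    rw [ev, if_pos (by omega)] at h
    exact one_ne_zero h

/-- If the gap is wide compared to the length of the strings, the program answers at once. -/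
theorem gapProgram_runs_of_le {n σ k l : ℕ} (hk : 1 ≤ k) (hkn : k ≤ n) (hln : l ≤ n)
    (hW : (2 ^ n.size) ^ 16 ≤ 2 ^ E.wordSize) (h : n ≤ 2 * (gapParams n k l).K * l) :
    Runs E gapProgram (gapInit n σ k l) (20 * k.sqrt + 20 * n.size + 100)
      fun s => s.reg 0 = 1 :=
  gapProgram_runs (T := 0) hk hkn hln hW (fun _ _ h => h) fun _ _ h' => absurd h' (not_lt.2 h)

theorem gapProgram_runs_of_lt {n σ k l : ℕ} (hk : 1 ≤ k) (hkn : k ≤ n) (hl : 1 ≤ l) (hln : l ≤ n)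
    (hW : (2 ^ n.size) ^ 16 ≤ 2 ^ E.wordSize) (h : 2 * (gapParams n k l).K * l < n) :
    Runs E gapProgram (gapInit n σ k l)
      (20 * k.sqrt + 20 * n.size + 100 + (20 * n.size + 60 + (gapParams n k l).searchTime))
      fun s => s.reg 0 = truth (∃ i < (gapParams n k l).reps, ¬ (gapParams n k l).SearchHit
        (mismatch E.charA E.charB (gapParams n k l).K) (fun i => E.coin i)
        (i * (gapParams n k l).period)) := by
  refine gapProgram_runs hk hkn hln hW (fun _ h' => absurd h' (not_le.2 h)) fun s hs _ => ?_
  refine Runs.mono (T := (20 * n.size + 50) + ((gapParams n k l).searchTime + 2)) (Runs.seq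
    (Runs.mono (setupLevels_runs hk hkn hl h hW hs) le_rfl ?_)) (by omega) fun _ h => h
  rintro s₁ ⟨hl₁, hd₁⟩
  refine Runs.seq (Runs.mono (repeatSearch_runs hl₁ (gapParams_fits hk hkn hl h hW) hd₁)
    le_rfl fun s₂ h₂ => ?_)
  exact Runs.assign (a := .reg 13) h₂ rfl

end WordRAM

namespace WordRAM

/-! ## Probabilities of errors -/

section flagged

variable {c : ℕ → ℕ → ℕ} {k r D x g G : ℕ} {coin : ℕ → ℕ}

/-- Only expensive blocks are flagged. -/
theorem Flagged.le_minCost (h : Flagged c k r coin D x g G) :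
    r ≤ minCost c k x (x + G * g) := by
  obtain ⟨p, hp, hc⟩ := cheap_minCost (c := c) k x (x + G * g)
  exact (h p hp).trans ((pathCost_mono p _ _ (restrictCost_le c _)).trans hc)

/-- If an expensive block is not flagged, then the sample misses a long stretch of mismatches. -/
theorem exists_missed_stretch (hc : ∀ i s, c i s ≤ 1) (hr : 1 ≤ r)
    (hx : 2 * (r * r) ≤ minCost c k x (x + G * g)) (h : ¬ Flagged c k r coin D x g G) :
    ∃ u v s, x ≤ u ∧ v ≤ x + G * g ∧ s ≤ k ∧ r ≤ ∑ i ∈ Finset.Ico u v, c i s ∧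
      ∀ γ < G, ¬ (u ≤ x + γ * g + coin (D + γ) % g ∧ x + γ * g + coin (D + γ) % g < v ∧
        c (x + γ * g + coin (D + γ) % g) s ≠ 0) := by
  classical
  by_contra! hcon
  refine h fun p hp => ?_
  by_contra! hlt
  have h1 := pathCost_le_sampled hc (sampled coin D x g G) (k := k) (q := r)
    (Nat.le_add_right x (G * g)) (fun u v s hu hv hs hq => by
      obtain ⟨γ, hγ, h1, h2, h3⟩ := hcon u v s hu hv hs hq
      exact ⟨_, ⟨γ, hγ, rfl⟩, h1, h2, h3⟩) p hp
  have h2 : minCost c k x (x + G * g) ≤ pathCost c p x (x + G * g) := minCost_le ⟨p, hp, le_rfl⟩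
  have h3 : pathCost (fun i s => if i ∈ sampled coin D x g G then c i s else 0) p x (x + G * g) =
      pathCost (restrictCost c (sampled coin D x g G)) p x (x + G * g) := by
    simp only [pathCost, restrictCost]
  rw [h3] at h1
  -- A path of sampled cost at most `r - 1` truly costs at most `(r + 1) * (r - 1) + r < 2 * r ^ 2`,
  -- against heaviness.
  obtain ⟨r, rfl⟩ : ∃ r', r = r' + 1 := ⟨r - 1, by omega⟩
  have h4 := Nat.mul_le_mul_left (r + 1 + 1) (Nat.lt_succ_iff.1 hlt)
  nlinarith

end flagged

theorem sum_range_mul (f : ℕ → ℕ) (G g : ℕ) : ∑ i ∈ Finset.range (G * g), f i =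
    ∑ γ ∈ Finset.range G, ∑ t ∈ Finset.range g, f (γ * g + t) := by
  induction G with
  | zero => simp
  | succ G ih => rw [Nat.succ_mul, Finset.sum_range_add, ih, Finset.sum_range_succ]

/-- The sample is unlikely to miss a long stretch of mismatches. -/
theorem coinLaw_missed_stretch_le {w g : ℕ} (hg : 0 < g) (hW : g ≤ 2 ^ w) {c : ℕ → ℕ → ℕ}
    (hc : ∀ i s, c i s ≤ 1) {x G u v s r : ℕ} (D : ℕ) (hu : x ≤ u) (hv : v ≤ x + G * g)
    (hr : r ≤ ∑ i ∈ Finset.Ico u v, c i s) :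
    coinLaw w {ω | ∀ γ < G, ¬ (u ≤ x + γ * g + (ω (D + γ) : ℕ) % g ∧
      x + γ * g + (ω (D + γ) : ℕ) % g < v ∧ c (x + γ * g + (ω (D + γ) : ℕ) % g) s ≠ 0)} ≤
      ENNReal.ofReal (Real.exp (-(r / (2 * g)))) := by
  -- Each group has its own random word. However the mismatches are spread over the groups, the
  -- numbers of bad residues add up to at least `r`, and only this sum enters the exponent.
  set bad : ℕ → Finset ℕ := fun γ => (Finset.range g).filter fun t =>
    u ≤ x + γ * g + t ∧ x + γ * g + t < v ∧ c (x + γ * g + t) s ≠ 0 with hbad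
  have hsum : r ≤ ∑ γ ∈ Finset.range G, (bad γ).card := by
    refine hr.trans ?_
    have e : ∑ γ ∈ Finset.range G, (bad γ).card = ∑ i ∈ Finset.Ico x (x + G * g),
        if u ≤ i ∧ i < v ∧ c i s ≠ 0 then 1 else 0 := by
      rw [Finset.sum_Ico_eq_sum_range, Nat.add_sub_cancel_left, sum_range_mul]
      refine Finset.sum_congr rfl fun γ _ => ?_
      rw [hbad, Finset.card_filter]
      simp only [add_assoc]
    rw [e]
    calc ∑ i ∈ Finset.Ico u v, c i s ≤ ∑ i ∈ Finset.Ico u v,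
          if u ≤ i ∧ i < v ∧ c i s ≠ 0 then 1 else 0 := by
          refine Finset.sum_le_sum fun i hi => ?_
          rw [Finset.mem_Ico] at hi
          have := hc i s
          split_ifs with h
          · exact this
          · simp only [hi, true_and, not_not] at h; omega
      _ ≤ _ := Finset.sum_le_sum_of_subset (Finset.Ico_subset_Ico hu hv)
  refine (measure_mono ?_).trans ((coinLaw_avoid_le hg hW G (fun γ => D + γ)
    (add_right_injective D) bad fun γ t ht =>
      Finset.mem_range.1 (Finset.mem_filter.1 ht).1).trans ?_)
  · intro ω hω γ hγ hmem
    exact hω γ hγ (Finset.mem_filter.1 hmem).2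
  · refine ENNReal.ofReal_le_ofReal (Real.exp_le_exp.2 (neg_le_neg ?_))
    have : (r : ℝ) ≤ (∑ γ ∈ Finset.range G, (bad γ).card : ℕ) := by exact_mod_cast hsum
    gcongr

namespace Params

variable {P : Params} {W : ℕ}

theorem offset_add_lt {u a : ℕ} (hu : u ≤ P.U) (ha : a < P.samples u) :
    P.offset u + a * (1 + P.groups u) < P.period := by
  have h1 : P.offset (u + 1) ≤ P.period :=
    Finset.sum_le_sum_of_subset (Finset.range_mono (by omega))
  have h2 : P.offset (u + 1) = P.offset u + P.samples u * (1 + P.groups u) :=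
    Finset.sum_range_succ _ _
  have h3 := Nat.mul_lt_mul_of_pos_right ha (show 0 < 1 + P.groups u by omega)
  omega

theorem samples_mul_J (u : ℕ) : P.samples u * P.J = P.blocks u * P.L := by
  rw [samples, blocks]; ring

/-- If there are cheap paths, it is unlikely that every run of the search flags some block. -/
theorem coinLaw_forall_searchHit_le {w : ℕ} (hF : P.Fits (2 ^ w)) {c : ℕ → ℕ → ℕ} {d : ℕ}
    (hd : ∀ N, Cheap c (2 * P.K) 0 N d) (hr : 1 ≤ P.r)
    (hle : 4 * ((P.U + 1) * P.L * d) ≤ P.J * P.r) :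
    coinLaw w {ω | ∀ i < P.reps, P.SearchHit c (fun i => ω i) (i * P.period)} ≤
      ENNReal.ofReal ((1 / 2) ^ P.reps) := by
  set I : Finset (Σ _ : ℕ, ℕ) := (Finset.range (P.U + 1)).sigma fun u =>
    Finset.range (P.samples u) with hI
  set bad : ℕ → Finset ℕ := fun u => heavyBlocks c (2 * P.K) P.r (P.len u) (P.blocks u)
  have hmem : ∀ x ∈ I, x.1 ≤ P.U ∧ x.2 < P.samples x.1 := by
    intro x hx
    rw [hI, Finset.mem_sigma, Finset.mem_range, Finset.mem_range] at hx
    exact ⟨by omega, hx.2⟩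
  refine (measure_mono ?_).trans ((coinLaw_repeat_le I (fun x => P.blocks x.1) (fun x hx =>
    ⟨blocks_pos hF _, (blocks_le hF (hmem x hx).1).trans (by have := hF.total; omega)⟩)
    (fun x => bad x.1) P.reps
    (fun i x => i * P.period + P.offset x.1 + x.2 * (1 + P.groups x.1)) ?_).trans ?_)
  · intro ω hω i
    obtain ⟨u, hu, a, ha, h⟩ := hω i i.2
    refine ⟨⟨u, a⟩, Finset.mem_sigma.2 ⟨Finset.mem_range.2 (Nat.lt_succ_of_le hu), Finset.mem_range.2 ha⟩, ?_⟩
    refine Finset.mem_filter.2 ⟨Finset.mem_range.2 (Nat.mod_lt _ (blocks_pos hF u)), ?_⟩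
    have := Flagged.le_minCost h
    rwa [Nat.add_mul, one_mul]
  -- Repetition `i` uses indices in a window of length `period`, so division by `period` recovers
  -- `i`.
  · intro i i' x hx x' hx' h
    have h1 := offset_add_lt (hmem x hx).1 (hmem x hx).2
    have h2 := offset_add_lt (hmem x' hx').1 (hmem x' hx').2
    have hp : 0 < P.period := by omega
    have key : ∀ q y, y < P.period → (q * P.period + y) / P.period = q := fun q y hy => by
      rw [mul_comm, Nat.mul_add_div hp, Nat.div_eq_of_lt hy, add_zero]
    refine Fin.ext ?_
    rw [← key i _ h1, ← key i' _ h2, ← add_assoc, ← add_assoc, h]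
  · have hS0 : 0 ≤ ∑ x ∈ I, 2 * ((bad x.1).card : ℝ) / P.blocks x.1 :=
      Finset.sum_nonneg fun _ _ => div_nonneg (mul_nonneg zero_le_two (Nat.cast_nonneg _))
        (Nat.cast_nonneg _)
    suffices hS : ∑ x ∈ I, 2 * ((bad x.1).card : ℝ) / P.blocks x.1 ≤ 1 / 2 from
      ENNReal.ofReal_le_ofReal (pow_le_pow_left₀ hS0 hS _)
    rw [hI, Finset.sum_sigma]
    simp only [Finset.sum_const, Finset.card_range, nsmul_eq_mul]
    have hJ : (0 : ℝ) < P.J := by exact_mod_cast hF.J_pos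
    have hr' : (0 : ℝ) < P.r := by exact_mod_cast hr
    -- By Markov at most `d / r` blocks of a level cost `r` or more; samples and blocks are in the
    -- ratio `L / J` on each level, and 2 is the bias of residues.
    have hterm : ∀ u ∈ Finset.range (P.U + 1),
        (P.samples u : ℝ) * (2 * ((bad u).card : ℝ) / P.blocks u) ≤ 2 * P.L * d / (P.J * P.r) := by
      intro u hu
      have hN : (0 : ℝ) < P.blocks u := by exact_mod_cast blocks_pos hF u
      have h1 : ((bad u).card : ℝ) * P.r ≤ d := by
        exact_mod_cast card_expensive_blocks c (2 * P.K) (P.len u) (P.blocks u) P.r d (hd _)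
      have h2 : (P.samples u : ℝ) * P.J = P.blocks u * P.L := by
        exact_mod_cast samples_mul_J (P := P) u
      rw [← mul_div_assoc, div_le_div_iff₀ hN (by positivity)]
      calc (P.samples u : ℝ) * (2 * (bad u).card) * (P.J * P.r)
          = 2 * (P.samples u * P.J) * ((bad u).card * P.r) := by ring
        _ ≤ 2 * (P.samples u * P.J) * d := by gcongr
        _ = _ := by rw [h2]; ring
    refine (Finset.sum_le_sum hterm).trans ?_
    rw [Finset.sum_const, Finset.card_range, nsmul_eq_mul, ← mul_div_assoc,
      div_le_div_iff₀ (by positivity) (by norm_num)]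
    have : (4 : ℝ) * ((P.U + 1 : ℕ) * P.L * d) ≤ P.J * P.r := by exact_mod_cast hle
    nlinarith

/-- If some level has many heavy blocks, it is unlikely that a run of the search flags no block. -/
theorem coinLaw_exists_not_searchHit_le {w : ℕ} (hF : P.Fits (2 ^ w)) {c : ℕ → ℕ → ℕ}
    (hc : ∀ i s, c i s ≤ 1) (hr : 1 ≤ P.r) (hK : P.K = P.r * P.r) {u : ℕ} (hu : u ≤ P.U)
    {ε δ : ℝ} (hε : Real.exp (-(P.L * (heavyBlocks c (2 * P.K) (2 * P.K) (P.len u)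
      (P.blocks u)).card / (2 * P.J))) ≤ ε)
    (hδ : P.g = 1 ∧ 0 ≤ δ ∨ Real.exp (-(P.r / (2 * P.g))) ≤ δ) :
    coinLaw w {ω | ∃ i < P.reps, ¬ P.SearchHit c (fun i => ω i) (i * P.period)} ≤
      ENNReal.ofReal (P.reps * (ε + P.samples u * (P.blocks u *
        ((P.J * P.len P.U + 1 : ℕ) * ((P.J * P.len P.U + 1 : ℕ) * ((2 * P.K + 1 : ℕ) * δ)))))) := by
  have hε0 : 0 ≤ ε := (Real.exp_pos _).le.trans hε
  have hδ0 : 0 ≤ δ := by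
    rcases hδ with h | h
    exacts [h.2, (Real.exp_pos _).le.trans h]
  have hW := hF.total
  set N := P.blocks u with hN
  set V := P.J * P.len P.U + 1 with hV
  set heavy := heavyBlocks c (2 * P.K) (2 * P.K) (P.len u) N with hheavy
  set pos : ℕ → ℕ → ℕ := fun i a => i * P.period + P.offset u + a * (1 + P.groups u) with hpos
  have hNW : N ≤ 2 ^ w := (blocks_le hF hu).trans (by omega)
  have hgW : P.g ≤ 2 ^ w := by
    have : P.g ≤ P.len P.U := Nat.le_mul_of_pos_left _ (groups_pos hF _)
    omega
  -- A run fails only if no heavy block is drawn (`A`) or the test of a drawn block misses a stretch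
  -- (`B`). As the drawn block is itself random, `B` is taken for each fixed block `j`, interval and
  -- shift, and the union bound runs over all of them.
  let A : ℕ → Set (ℕ → Fin (2 ^ w)) := fun i =>
    {ω | ∀ a < P.samples u, (ω (pos i a) : ℕ) % N ∉ heavy}
  let B : ℕ → ℕ → ℕ → ℕ → ℕ → ℕ → Set (ℕ → Fin (2 ^ w)) := fun i a j y z s =>
    {ω | (j * P.len u ≤ y ∧ z ≤ j * P.len u + P.groups u * P.g ∧
      P.r ≤ ∑ i ∈ Finset.Ico y z, c i s) ∧ ∀ γ < P.groups u,
      ¬ (y ≤ j * P.len u + γ * P.g + (ω (pos i a + 1 + γ) : ℕ) % P.g ∧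
        j * P.len u + γ * P.g + (ω (pos i a + 1 + γ) : ℕ) % P.g < z ∧
        c (j * P.len u + γ * P.g + (ω (pos i a + 1 + γ) : ℕ) % P.g) s ≠ 0)}
  have hA : ∀ i, coinLaw w (A i) ≤ ENNReal.ofReal ε := by
    intro i
    refine (coinLaw_avoid_le (blocks_pos hF u) hNW (P.samples u) (pos i) ?_ (fun _ => heavy)
      fun _ b hb => Finset.mem_range.1 (Finset.mem_filter.1 hb).1).trans
      (ENNReal.ofReal_le_ofReal (le_of_eq_of_le ?_ hε))
    · intro a a' h
      simp only [hpos, add_right_inj] at h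
      exact Nat.eq_of_mul_eq_mul_right (by omega) h
    · rw [Finset.sum_const, Finset.card_range, smul_eq_mul]
      congr 2
      have hJ : (0 : ℝ) < P.J := by exact_mod_cast hF.J_pos
      have hN' : (0 : ℝ) < N := by exact_mod_cast blocks_pos hF u
      have h2 : (P.samples u : ℝ) * P.J = N * P.L := by
        exact_mod_cast samples_mul_J (P := P) u
      rw [div_eq_div_iff (by positivity) (by positivity)]
      push_cast
      linear_combination (2 * (heavy.card : ℝ)) * h2
  have hB : ∀ i a j y z s, coinLaw w (B i a j y z s) ≤ ENNReal.ofReal δ := by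
    intro i a j y z s
    by_cases hcond : j * P.len u ≤ y ∧ z ≤ j * P.len u + P.groups u * P.g ∧
      P.r ≤ ∑ i ∈ Finset.Ico y z, c i s
    · rcases hδ with ⟨hg, -⟩ | hδ
      -- With `g = 1` every position is sampled, so no stretch containing a mismatch can be missed.
      · have : B i a j y z s = ∅ := by
          refine Set.eq_empty_of_forall_notMem fun ω hω => ?_
          obtain ⟨h1, h2, h3⟩ := hcond
          have h4 : ∑ i ∈ Finset.Ico y z, c i s ≠ 0 := by omega
          obtain ⟨i, hi, hne⟩ := Finset.exists_ne_zero_of_sum_ne_zero h4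
          rw [Finset.mem_Ico] at hi
          rw [hg, mul_one] at h2
          refine hω.2 (i - j * P.len u) (by omega) ?_
          rw [hg, Nat.mod_one, mul_one, add_zero, Nat.add_sub_cancel' (by omega)]
          exact ⟨hi.1, hi.2, hne⟩
        rw [this, measure_empty]
        exact zero_le
      · exact (measure_mono fun ω hω => hω.2).trans ((coinLaw_missed_stretch_le hF.g_pos hgW hc _
          hcond.1 hcond.2.1 hcond.2.2).trans (ENNReal.ofReal_le_ofReal hδ))
    · have : B i a j y z s = ∅ := Set.eq_empty_of_forall_notMem fun ω hω => hcond hω.1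
      rw [this, measure_empty]
      exact zero_le
  have hsub : {ω : ℕ → Fin (2 ^ w) | ∃ i < P.reps, ¬ P.SearchHit c (fun i => ω i) (i * P.period)} ⊆
      ⋃ i ∈ Finset.range P.reps, (A i ∪ ⋃ a ∈ Finset.range (P.samples u), ⋃ j ∈ Finset.range N,
        ⋃ y ∈ Finset.range V, ⋃ z ∈ Finset.range V, ⋃ s ∈ Finset.range (2 * P.K + 1),
          B i a j y z s) := by
    rintro ω ⟨i, hi, hω⟩
    simp only [Set.mem_iUnion, Set.mem_union, Finset.mem_range, exists_prop]
    refine ⟨i, hi, ?_⟩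
    by_cases hAω : ω ∈ A i
    · exact .inl hAω
    right
    obtain ⟨a, ha, hmem⟩ : ∃ a < P.samples u, (ω (pos i a) : ℕ) % N ∈ heavy := by
      by_contra! hcon
      exact hAω hcon
    set j := (ω (pos i a) : ℕ) % N with hj
    have hjN : j < N := Nat.mod_lt _ (blocks_pos hF u)
    have hnot : ¬ Flagged c (2 * P.K) P.r (fun i => ω i) (pos i a + 1) (j * P.len u) P.g
        (P.groups u) := fun h => hω ⟨u, hu, a, ha, h⟩
    have hmin := (Finset.mem_filter.1 hmem).2
    rw [Nat.add_mul, one_mul, hK] at hmin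
    obtain ⟨y, z, s, hy, hz, hs, hsum, hmiss⟩ := exists_missed_stretch hc hr
      (by rw [hK]; exact hmin) hnot
    have hyz : y < z := by
      by_contra hge
      rw [Finset.Ico_eq_empty hge, Finset.sum_empty] at hsum
      omega
    have hzV : z < V := by
      have h1 : (j + 1) * P.len u ≤ N * P.len u := Nat.mul_le_mul_right _ hjN
      rw [hN, blocks_mul_len hu, Nat.add_mul, one_mul] at h1
      change z ≤ j * P.len u + P.len u at hz
      omega
    exact ⟨a, ha, j, hjN, y, by omega, z, hzV, s, by omega, ⟨hy, hz, hsum⟩, hmiss⟩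
  have bound : ∀ (n : ℕ) (S : ℕ → Set (ℕ → Fin (2 ^ w))) (e : ℝ), 0 ≤ e →
      (∀ i, coinLaw w (S i) ≤ ENNReal.ofReal e) →
      coinLaw w (⋃ i ∈ Finset.range n, S i) ≤ ENNReal.ofReal (n * e) := by
    intro n S e he hS
    refine (measure_biUnion_finset_le _ _).trans ((Finset.sum_le_sum fun i _ => hS i).trans ?_)
    rw [Finset.sum_const, Finset.card_range, nsmul_eq_mul, ENNReal.ofReal_mul (by positivity),
      ENNReal.ofReal_natCast]
  refine (measure_mono hsub).trans (bound _ _ _ (by positivity) fun i => ?_)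
  rw [ENNReal.ofReal_add hε0 (by positivity)]
  refine (measure_union_le _ _).trans (add_le_add (hA i) ?_)
  refine bound _ _ _ (by positivity) fun a => bound _ _ _ (by positivity) fun j =>
    bound _ _ _ (by positivity) fun y => bound _ _ _ (by positivity) fun z =>
    bound _ _ _ hδ0 fun s => hB i a j y z s

end Params

end WordRAM

namespace WordRAM

/-! ## The gap edit distance theorem -/

section bounds

variable {n k l : ℕ}

theorem le_sqrt_mul_sqrt (hk : 1 ≤ k) : k ≤ 4 * (k.sqrt * k.sqrt) := by
  have h1 : k < (k.sqrt + 1) * (k.sqrt + 1) := Nat.lt_succ_sqrt k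
  have h2 : 1 ≤ k.sqrt := Nat.sqrt_pos.2 hk
  nlinarith

theorem size_pos_of_le (hk : 1 ≤ k) (hkn : k ≤ n) : 1 ≤ n.size := Nat.size_pos.2 (hk.trans hkn)

theorem gapParams_K_le_mul (hk : 1 ≤ k) (hkn : k ≤ n) :
    (gapParams n k l).K ≤ k.sqrt * (128 * n.size * (gapParams n k l).g) := by
  have h1 := Nat.lt_mul_div_succ k.sqrt (show 0 < 128 * n.size by
    have := size_pos_of_le hk hkn
    omega)
  exact Nat.mul_le_mul_left _ h1.le

/-- The time bound of the search. -/
theorem gapParams_searchTime_le (hk : 1 ≤ k) (hkn : k ≤ n) (hl : 1 ≤ l)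
    (h : 2 * (gapParams n k l).K * l < n) :
    (20 * k.sqrt + 20 * n.size + 100 + (20 * n.size + 60 + (gapParams n k l).searchTime)) * l ≤
      3 * 10 ^ 8 * n.size ^ 5 * (n * k.sqrt) := by
  have hU := gapParams_U_le hk hkn hl h
  have hlen := gapParams_len_top_lt hk hkn h
  have hK := gapParams_K_le_mul (l := l) hk hkn
  have hK1 := gapParams_K_pos (n := n) (l := l) hk
  have hrK := gapParams_r_le_K (n := n) (k := k) (l := l)
  have hlam := size_pos_of_le hk hkn
  have hg : 1 ≤ (gapParams n k l).groups (gapParams n k l).U := by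
    by_contra h0
    have h1 := gapParams_len_zero_pos (n := n) (k := k) (l := l)
    have h2 := (gapParams n k l).len_eq (gapParams n k l).U
    rw [Params.len, show (gapParams n k l).groups (gapParams n k l).U = 0 by omega, zero_mul] at h2
    have := Nat.mul_pos h1 (Nat.two_pow_pos (gapParams n k l).U)
    omega
  rw [Params.len] at hlen
  rw [Params.searchTime, Params.levelTime, show (gapParams n k l).L = 128 * (n.size * n.size) from rfl,
    show (gapParams n k l).reps = n.size from rfl]
  change k.sqrt ≤ _ at hrK
  generalize (gapParams n k l).K = K at *
  generalize (gapParams n k l).U = U at *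
  generalize (gapParams n k l).groups U = G at *
  generalize (gapParams n k l).g = g at *
  generalize n.size = lam at *
  generalize k.sqrt = r at *
  have hX : 1 ≤ lam * lam * G * K := Nat.mul_pos (Nat.mul_pos (Nat.mul_pos hlam hlam) hg) hK1
  have hKX : K ≤ lam * lam * G * K :=
    Nat.le_mul_of_pos_left _ (Nat.mul_pos (Nat.mul_pos hlam hlam) hg)
  -- `K ≤ r * (128 * lam * g)` trades a factor `K` for `g`, and `G * g * l < 2 * n` then bounds the
  -- top block length. This is where `√k` appears in the time.
  have hXl : lam * lam * G * K * l ≤ 256 * lam ^ 3 * (n * r) := by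
    calc lam * lam * G * K * l ≤ lam * lam * G * (r * (128 * lam * g)) * l := by gcongr
      _ = 128 * lam ^ 3 * r * (G * g * l) := by ring
      _ ≤ 128 * lam ^ 3 * r * (2 * n) := by gcongr
      _ = _ := by ring
  rw [show 128 * (lam * lam) * G * K = 128 * (lam * lam * G * K) by ring]
  generalize lam * lam * G * K = X at *
  have hT : 20 * r + 20 * lam + 100 + (20 * lam + 60 + (lam * ((U + 1) *
      (3000 * (128 * X) + 50 + 20) + 60) + 20)) ≤ 10 ^ 6 * lam ^ 2 * X := by
    have h1 : lam * ((U + 1) * (3000 * (128 * X) + 50 + 20) + 60) ≤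
        lam * (2 * lam * (3000 * (128 * X) + 50 * X + 20 * X) + 60 * (lam * X)) := by
      have : 1 ≤ lam * X := Nat.mul_pos hlam hX
      gcongr
      · omega
      · omega
      · omega
      · omega
    have h2 : 1 ≤ lam ^ 2 := Nat.one_le_pow _ _ hlam
    have h3 : lam ≤ lam ^ 2 := Nat.le_self_pow two_ne_zero lam
    have h4 : lam ^ 2 ≤ lam ^ 2 * X := Nat.le_mul_of_pos_right _ hX
    have h5 : X ≤ lam ^ 2 * X := Nat.le_mul_of_pos_left _ h2
    nlinarith
  calc _ ≤ 10 ^ 6 * lam ^ 2 * X * l := Nat.mul_le_mul_right _ hT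
    _ = 10 ^ 6 * lam ^ 2 * (X * l) := by ring
    _ ≤ 10 ^ 6 * lam ^ 2 * (256 * lam ^ 3 * (n * r)) := by gcongr
    _ ≤ _ := by
      have : 0 ≤ lam ^ 5 * (n * r) := Nat.zero_le _
      nlinarith

/-- Few edits lead to paths that are cheap enough for the search. -/
theorem gapParams_small (hk : 1 ≤ k) (hkn : k ≤ n) (hl : 1 ≤ l)
    (hrl : k.sqrt ≤ l) (h : 2 * (gapParams n k l).K * l < n) {d : ℕ}
    (hd : 10 ^ 8 * n.size ^ 5 * d ≤ k.sqrt * k.sqrt) :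
    4 * (((gapParams n k l).U + 1) * (gapParams n k l).L * (2 * d)) ≤
      (gapParams n k l).J * (gapParams n k l).r := by
  have hU := gapParams_U_le hk hkn hl h
  have hlen := gapParams_len_top_lt hk hkn h
  have hJ := gapParams_le_blocks (n := n) (k := k) (l := l)
  have hlam := size_pos_of_le hk hkn
  rw [show (gapParams n k l).L = 128 * (n.size * n.size) from rfl,
    show (gapParams n k l).r = k.sqrt from rfl]
  generalize (gapParams n k l).U = U at *
  generalize (gapParams n k l).len U = b at *
  generalize (gapParams n k l).J = J at *
  generalize n.size = lam at *
  generalize k.sqrt = r at *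
  -- Top blocks are shorter than `2 * n / l`, so more than `l / 2` are needed to cover the string.
  -- With `r ≤ l` this gives `r * r ≤ 2 * J * r` below.
  have h1 : l < 2 * J := by
    refine Nat.lt_of_mul_lt_mul_left (a := b) ?_
    calc b * l < 2 * n := hlen
      _ ≤ 2 * (J * b) := by omega
      _ = _ := by ring
  have h2 : lam ^ 3 ≤ lam ^ 5 := Nat.pow_le_pow_right hlam (by norm_num)
  have h3 : 2 * (4 * ((U + 1) * (128 * (lam * lam)) * (2 * d))) ≤ 2 * (J * r) := by
    calc 2 * (4 * ((U + 1) * (128 * (lam * lam)) * (2 * d)))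
        ≤ 2 * (4 * ((2 * lam) * (128 * (lam * lam)) * (2 * d))) := by gcongr; omega
      _ = 4096 * lam ^ 3 * d := by ring
      _ ≤ 10 ^ 8 * lam ^ 5 * d := by gcongr; norm_num
      _ ≤ r * r := hd
      _ ≤ (2 * J) * r := Nat.mul_le_mul_right _ (by omega)
      _ = _ := by ring
  omega

theorem exp_neg_le_pow {x : ℝ} {m : ℕ} (h : 32 * (m : ℝ) ≤ x) :
    Real.exp (-x) ≤ ((2 ^ m : ℝ) ^ 32)⁻¹ := by
  rw [Real.exp_neg]
  refine inv_anti₀ (by positivity) ?_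
  have h1 : (2 : ℝ) ≤ Real.exp 1 := by
    have := Real.add_one_le_exp (1 : ℝ)
    linarith
  calc ((2 : ℝ) ^ m) ^ 32 ≤ (Real.exp 1 ^ m) ^ 32 := by gcongr
    _ = Real.exp (32 * m) := by
      rw [← pow_mul, ← Real.exp_nat_mul]
      congr 1
      push_cast
      ring
    _ ≤ _ := Real.exp_le_exp.2 h

/-- Either all positions are sampled, or a long stretch of mismatches is rarely missed. -/
theorem gapParams_density (hk : 1 ≤ k) (hkn : k ≤ n) :
    (gapParams n k l).g = 1 ∧ 0 ≤ ((2 ^ n.size : ℝ) ^ 32)⁻¹ ∨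
      Real.exp (-((gapParams n k l).r / (2 * (gapParams n k l).g))) ≤
        ((2 ^ n.size : ℝ) ^ 32)⁻¹ := by
  have hlam := size_pos_of_le hk hkn
  have hg : (gapParams n k l).g = k.sqrt / (128 * n.size) + 1 := rfl
  rw [hg, show (gapParams n k l).r = k.sqrt from rfl]
  generalize n.size = lam at *
  generalize k.sqrt = r at *
  rcases Nat.eq_zero_or_pos (r / (128 * lam)) with h | h
  · exact .inl ⟨by rw [h], by positivity⟩
  · right
    refine exp_neg_le_pow ?_
    -- The quotient `q` is at least 1, so `g = q + 1 ≤ 2 * q`, and `128 * lam * q ≤ r` gives `r / (2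
    -- * g) ≥ 32 * lam`.
    have h1 : 128 * lam * (r / (128 * lam)) ≤ r := Nat.mul_div_le _ _
    generalize r / (128 * lam) = q at *
    rw [le_div_iff₀ (by positivity)]
    have h2 : 32 * lam * (2 * (q + 1)) ≤ r := by nlinarith [Nat.mul_le_mul_left lam h]
    exact_mod_cast h2

/-- If every path is expensive, the error probability of the search is small. -/
theorem gapParams_error_le {w : ℕ} (hk : 1 ≤ k) (hkn : k ≤ n) (hl : 1 ≤ l)
    (h : 2 * (gapParams n k l).K * l < n) (hW : (2 ^ n.size) ^ 16 ≤ 2 ^ w) {c : ℕ → ℕ → ℕ}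
    (hc : ∀ i s, c i s ≤ 1)
    (hD : 12 * (gapParams n k l).K * l < minCost c (2 * (gapParams n k l).K) 0 n) :
    coinLaw w {ω | ∃ i < (gapParams n k l).reps, ¬ (gapParams n k l).SearchHit c (fun i => ω i)
      (i * (gapParams n k l).period)} ≤ ENNReal.ofReal (1 / n) := by
  have hF := gapParams_fits hk hkn hl h hW
  have hlam := size_pos_of_le hk hkn
  have hU := gapParams_U_le hk hkn hl h
  have hJl := gapParams_J_le (n := n) (k := k) hl
  have hJn := gapParams_le_blocks (n := n) (k := k) (l := l)
  rw [Params.len_eq] at hJn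
  -- The constant 12: `2 * (2 * K) * (J + l)` is at most `12 * K * l`, because `J ≤ l + 1` and `l ≥
  -- 1`.
  obtain ⟨u, hu, hheavy⟩ := exists_level_heavyBlocks hc (gapParams_len_zero hk (hk.trans hkn)) hJn
    (l := l) (lt_of_le_of_lt (by nlinarith) hD)
  rw [← Params.len_eq] at hheavy
  change l ≤ _ * (heavyBlocks c (2 * (gapParams n k l).K) (2 * (gapParams n k l).K)
    ((gapParams n k l).len u) ((gapParams n k l).blocks u)).card at hheavy
  refine (Params.coinLaw_exists_not_searchHit_le hF hc (gapParams_r_pos hk) rfl hu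
    (ε := ((2 ^ n.size : ℝ) ^ 32)⁻¹) (exp_neg_le_pow ?_) (gapParams_density hk hkn)).trans
    (ENNReal.ofReal_le_ofReal ?_)
  · have hJ0 := hF.J_pos
    rw [show (gapParams n k l).L = 128 * (n.size * n.size) from rfl]
    generalize (heavyBlocks c (2 * (gapParams n k l).K) (2 * (gapParams n k l).K)
      ((gapParams n k l).len u) ((gapParams n k l).blocks u)).card = m at *
    generalize (gapParams n k l).J = J at *
    rw [le_div_iff₀ (by positivity)]
    -- `J ≤ l + 1 ≤ 2 * l ≤ 2 * n.size * m`; one factor `n.size` in `L` compensates the number of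
    -- levels, the other gives the exponent.
    have h1 : 32 * n.size * (2 * J) ≤ 128 * (n.size * n.size) * m := by
      calc 32 * n.size * (2 * J) ≤ 32 * n.size * (2 * (2 * (n.size * m))) := by
            have := Nat.mul_le_mul_right m hU
            gcongr
            omega
        _ = _ := by ring
    exact_mod_cast h1
  · have hΛ : n < 2 ^ n.size := Nat.lt_size_self n
    have hΛ2 : 2 ≤ 2 ^ n.size := Nat.le_self_pow (by omega) 2
    have hreps : (gapParams n k l).reps ≤ 2 ^ n.size := size_le_two_pow n
    have hlen : (gapParams n k l).len (gapParams n k l).U ≤ 2 * 2 ^ n.size := by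
      have h1 := gapParams_len_top_lt hk hkn h
      have h2 := Nat.le_mul_of_pos_right ((gapParams n k l).len (gapParams n k l).U) hl
      omega
    have hblocks := gapParams_blocks_le (n := n) (k := k) (l := l)
    have hs : (gapParams n k l).samples u ≤ 256 * (2 ^ n.size) ^ 3 := by
      calc (gapParams n k l).samples u
          ≤ 2 ^ (gapParams n k l).U * (128 * (2 ^ n.size * 2 ^ n.size)) := by
            refine Nat.mul_le_mul (Nat.pow_le_pow_right two_pos (Nat.sub_le _ _)) ?_
            exact Nat.mul_le_mul_left _ (Nat.mul_le_mul (size_le_two_pow n) (size_le_two_pow n))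
        _ ≤ (2 * 2 ^ n.size) * (128 * (2 ^ n.size * 2 ^ n.size)) :=
            Nat.mul_le_mul_right _ (two_pow_U_le.trans hlen)
        _ = _ := by ring
    have hb : (gapParams n k l).blocks u ≤ 3 * 2 ^ n.size :=
      (Params.blocks_le hF hu).trans (by omega)
    have hV : (gapParams n k l).J * (gapParams n k l).len (gapParams n k l).U + 1 ≤
        4 * 2 ^ n.size := by omega
    have hK : 2 * (gapParams n k l).K + 1 ≤ 3 * 2 ^ n.size := by
      have := (gapParams_K_le (n := n) (k := k) (l := l)).trans hkn
      omega
    have hn : (0 : ℝ) < n := by exact_mod_cast hk.trans hkn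
    generalize (gapParams n k l).reps = R at *
    generalize (gapParams n k l).samples u = S at *
    generalize (gapParams n k l).blocks u = N at *
    generalize (gapParams n k l).J * (gapParams n k l).len (gapParams n k l).U + 1 = V at *
    generalize 2 * (gapParams n k l).K + 1 = M at *
    -- The union bound has polynomially many terms in `2 ^ n.size`, which the thirty-second power in
    -- `ε` and `δ` outweighs.
    have key : R * (1 + S * (N * (V * (V * M)))) * n ≤ (2 ^ n.size) ^ 32 := by
      generalize 2 ^ n.size = Λ at *
      calc R * (1 + S * (N * (V * (V * M)))) * n
          ≤ Λ * (Λ ^ 8 + 256 * Λ ^ 3 * (3 * Λ * (4 * Λ * (4 * Λ * (3 * Λ))))) * Λ := by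
            gcongr
            exact Nat.one_le_pow _ _ (by omega)
        _ = Λ ^ 10 + 36864 * Λ ^ 9 := by ring
        _ ≤ 2 ^ 16 * (Λ ^ 10) := by
          have : Λ ^ 9 * 2 ≤ Λ ^ 9 * Λ := Nat.mul_le_mul_left _ hΛ2
          rw [pow_succ Λ 9]
          omega
        _ ≤ Λ ^ 22 * Λ ^ 10 := by
          refine Nat.mul_le_mul_right _ ?_
          exact (Nat.pow_le_pow_left hΛ2 16).trans (Nat.pow_le_pow_right (by omega) (by norm_num))
        _ = _ := by ring
    have key' : (R : ℝ) * (1 + S * (N * (V * (V * M)))) * n ≤ ((2 : ℝ) ^ n.size) ^ 32 := by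
      exact_mod_cast key
    rw [le_div_iff₀ hn]
    calc _ = (R : ℝ) * (1 + S * (N * (V * (V * M)))) * n * (((2 : ℝ) ^ n.size) ^ 32)⁻¹ := by ring
      _ ≤ ((2 : ℝ) ^ n.size) ^ 32 * (((2 : ℝ) ^ n.size) ^ 32)⁻¹ := by gcongr
      _ = 1 := mul_inv_cancel₀ (by positivity)

end bounds

/-! ### Assembling the time bound and the two error bounds -/

theorem size_le_log {n : ℕ} (hn : 1 ≤ n) : (n.size : ℝ) ≤ 3 * Real.log (n + 2) := by
  have h3 : (1 : ℝ) ≤ Real.log (n + 2) := by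
    rw [Real.le_log_iff_exp_le (by positivity)]
    have : (1 : ℝ) ≤ n := by exact_mod_cast hn
    have := Real.exp_one_lt_d9
    linarith
  obtain ⟨m, hm⟩ : ∃ m, n.size = m + 1 := ⟨n.size - 1, by have := Nat.size_pos.2 hn; omega⟩
  have h1 : 2 ^ m ≤ n := Nat.lt_size.1 (by omega)
  have h2 : (m : ℝ) * Real.log 2 ≤ Real.log (n + 2) := by
    rw [← Real.log_pow]
    refine Real.log_le_log (by positivity) ?_
    have : ((2 : ℝ) ^ m) ≤ n := by exact_mod_cast h1
    linarith
  have h4 := Real.log_two_gt_d9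
  have h5 : (m : ℝ) * (1 / 2) ≤ m * Real.log 2 := by gcongr; linarith
  rw [hm]
  push_cast
  linarith

/-- Only monotonicity and subadditivity are used, so the output events need not be shown measurable.
-/
theorem ofReal_one_sub_le {w n : ℕ} {S T : Set (ℕ → Fin (2 ^ w))}
    (hS : coinLaw w T ≤ ENNReal.ofReal (1 / n)) (h : ∀ ω, ω ∉ T → ω ∈ S) :
    ENNReal.ofReal (1 - 1 / n) ≤ coinLaw w S := by
  rw [ENNReal.ofReal_sub _ (by positivity), ENNReal.ofReal_one, tsub_le_iff_right]
  have h1 : coinLaw w Set.univ ≤ coinLaw w (S ∪ T) :=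
    measure_mono fun ω _ => (em (ω ∈ T)).symm.imp (h ω) id
  rw [measure_univ] at h1
  exact h1.trans ((measure_union_le _ _).trans (add_le_add_right hS _))

theorem gapProgram_halts {n σ k l κ : ℕ} (hκ : (2 ^ n.size) ^ 16 ≤ 2 ^ wordBits κ n σ) (hk : 1 ≤ k)
    (hkn : k ≤ n) (hl : 1 ≤ l) (hln : l ≤ n) (A B : Fin n → Fin σ)
    (ω : ℕ → Fin (2 ^ wordBits κ n σ)) :
    ∃ (s : State) (t : ℕ), Exec (gapEnv κ A B ω) gapProgram (gapInit n σ k l) s t ∧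
      t * l ≤ 3 * 10 ^ 8 * n.size ^ 5 * (n * k.sqrt) := by
  rcases le_or_gt n (2 * (gapParams n k l).K * l) with h | h
  · obtain ⟨s, t, he, ht, -⟩ := gapProgram_runs_of_le (E := gapEnv κ A B ω) (σ := σ) hk hkn hln hκ h
    refine ⟨s, t, he, ?_⟩
    have h1 : 1 ≤ n.size := size_pos_of_le hk hkn
    have h2 : 1 ≤ k.sqrt := Nat.sqrt_pos.2 hk
    have h3 : n.size ≤ n.size ^ 5 := Nat.le_self_pow (by norm_num) _
    calc t * l ≤ (140 * (n.size * k.sqrt)) * n := by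
          refine Nat.mul_le_mul (ht.trans ?_) hln
          nlinarith
      _ = 140 * n.size * (n * k.sqrt) := by ring
      _ ≤ _ := by gcongr; norm_num
  · obtain ⟨s, t, he, ht, -⟩ := gapProgram_runs_of_lt (E := gapEnv κ A B ω) (σ := σ) hk hkn hl hln
      hκ h
    exact ⟨s, t, he, (Nat.mul_le_mul_right _ ht).trans (gapParams_searchTime_le hk hkn hl h)⟩

theorem gapProgram_outputs_small {n σ k l κ : ℕ} (hκ : (2 ^ n.size) ^ 16 ≤ 2 ^ wordBits κ n σ)
    (hk : 1 ≤ k) (hkn : k ≤ n) (hl : 1 ≤ l) (hln : l ≤ n) (hrl : k.sqrt ≤ l) {A B : Fin n → Fin σ}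
    (hd : 10 ^ 8 * n.size ^ 5 * stringED A B ≤ k.sqrt * k.sqrt) :
    ENNReal.ofReal (1 - 1 / n) ≤ probOutputs gapProgram κ k l A B .small := by
  rcases le_or_gt n (2 * (gapParams n k l).K * l) with h | h
  · refine ofReal_one_sub_le (T := ∅) (by simp) fun ω _ => ?_
    obtain ⟨s, t, he, -, hs⟩ := gapProgram_runs_of_le (E := gapEnv κ A B ω) (σ := σ) hk hkn hln hκ h
    exact ⟨s, t, he, hs⟩
  · have hlam := size_pos_of_le hk hkn
    have hED : 2 * stringED A B ≤ (gapParams n k l).K := by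
      have h1 : 1 ≤ n.size ^ 5 := Nat.one_le_pow _ _ hlam
      change _ ≤ k.sqrt * k.sqrt
      nlinarith [Nat.mul_le_mul_right (stringED A B) h1]
    have hμ := Params.coinLaw_forall_searchHit_le (gapParams_fits hk hkn hl h hκ)
      (fun N => cheap_of_stringED A B hED N) (gapParams_r_pos hk)
      (gapParams_small hk hkn hl hrl h hd)
    refine ofReal_one_sub_le (hμ.trans (ENNReal.ofReal_le_ofReal ?_)) fun ω hω => ?_
    · have h1 : (0 : ℝ) < n := by exact_mod_cast hk.trans hkn
      have h2 : (n : ℝ) ≤ 2 ^ n.size := by exact_mod_cast (Nat.lt_size_self n).le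
      rw [div_pow, one_pow]
      exact one_div_le_one_div_of_le h1 h2
    · obtain ⟨s, t, he, -, hs⟩ := gapProgram_runs_of_lt (E := gapEnv κ A B ω) (σ := σ) hk hkn hl hln
        hκ h
      refine ⟨s, t, he, hs.trans (truth_true ?_)⟩
      by_contra! hcon
      exact hω hcon

theorem gapProgram_outputs_large {n σ k l κ : ℕ} (hκ : (2 ^ n.size) ^ 16 ≤ 2 ^ wordBits κ n σ)
    (hk : 1 ≤ k) (hkn : k ≤ n) (hl : 1 ≤ l) (hln : l ≤ n) {A B : Fin n → Fin σ}
    (hd : 17 * (k * l) ≤ stringED A B) :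
    ENNReal.ofReal (1 - 1 / n) ≤ probOutputs gapProgram κ k l A B .large := by
  have hED := stringED_le_minCost A B (gapParams n k l).K
  have hKl : (gapParams n k l).K * l ≤ k * l := Nat.mul_le_mul_right _ gapParams_K_le
  have hKK : (gapParams n k l).K ≤ (gapParams n k l).K * l := Nat.le_mul_of_pos_right _ hl
  have hK1 := gapParams_K_pos (n := n) (l := l) hk
  rcases le_or_gt n (2 * (gapParams n k l).K * l) with h | h
  -- The immediate answer cannot be wrong here: `minCost ≤ n ≤ 2 * K * l` would give a distance of
  -- at most `6 * k * l`.
  · have h1 := minCost_le_length (c := mismatch (charAt A) (charAt B) (gapParams n k l).K)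
      (fun i s => mismatch_le_one _ _ _ i s) (k := 2 * (gapParams n k l).K) 0 n
    rw [mul_assoc] at h
    omega
  · refine ofReal_one_sub_le (gapParams_error_le hk hkn hl h hκ
      (mismatch_le_one (charAt A) (charAt B) (gapParams n k l).K) ?_) fun ω hω => ?_
    · rw [mul_assoc]
      omega
    · obtain ⟨s, t, he, -, hs⟩ := gapProgram_runs_of_lt (E := gapEnv κ A B ω) (σ := σ) hk hkn hl hln
        hκ h
      exact ⟨s, t, he, hs.trans (truth_false hω)⟩

end WordRAM

theorem two_pow_size_le_wordBits (n σ : ℕ) : (2 ^ n.size) ^ 16 ≤ 2 ^ wordBits 16 n σ := by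
  rw [← pow_mul, wordBits, mul_comm]
  exact Nat.pow_le_pow_right two_pos
    (Nat.mul_le_mul_left _ (Nat.size_le_size (Nat.le_add_right n σ)))

theorem mainTheorem3 :
    ∃ (P : WordRAM.Cmd) (κ c : ℕ) (C : ℝ), 0 < κ ∧ 0 < C ∧
      ∀ n σ k ℓ : ℕ, 1 ≤ k → k ≤ n → Real.sqrt k ≤ ℓ → ℓ ≤ n →
        ∀ A B : Fin n → Fin σ,
          (∀ ω, HaltsWithin P κ k ℓ A B ω
            (C * Real.log (n + 2) ^ c * (((n : ℝ) + (k : ℝ) ^ 2) * Real.sqrt k / ℓ))) ∧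
          ((stringED A B : ℝ) ≤ k / (C * Real.log (n + 2) ^ c) →
            ENNReal.ofReal (1 - 1 / n) ≤ probOutputs P κ k ℓ A B .small) ∧
          (C * (k * ℓ) ≤ (stringED A B : ℝ) →
            ENNReal.ofReal (1 - 1 / n) ≤ probOutputs P κ k ℓ A B .large) := by
  -- The exponent 5 is that of `n.size` in both bounds. `10 ^ 12` exceeds `4 * 10 ^ 8 * 3 ^ 5`
  -- (small distances, with 4 from `k ≤ 4 * r ^ 2`) and `3 * 10 ^ 8 * 3 ^ 5` (time), where `3 ^ 5`
  -- comes from `n.size ≤ 3 * log (n + 2)`.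
  refine ⟨WordRAM.gapProgram, 16, 5, 10 ^ 12, by norm_num, by norm_num, ?_⟩
  intro n σ k ℓ hk hkn hkl hln A B
  have hrl : k.sqrt ≤ ℓ := by exact_mod_cast (Real.nat_sqrt_le_real_sqrt (a := k)).trans hkl
  have hl : 1 ≤ ℓ := (Nat.sqrt_pos.2 hk).trans_le hrl
  have hκ := two_pow_size_le_wordBits n σ
  have hlog := WordRAM.size_le_log (hk.trans hkn)
  have hlam : (1 : ℝ) ≤ n.size := by exact_mod_cast WordRAM.size_pos_of_le hk hkn
  have hlog5 : (n.size : ℝ) ^ 5 ≤ 243 * Real.log (n + 2) ^ 5 := by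
    calc (n.size : ℝ) ^ 5 ≤ (3 * Real.log (n + 2)) ^ 5 := by gcongr
      _ = _ := by ring
  refine ⟨fun ω => ?_, fun hd => ?_, fun hd => ?_⟩
  · obtain ⟨s, t, he, ht⟩ := WordRAM.gapProgram_halts hκ hk hkn hl hln A B ω
    refine ⟨s, t, he, ?_⟩
    have hl' : (0 : ℝ) < ℓ := by exact_mod_cast hl
    rw [← mul_div_assoc, le_div_iff₀ hl']
    calc (t : ℝ) * ℓ ≤ 3 * 10 ^ 8 * n.size ^ 5 * (n * k.sqrt) := by exact_mod_cast ht
      _ ≤ 3 * 10 ^ 8 * (243 * Real.log (n + 2) ^ 5) * ((n + k ^ 2) * Real.sqrt k) := by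
        have h1 : (n : ℝ) ≤ n + (k : ℝ) ^ 2 := le_add_of_nonneg_right (by positivity)
        have h0 : 0 ≤ Real.log ((n : ℝ) + 2) := by linarith
        gcongr
        exact Real.nat_sqrt_le_real_sqrt
      _ = 3 * 10 ^ 8 * 243 * (Real.log (n + 2) ^ 5 * ((n + k ^ 2) * Real.sqrt k)) := by ring
      _ ≤ 10 ^ 12 * (Real.log (n + 2) ^ 5 * ((n + k ^ 2) * Real.sqrt k)) := by
        have h0 : 0 ≤ Real.log ((n : ℝ) + 2) := by linarith
        gcongr
        norm_num
      _ = _ := by ring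
  · refine WordRAM.gapProgram_outputs_small hκ hk hkn hl hln hrl ?_
    have h0 : 0 < Real.log ((n : ℝ) + 2) := by linarith
    rw [le_div_iff₀ (by positivity)] at hd
    have h1 : (4 * 10 ^ 8 * n.size ^ 5 * stringED A B : ℝ) ≤ k := by
      calc (4 * 10 ^ 8 * n.size ^ 5 * stringED A B : ℝ)
          ≤ 4 * 10 ^ 8 * (243 * Real.log (n + 2) ^ 5) * stringED A B := by gcongr
        _ = 4 * 10 ^ 8 * 243 * (Real.log (n + 2) ^ 5 * stringED A B) := by ring
        _ ≤ 10 ^ 12 * (Real.log (n + 2) ^ 5 * stringED A B) := by gcongr; norm_num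
        _ = stringED A B * (10 ^ 12 * Real.log (n + 2) ^ 5) := by ring
        _ ≤ k := hd
    have h2 : 4 * 10 ^ 8 * n.size ^ 5 * stringED A B ≤ k := by exact_mod_cast h1
    have h3 := WordRAM.le_sqrt_mul_sqrt hk
    nlinarith
  · refine WordRAM.gapProgram_outputs_large hκ hk hkn hl hln ?_
    have h1 : (17 * (k * ℓ) : ℝ) ≤ stringED A B := by
      refine le_trans ?_ hd
      gcongr
      norm_num
    exact_mod_cast h1
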